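/- Let $k$ be an algebraically closed field of characteristic zero. Let $\mathfrak g$ be the simple Lie algebra of type $E_6$ over $k$, with the short grading $\mathfrak g=\mathfrak g(-1)\oplus\mathfrak g(0)\oplus\mathfrak g(1)$ for which $\mathfrak g_0:=\mathfrak g(0)\cong\mathfrak{so}_{10}\oplus k$, and put $\mathfrak g_1:=\mathfrak g(-1)\oplus\mathfrak g(1)$. Let $G_0$ be the connected subgroup of the adjoint group of $\mathfrak g$ with Lie algebra $\mathfrak g_0$, and $SO_{10}$ (by abuse of notation) the connected subgroup of $G_0$ with Lie algebra $\mathfrak{so}_{10}$. Let $\mathfrak C(\mathfrak g_1)=\{(x,y)\in\mathfrak g_1\times\mathfrak g_1 : [x,y]=0\}$. A Cartan subspace of $\mathfrak g_1$ is a maximal abelian subspace $\mathfrak c\subset\mathfrak g_1$ consisting of semisimple elements; $\mathfrak c(1)$ denotes its image under the projection to $\mathfrak g(1)$. Closures are Zariski closures, and $G_0$ acts diagonally on pairs. Let $\varepsilon_1,\dots,\varepsilon_5$ be the standard weights of a Cartan subalgebra $\mathfrak t$ of $\mathfrak{so}_{10}$, and $\pi_1=\varepsilon_1$, $\pi_4=\tfrac12(\varepsilon_1+\varepsilon_2+\varepsilon_3+\varepsilon_4-\varepsilon_5)$,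 $\pi_5=\tfrac12(\varepsilon_1+\varepsilon_2+\varepsilon_3+\varepsilon_4+\varepsilon_5)$; $V(\varphi)$ is the irreducible representation of highest weight $\varphi$. Then, for a suitable identification $\mathfrak g(0)\cong\mathfrak{so}_{10}\oplus k$: 1. As representations of $\mathfrak{so}_{10}$, $\mathfrak g(1)=V(\pi_5)$ and $\mathfrak g(-1)=V(\pi_4)$ are the two half-spinor representations. 2. There is a Cartan subspace $\mathfrak c\subset\mathfrak g_1$ of dimension $2$ such that $\mathfrak c(1)$ is spanned by two weight vectors, of weights $\pi_5$ and $\tfrac12(\varepsilon_1-\varepsilon_2-\varepsilon_3-\varepsilon_4-\varepsilon_5)$. Let $h\in\mathfrak t$ be the element with $\varepsilon_1(h)=2$ and $\varepsilon_i(h)=0$ for $i\ge 2$. The one-parameter subgroup $\lambda\colon k^\times\to SO_{10}$, $\lambda(t)=t^{\operatorname{ad}h}$, satisfies $\lim_{t\to0}\lambda(t)v=0$ for all $v\in\mathfrak c(1)$; so it contracts $\mathfrak c(1)\times\mathfrak c(1)$ to $0$. 3. There is a subrepresentation $W\cong V(\pi_1)$ of $S^2(\mathfrak g(1)^*)$ and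 a nonzero $SO_{10}$-invariant polynomial function $f$ on $\mathfrak g(1)\times\mathfrak g(1)$, homogeneous of degree $4$, which lies in $W\otimes W\subset S^2(\mathfrak g(1)^*)\otimes S^2(\mathfrak g(1)^*)$ and spans the space of $SO_{10}$-invariants in $W\otimes W$. 4. For every Cartan subspace $\mathfrak c$ of $\mathfrak g_1$, $f$ vanishes on $\overline{G_0(\mathfrak c(1)\times\mathfrak c(1))}$, and $\overline{G_0(\mathfrak c(1)\times\mathfrak c(1))}\ne\mathfrak g(1)\times\mathfrak g(1)$; that is, condition $(\spadesuit)$, which asks for equality here, fails. 5. The commuting variety $\mathfrak C(\mathfrak g_1)$ is reducible. -/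

import Mathlib

open Topology

attribute [local instance 100] LieRing.ofAssociativeRing

namespace E6Pair

section Zariski

/-! ### Polynomial functions and the Zariski topology on a vector space -/

/-- The function on `V` given by a polynomial in the linear forms on `V`. -/
noncomputable def polyFun {k V : Type*} [Field k] [AddCommGroup V] [Module k V]
    (p : MvPolynomial (Module.Dual k V) k) : V → k :=
  fun v => MvPolynomial.eval (fun φ : Module.Dual k V => φ v) p

/-- `f` is a polynomial function on `V`, homogeneous of degree `d`. -/
def IsHomogeneousPolyFun (k : Type*) {V : Type*} [Field k] [AddCommGroup V] [Module k V]
    (d : ℕ) (f : V → k) : Prop :=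
  ∃ p : MvPolynomial (Module.Dual k V) k, p.IsHomogeneous d ∧ f = polyFun p

/-- The Zariski topology on `V`, generated by the nonvanishing loci of polynomial functions. -/
@[reducible]
def zariski (k V : Type*) [Field k] [AddCommGroup V] [Module k V] : TopologicalSpace V :=
  TopologicalSpace.generateFrom
    {U | ∃ p : MvPolynomial (Module.Dual k V) k, U = {v | polyFun p v ≠ 0}}

end Zariski

section Groups

/-! ### The connected group attached to an algebraic subalgebra -/

variable {k L : Type*} [Field k] [LieRing L] [LieAlgebra k L]

/-- `λ` is the multiplicative one-parameter subgroup `t ↦ t ^ (ad h)` of `GL(L)`: `ad h` is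
diagonalizable with integer eigenvalues, and `λ t` is multiplication by `t ^ i` on the
`i`-eigenspace. -/
def IsMultOneParam (h : L) (lam : kˣ →* (L ≃ₗ[k] L)) : Prop :=
  (⨆ i : ℤ, (LieAlgebra.ad k L h).eigenspace (i : k)) = ⊤ ∧
    ∀ (t : kˣ) (i : ℤ), ∀ x ∈ (LieAlgebra.ad k L h).eigenspace (i : k),
      lam t x = ((t ^ i : kˣ) : k) • x

/-- `g = exp (ad n)` with `ad n` nilpotent. -/
def IsExpAd (n : L) (g : L ≃ₗ[k] L) : Prop :=
  ∃ N : ℕ, LieAlgebra.ad k L n ^ N = 0 ∧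
    ∀ x, g x = ∑ j ∈ Finset.range N, ((Nat.factorial j : k)⁻¹) • (LieAlgebra.ad k L n ^ j) x

/-- The connected algebraic subgroup of `GL(L)` with Lie algebra `ad m`, for an algebraic
subalgebra `m` of `L` (characteristic zero, `k` algebraically closed). A connected algebraic group
is generated by its additive and multiplicative one-parameter subgroups; these are
`exp (k · ad n)` with `n ∈ m` and `ad n` nilpotent, and `t ↦ t ^ (ad h)` with `h ∈ m` and `ad h`
diagonalizable with integer eigenvalues. -/
def connectedSubgroup (m : LieSubalgebra k L) : Subgroup (L ≃ₗ[k] L) :=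
  Subgroup.closure
    ({g | ∃ n ∈ m, IsExpAd n g} ∪
      {g | ∃ h ∈ m, ∃ lam : kˣ →* (L ≃ₗ[k] L), IsMultOneParam h lam ∧ ∃ t, g = lam t})

/-- `lim_{t → 0} λ(t) v = 0`: the curve `t ↦ λ(t) v` extends to a polynomial curve with value `0`
at `t = 0`. -/
def ContractsToZero (lam : kˣ →* (L ≃ₗ[k] L)) (v : L) : Prop :=
  ∃ (N : ℕ) (w : ℕ → L), ∀ t : kˣ,
    lam t v = ∑ i ∈ Finset.range N, ((t : k) ^ (i + 1)) • w i

end Groups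

section SymmetricPairs

/-! ### Short gradings, commuting varieties, Cartan subspaces -/

variable {k L : Type*} [Field k] [LieRing L] [LieAlgebra k L]

/-- The piece of degree `i` of the grading of `L` by the eigenvalues of `ad z`. -/
def piece (z : L) (i : k) : Submodule k L :=
  (LieAlgebra.ad k L z).eigenspace i

theorem mem_piece {z : L} {i : k} {x : L} : x ∈ piece z i ↔ ⁅z, x⁆ = i • x := by
  simp [piece]

/-- The subalgebra `𝔤₀ = 𝔤(0)`. -/
def even (k : Type*) {L : Type*} [Field k] [LieRing L] [LieAlgebra k L] (z : L) :
    LieSubalgebra k L :=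
  { piece z (0 : k) with
    lie_mem' := by
      intro x y hx hy
      have hx' : ⁅z, x⁆ = 0 := by simpa using mem_piece.1 hx
      have hy' : ⁅z, y⁆ = 0 := by simpa using mem_piece.1 hy
      refine mem_piece.2 ?_
      rw [leibniz_lie, hx', hy']
      simp }

/-- The space `𝔤₁ = 𝔤(-1) ⊕ 𝔤(1)`. -/
def odd (k : Type*) {L : Type*} [Field k] [LieRing L] [LieAlgebra k L] (z : L) : Submodule k L :=
  piece z (-1 : k) ⊔ piece z (1 : k)

/-- The commuting variety of a subspace `p` of `L`. -/
def commutingVariety (p : Submodule k L) : Set (L × L) :=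
  {q | q.1 ∈ p ∧ q.2 ∈ p ∧ ⁅q.1, q.2⁆ = 0}

/-- `c` is an abelian subspace of `p` consisting of semisimple elements of `L`. -/
def IsAbelianSemisimple (p c : Submodule k L) : Prop :=
  c ≤ p ∧ (∀ x ∈ c, ∀ y ∈ c, ⁅x, y⁆ = 0) ∧ ∀ x ∈ c, (LieAlgebra.ad k L x).IsSemisimple

/-- A Cartan subspace of `p`: a maximal abelian subspace consisting of semisimple elements. -/
def IsCartanSubspace (p c : Submodule k L) : Prop :=
  Maximal (IsAbelianSemisimple p) c

/-- For `c ≤ 𝔤(-1) ⊕ 𝔤(1)`, the image `c(1)` of `c` under the projection to `𝔤(1)`, that is, the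
set of `x ∈ 𝔤(1)` such that `x + y ∈ c` for some `y ∈ 𝔤(-1)`. -/
def projOne (z : L) (c : Submodule k L) : Submodule k L :=
  (c ⊔ piece z (-1 : k)) ⊓ piece z (1 : k)

/-- The set `G₀ (c(1) × c(1))`, with `G₀` acting diagonally. -/
def sweep (z : L) (c : Submodule k L) : Set (L × L) :=
  {q | ∃ g ∈ connectedSubgroup (even k z), ∃ a ∈ projOne z c, ∃ b ∈ projOne z c, q = (g a, g b)}

/-- The condition that `G₀ (c(1) × c(1))` is Zariski dense in `𝔤(1) × 𝔤(1)`. -/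
def Spade (z : L) (c : Submodule k L) : Prop :=
  closure[zariski k (L × L)] (sweep z c) = (piece z (1 : k) : Set L) ×ˢ (piece z (1 : k) : Set L)

end SymmetricPairs

section SO10

/-! ### The Lie algebra `𝔰𝔬₁₀` and its highest weight representations -/

variable (k : Type*) [Field k]

/-- `𝔰𝔬₁₀`, for the form `(u, v) ↦ ∑ i, (u i * v (i + 5) + u (i + 5) * v i)` on `k ^ 10`. -/
abbrev so10 := LieAlgebra.Orthogonal.typeD (Fin 5) k

variable {k}

/-- The element `diag (a, -a)` of the diagonal Cartan subalgebra `𝔱` of `𝔰𝔬₁₀`, on which the weight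
`ε i` takes the value `a i`. -/
def cartanElt (a : Fin 5 → k) : so10 k :=
  ⟨Matrix.fromBlocks (Matrix.diagonal a) 0 0 (-Matrix.diagonal a), by
    simp only [LieAlgebra.Orthogonal.typeD, mem_skewAdjointMatricesLieSubalgebra,
      mem_skewAdjointMatricesSubmodule, Matrix.IsSkewAdjoint, Matrix.IsAdjointPair,
      LieAlgebra.Orthogonal.JD, Matrix.fromBlocks_transpose, Matrix.fromBlocks_multiply,
      Matrix.fromBlocks_neg]
    simp⟩

/-- `x` lies in the sum of the root spaces of `𝔰𝔬₁₀` for the positive roots `ε i - ε j` and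
`ε i + ε j`, `i < j`. -/
def IsPositive (x : so10 k) : Prop :=
  x.1.toBlocks₂₁ = 0 ∧ ∀ i j, j ≤ i → x.1.toBlocks₁₁ i j = 0

/-- `v` is a vector of weight `∑ i, w i • ε i`. -/
def IsWeightVector {M : Type*} [AddCommGroup M] [Module k M] (ρ : so10 k → Module.End k M)
    (w : Fin 5 → k) (v : M) : Prop :=
  ∀ a : Fin 5 → k, ρ (cartanElt a) v = (∑ i, w i * a i) • v

/-- `U` is a subrepresentation isomorphic to `V(w)`: it is irreducible and has a highest weight
vector of weight `w = ∑ i, w i • ε i`. -/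
structure IsHighestWeightIrrep {M : Type*} [AddCommGroup M] [Module k M]
    (ρ : so10 k → Module.End k M) (w : Fin 5 → k) (U : Submodule k M) : Prop where
  stable : ∀ x, ∀ u ∈ U, ρ x u ∈ U
  irreducible : ∀ W ≤ U, (∀ x, ∀ u ∈ W, ρ x u ∈ W) → W = ⊥ ∨ W = U
  highest : ∃ v ∈ U, v ≠ 0 ∧ IsWeightVector ρ w v ∧ ∀ x, IsPositive x → ρ x v = 0

/-- The fundamental weight `π₁ = ε₁`. -/
def pi1 (k : Type*) [Field k] : Fin 5 → k := ![1, 0, 0, 0, 0]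

/-- The fundamental weight `π₄ = (ε₁ + ε₂ + ε₃ + ε₄ - ε₅) / 2`. -/
def pi4 (k : Type*) [Field k] : Fin 5 → k := ![1 / 2, 1 / 2, 1 / 2, 1 / 2, -1 / 2]

/-- The fundamental weight `π₅ = (ε₁ + ε₂ + ε₃ + ε₄ + ε₅) / 2`. -/
def pi5 (k : Type*) [Field k] : Fin 5 → k := ![1 / 2, 1 / 2, 1 / 2, 1 / 2, 1 / 2]

/-- The weight `(ε₁ - ε₂ - ε₃ - ε₄ - ε₅) / 2`. -/
def pi5' (k : Type*) [Field k] : Fin 5 → k := ![1 / 2, -1 / 2, -1 / 2, -1 / 2, -1 / 2]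

/-- The action of an endomorphism `T` of `M` on `S²(M*)`, the space of quadratic forms on `M`,
induced by the dual action: `(T Q) v = - B_Q (v, T v)`, with `B_Q` the polar form of `Q`. -/
noncomputable def quadAction {M : Type*} [AddCommGroup M] [Module k M] (T : Module.End k M) :
    Module.End k (QuadraticForm k M) where
  toFun Q := -LinearMap.BilinMap.toQuadraticMap (Q.polarBilin.compl₂ T)
  map_add' Q Q' := by
    ext v
    simp [QuadraticMap.polar]
    ring
  map_smul' a Q := by
    ext v
    simp [QuadraticMap.polar]
    ring

end SO10

section E6

/-! ### The Lie algebra `E₆`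

`E₆` is the Lie algebra of all endomorphisms of the 27-dimensional split exceptional Jordan algebra
(realised as triples of `3 × 3` matrices) that annihilate its cubic norm. -/

variable (k : Type*) [Field k]

/-- The space of the split exceptional Jordan algebra. -/
abbrev J27 := Matrix (Fin 3) (Fin 3) k × Matrix (Fin 3) (Fin 3) k × Matrix (Fin 3) (Fin 3) k

variable {k}

/-- The cubic norm `N(A, B, C) = det A + det B + det C - tr (A B C)`. -/
def cubicNorm (v : J27 k) : k :=
  v.1.det + v.2.1.det + v.2.2.det - (v.1 * v.2.1 * v.2.2).trace

/-- The derivative of the cubic norm at the point `v` in the direction `w`. -/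
def cubicNormDeriv (v w : J27 k) : k :=
  (v.1.adjugate * w.1).trace + (v.2.1.adjugate * w.2.1).trace + (v.2.2.adjugate * w.2.2).trace
    - (w.1 * v.2.1 * v.2.2).trace - (v.1 * w.2.1 * v.2.2).trace - (v.1 * v.2.1 * w.2.2).trace

theorem trace_adjugate_mul (A B : Matrix (Fin 3) (Fin 3) k) :
    (A.adjugate * B).trace =
      (A 1 1 * A 2 2 - A 1 2 * A 2 1) * B 0 0 - (A 0 1 * A 2 2 - A 0 2 * A 2 1) * B 1 0
      + (A 0 1 * A 1 2 - A 0 2 * A 1 1) * B 2 0 - (A 1 0 * A 2 2 - A 1 2 * A 2 0) * B 0 1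
      + (A 0 0 * A 2 2 - A 0 2 * A 2 0) * B 1 1 - (A 0 0 * A 1 2 - A 0 2 * A 1 0) * B 2 1
      + (A 1 0 * A 2 1 - A 1 1 * A 2 0) * B 0 2 - (A 0 0 * A 2 1 - A 0 1 * A 2 0) * B 1 2
      + (A 0 0 * A 1 1 - A 0 1 * A 1 0) * B 2 2 := by
  rw [Matrix.adjugate_fin_three, Matrix.trace_fin_three]
  simp only [Matrix.mul_apply, Fin.sum_univ_three]
  simp
  ring

theorem det_add_smul (A B : Matrix (Fin 3) (Fin 3) k) (t : k) :
    (A + t • B).det =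
      A.det + t * (A.adjugate * B).trace + t ^ 2 * (B.adjugate * A).trace + t ^ 3 * B.det := by
  simp only [trace_adjugate_mul, Matrix.det_fin_three, Matrix.add_apply, Matrix.smul_apply,
    smul_eq_mul]
  ring

/-- `cubicNormDeriv v w` is indeed the derivative of the cubic norm. -/
theorem cubicNorm_add_smul (v w : J27 k) (t : k) :
    cubicNorm (v + t • w) =
      cubicNorm v + t * cubicNormDeriv v w + t ^ 2 * cubicNormDeriv w v + t ^ 3 * cubicNorm w := by
  simp only [cubicNorm, cubicNormDeriv, Prod.fst_add, Prod.snd_add, Prod.smul_fst, Prod.smul_snd,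
    det_add_smul, Matrix.add_mul, Matrix.mul_add, Matrix.smul_mul, Matrix.mul_smul,
    Matrix.trace_add, Matrix.trace_smul, smul_eq_mul]
  ring

theorem cubicNormDeriv_add_right (v w w' : J27 k) :
    cubicNormDeriv v (w + w') = cubicNormDeriv v w + cubicNormDeriv v w' := by
  simp only [cubicNormDeriv, Prod.fst_add, Prod.snd_add, Matrix.add_mul, Matrix.mul_add,
    Matrix.trace_add]
  ring

theorem cubicNormDeriv_smul_right (v w : J27 k) (a : k) :
    cubicNormDeriv v (a • w) = a * cubicNormDeriv v w := by
  simp only [cubicNormDeriv, Prod.smul_fst, Prod.smul_snd, Matrix.smul_mul, Matrix.mul_smul,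
    Matrix.trace_smul, smul_eq_mul]
  ring

theorem cubicNormDeriv_neg_right (v w : J27 k) :
    cubicNormDeriv v (-w) = -cubicNormDeriv v w := by
  simpa using cubicNormDeriv_smul_right v w (-1)

/-- The polarization of the cubic norm. -/
def cubicPolar (u v w : J27 k) : k :=
  cubicNormDeriv (u + v) w - cubicNormDeriv u w - cubicNormDeriv v w

theorem cubicPolar_right_comm (u v w : J27 k) : cubicPolar u v w = cubicPolar u w v := by
  simp only [cubicPolar, cubicNormDeriv, trace_adjugate_mul, Prod.fst_add, Prod.snd_add,
    Matrix.add_mul, Matrix.mul_add, Matrix.trace_add, Matrix.add_apply]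
  ring

theorem cubicPolar_neg (u v w : J27 k) : cubicPolar u (-v) w = -cubicPolar u v w := by
  rw [cubicPolar_right_comm, cubicPolar_right_comm u v w]
  simp only [cubicPolar, cubicNormDeriv_neg_right]
  ring

theorem cubicNormDeriv_neg_left (v w : J27 k) : cubicNormDeriv (-v) w = cubicNormDeriv v w := by
  simp only [cubicNormDeriv, trace_adjugate_mul, Prod.fst_neg, Prod.snd_neg, Matrix.neg_mul,
    Matrix.mul_neg, Matrix.trace_neg, Matrix.neg_apply]
  ring

variable [CharZero k]

theorem cubicNormDeriv_of_annihilates {X : Module.End k (J27 k)}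
    (hX : ∀ v, cubicNormDeriv v (X v) = 0) (v w : J27 k) :
    cubicNormDeriv v (X w) = -cubicPolar v w (X v) := by
  have key : ∀ w, cubicPolar v w (X v) + cubicNormDeriv v (X w) +
      (cubicPolar v w (X w) + cubicNormDeriv w (X v)) = 0 := by
    intro w
    have h := hX (v + w)
    have h1 := hX v
    have h2 := hX w
    rw [map_add, cubicNormDeriv_add_right] at h
    simp only [cubicPolar]
    linear_combination h - h1 - h2
  have h1 := key w
  have h2 := key (-w)
  rw [map_neg, cubicPolar_neg, cubicPolar_neg, cubicNormDeriv_neg_right, cubicNormDeriv_neg_left]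
    at h2
  have h3 : cubicPolar v w (-X w) = -cubicPolar v w (X w) := by
    simp only [cubicPolar, cubicNormDeriv_neg_right]
    ring
  rw [h3] at h2
  have h4 : (2 : k) * (cubicNormDeriv v (X w) + cubicPolar v w (X v)) = 0 := by
    linear_combination h1 - h2
  have h5 := (mul_eq_zero.1 h4).resolve_left two_ne_zero
  linear_combination h5

variable (k) in
/-- The Lie algebra `E₆`. -/
def e6 : LieSubalgebra k (Module.End k (J27 k)) where
  carrier := {X | ∀ v, cubicNormDeriv v (X v) = 0}
  add_mem' := by
    intro X Y hX hY v
    rw [LinearMap.add_apply, cubicNormDeriv_add_right, hX v, hY v, add_zero]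
  zero_mem' := by
    intro v
    simpa using cubicNormDeriv_smul_right v 0 0
  smul_mem' := by
    intro a X hX v
    rw [LinearMap.smul_apply, cubicNormDeriv_smul_right, hX v, mul_zero]
  lie_mem' := by
    intro X Y hX hY v
    have h1 := cubicNormDeriv_of_annihilates hX v (Y v)
    have h2 := cubicNormDeriv_of_annihilates hY v (X v)
    have h3 := cubicPolar_right_comm v (X v) (Y v)
    have h4 : ⁅X, Y⁆ v = X (Y v) + -(Y (X v)) := by
      rw [Ring.lie_def, LinearMap.sub_apply, sub_eq_add_neg]
      rfl
    rw [h4, cubicNormDeriv_add_right, cubicNormDeriv_neg_right, h1, h2]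
    linear_combination h3

variable (k) in
/-- The matrix `diag (2/3, -1/3, -1/3)`. -/
def gradingMatrix : Matrix (Fin 3) (Fin 3) k :=
  Matrix.diagonal ![2 / 3, -1 / 3, -1 / 3]

variable (k) in
/-- The element of `E₆` that defines its short grading
`𝔤 = 𝔤(-1) ⊕ 𝔤(0) ⊕ 𝔤(1)`, as an endomorphism of the 27-dimensional space. Its
eigenvalues there are `4/3`, `1/3`, `-2/3`, with multiplicities `1`, `16`, `10`. -/
def gradingEnd : Module.End k (J27 k) where
  toFun v := (gradingMatrix k * v.1 + v.1 * gradingMatrix k,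
    -(gradingMatrix k * v.2.1), -(v.2.2 * gradingMatrix k))
  map_add' v w := by
    simp only [Prod.fst_add, Prod.snd_add, Matrix.mul_add, Matrix.add_mul, Prod.mk_add_mk,
      Prod.mk.injEq]
    refine ⟨?_, ?_, ?_⟩ <;> abel
  map_smul' a v := by
    simp [smul_add]

theorem gradingEnd_mem : gradingEnd k ∈ e6 k := by
  intro v
  obtain ⟨A, B, C⟩ := v
  have h0 : (gradingMatrix k).trace = 0 := by
    simp [gradingMatrix, Fin.sum_univ_three]
    norm_num
  have hl : ∀ M : Matrix (Fin 3) (Fin 3) k, (M.adjugate * (gradingMatrix k * M)).trace = 0 := by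
    intro M
    rw [Matrix.trace_mul_comm, Matrix.mul_assoc, Matrix.mul_adjugate, Matrix.mul_smul,
      Matrix.mul_one, Matrix.trace_smul, h0, smul_zero]
  have hr : ∀ M : Matrix (Fin 3) (Fin 3) k, (M.adjugate * (M * gradingMatrix k)).trace = 0 := by
    intro M
    rw [← Matrix.mul_assoc, Matrix.adjugate_mul, Matrix.smul_mul, Matrix.one_mul,
      Matrix.trace_smul, h0, smul_zero]
  have hc : (A * B * (C * gradingMatrix k)).trace = (gradingMatrix k * A * B * C).trace := by
    rw [← Matrix.mul_assoc, Matrix.trace_mul_comm]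
    simp only [Matrix.mul_assoc]
  simp only [cubicNormDeriv, gradingEnd, LinearMap.coe_mk, AddHom.coe_mk, Matrix.mul_add,
    Matrix.add_mul, Matrix.mul_neg, Matrix.neg_mul, Matrix.trace_add, Matrix.trace_neg, hl, hr, hc]
  simp only [Matrix.mul_assoc]
  ring

variable (k) in
/-- The grading element of `E₆`. -/
def gradingElt : e6 k := ⟨gradingEnd k, gradingEnd_mem⟩

end E6

section Pair

/-! ### Objects attached to an identification of `𝔤(0)` with `𝔰𝔬₁₀ ⊕ k` -/

variable {k : Type*} [Field k] [CharZero k]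

/-- The graded pieces `𝔤(i)` of `E₆`. -/
abbrev g (k : Type*) [Field k] [CharZero k] (i : k) : Submodule k (e6 k) :=
  piece (gradingElt k) i

/-- The subalgebra `𝔤₀ = 𝔤(0)` of `E₆`. -/
abbrev g0 (k : Type*) [Field k] [CharZero k] : LieSubalgebra k (e6 k) :=
  even k (gradingElt k)

/-- The subspace `𝔤₁ = 𝔤(-1) ⊕ 𝔤(1)` of `E₆`. -/
abbrev g1 (k : Type*) [Field k] [CharZero k] : Submodule k (e6 k) :=
  odd k (gradingElt k)

/-- The embedding of `𝔰𝔬₁₀` in `E₆` given by an identification of `𝔤(0)` with `𝔰𝔬₁₀ ⊕ k`. -/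
def so10Embedding (ψ : (so10 k × k) ≃ₗ⁅k⁆ g0 k) : so10 k →ₗ⁅k⁆ e6 k :=
  (g0 k).incl.comp (ψ.toLieHom.comp (LieHom.inl k (so10 k) k))

/-- The adjoint action of `𝔰𝔬₁₀` on `E₆`. -/
def so10Ad (ψ : (so10 k × k) ≃ₗ⁅k⁆ g0 k) (x : so10 k) : Module.End k (e6 k) :=
  LieAlgebra.ad k (e6 k) (so10Embedding ψ x)

theorem so10Ad_mem (ψ : (so10 k × k) ≃ₗ⁅k⁆ g0 k) (x : so10 k) {i : k} :
    ∀ v ∈ g k i, so10Ad ψ x v ∈ g k i := by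
  intro v hv
  have hx : ⁅gradingElt k, so10Embedding ψ x⁆ = 0 := by
    have h : (so10Embedding ψ x : e6 k) ∈ piece (gradingElt k) (0 : k) :=
      (ψ (LieHom.inl k (so10 k) k x)).2
    simpa using mem_piece.1 h
  refine mem_piece.2 ?_
  rw [so10Ad, LieAlgebra.ad_apply, leibniz_lie, hx, zero_lie, zero_add, mem_piece.1 hv, lie_smul]

/-- The action of `𝔰𝔬₁₀` on `S²(𝔤(1)*)`, the space of quadratic forms on `𝔤(1)`. -/
noncomputable def so10Quad (ψ : (so10 k × k) ≃ₗ⁅k⁆ g0 k) (x : so10 k) :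
    Module.End k (QuadraticForm k (g k 1)) :=
  quadAction ((so10Ad ψ x).restrict (so10Ad_mem ψ x))

/-- The connected subgroup of the adjoint group of `E₆` with Lie algebra `𝔰𝔬₁₀` (the image of
the spin group). -/
def SO10 (ψ : (so10 k × k) ≃ₗ⁅k⁆ g0 k) : Subgroup (e6 k ≃ₗ[k] e6 k) :=
  connectedSubgroup (so10Embedding ψ).range

/-- The function `f` on `𝔤(1) × 𝔤(1)` is invariant under the diagonal action of a subgroup `Γ` of
`GL(E₆)` that preserves `𝔤(1)`. -/
def IsInvariant (Γ : Subgroup (e6 k ≃ₗ[k] e6 k)) (f : g k 1 × g k 1 → k) : Prop :=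
  ∀ s ∈ Γ, ∃ T : Module.End k (g k 1), (∀ x, (T x : e6 k) = s x) ∧
    ∀ x y, f (T x, T y) = f (x, y)

/-- The image of `W ⊗ W` in the space of polynomial functions on `𝔤(1) × 𝔤(1)`, for a subspace `W`
of `S²(𝔤(1)*)`: the span of the functions `(x, y) ↦ Q x * Q' y` with `Q, Q' ∈ W`. -/
def tensorSquare (W : Submodule k (QuadraticForm k (g k 1))) :
    Submodule k (g k 1 × g k 1 → k) :=
  Submodule.span k {f | ∃ Q ∈ W, ∃ Q' ∈ W, f = fun q => Q q.1 * Q' q.2}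

end Pair

end E6Pair

/-! The 27-dimensional space splits under `𝔤(0)` as 1 + 16 + 10, and in these coordinates the cubic
norm is `(α, s, u) ↦ (α * form u u - ⟨u·s, s⟩) / 2`, where `u·s` is Clifford multiplication
(`cubicNormDeriv_eq`). Write `B = spinPair`, the symmetric map from pairs of spinors to vectors with
`form w (B(s,t)) = ⟨w·s, t⟩`. Two identities carry the argument: the Clifford relation
`spinMul_swap_spinMul`, and `B(s,s)·s = 0` (`spinMul_spinPair_self`). The spaces `𝔤(1)` and `𝔤(-1)`
consist of the elements `hi η` and `lo ξ`, and `𝔤(0)` of the elements `mid (A, c)`; that nothing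
else occurs is `exists_decomp`.

The invariant is `f(η, η') = form (B(η,η)) (B(η',η'))`. Let `N(η, ξ)` be the natural pairing of
`B(η,η)` with `B(ξ,ξ)`. The heart of the proof is that `N * f = 0` on commuting pairs
(`form_spinPair_eq_zero_of_commute`). If `hi η + lo ξ` and `hi η' + lo ξ'` commute, then `B(ξ', w·η)
= B(ξ, w·η')` for every vector `w`. Take `w = b = B(η,η)`: the left side vanishes, so `σ = b·η'`
satisfies `B(ξ,σ) = 0`, and by polarization `B(ξ,ξ)·σ = 0`. Also `b·σ = 0`, because `b` is
isotropic. The Clifford relation for `b` and `B(ξ,ξ)` now gives `N σ = 0`, while `f = ⟨σ, η'⟩`.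

Reducibility follows at once. The commuting variety contains `𝔤(1) × 𝔤(1)`, where `f` is not
identically zero, and the diagonal, where `N` is not identically zero; so the loci `f ≠ 0` and `N ≠
0` are nonempty, open and disjoint in it.

For Cartan subspaces the case `N = 0` has to be handled as well. If `x = hi η + lo ξ` is semisimple
and `N = 0`, then `(ad x)^3` kills a suitable element of `𝔤(0)`, hence so does `ad x`, and this
forces `B(η,η) = 0` (`spinPair_eq_zero_of_isSemisimple`). So `f` vanishes on the projections to
`𝔤(1)` of commuting semisimple pairs. The group `G₀` acts by automorphisms that preserve the grading
and so permutes such pairs; `f` therefore vanishes on the sweep and on its closure, and `f ≠ 0`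
refutes density.

The subrepresentation `W` consists of the quadratic forms obtained by pairing `B(η,η)` with a fixed
vector. An element of `W ⊗ W` is a bilinear form on vectors evaluated at `(B(η,η), B(η',η'))`;
invariance under unipotent elements `1 + u ∧ v` makes it proportional to `form`
(`bilin_eq_smul_form`).

That the algebra is of type `E₆` is proved with explicit Chevalley generators. Each Serre relation
asserts that an element vanishes whose weight is neither zero nor a root, which a Weyl-invariant
norm detects (`eq_zero_of_isNotRoot`); generation is `eq_top_of_serre`. -/

namespace E6Pair

/-! ### The half-spinor modules of `𝔰𝔬₁₀`

A half-spinor module and its dual are both realised on `k ^ 16`, in dual bases of weight vectors.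
The Clifford action `spinMul w` of a vector `w` of `k ^ 10` is a symmetric matrix of size 16. -/

section Spinors

variable {k : Type*} [Field k]

/-- The vector representation of `𝔰𝔬₁₀`. -/
abbrev Vec (k : Type*) := Fin 5 ⊕ Fin 5 → k

/-- A half-spinor representation of `𝔰𝔬₁₀`. -/
abbrev Spin (k : Type*) := Fin 16 → k

/-- The coordinates of `spinMul w s`. -/
def spinMulFun (w : Vec k) (s : Spin k) : Spin k := fun i => match i.val with
  | 0 => w (.inl 0) * s 14 - w (.inl 1) * s 13 + w (.inl 2) * s 11 + w (.inl 3) * s 7 + w (.inl 4) * s 15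
  | 1 => w (.inl 1) * s 12 - w (.inl 2) * s 10 + w (.inl 3) * s 6 + w (.inr 0) * s 15 - w (.inr 4) * s 14
  | 2 => w (.inl 0) * s 12 + w (.inl 2) * s 9 - w (.inl 3) * s 5 - w (.inr 1) * s 15 - w (.inr 4) * s 13
  | 3 => w (.inl 2) * s 8 + w (.inl 3) * s 4 + w (.inl 4) * s 12 + w (.inr 0) * s 13 + w (.inr 1) * s 14
  | 4 => w (.inl 0) * s 10 + w (.inl 1) * s 9 + w (.inl 3) * s 3 + w (.inr 2) * s 15 - w (.inr 4) * s 11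
  | 5 => w (.inl 1) * s 8 - w (.inl 3) * s 2 + w (.inl 4) * s 10 + w (.inr 0) * s 11 - w (.inr 2) * s 14
  | 6 => w (.inl 0) * s 8 + w (.inl 3) * s 1 - w (.inl 4) * s 9 - w (.inr 1) * s 11 - w (.inr 2) * s 13
  | 7 => w (.inl 3) * s 0 + w (.inr 0) * s 9 - w (.inr 1) * s 10 - w (.inr 2) * s 12 + w (.inr 4) * s 8
  | 8 => w (.inl 0) * s 6 + w (.inl 1) * s 5 + w (.inl 2) * s 3 - w (.inr 3) * s 15 + w (.inr 4) * s 7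
  | 9 => w (.inl 1) * s 4 + w (.inl 2) * s 2 - w (.inl 4) * s 6 + w (.inr 0) * s 7 - w (.inr 3) * s 14
  | 10 => w (.inl 0) * s 4 - w (.inl 2) * s 1 + w (.inl 4) * s 5 - w (.inr 1) * s 7 - w (.inr 3) * s 13
  | 11 => w (.inl 2) * s 0 + w (.inr 0) * s 5 - w (.inr 1) * s 6 + w (.inr 3) * s 12 - w (.inr 4) * s 4
  | 12 => w (.inl 0) * s 2 + w (.inl 1) * s 1 + w (.inl 4) * s 3 - w (.inr 2) * s 7 + w (.inr 3) * s 11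
  | 13 => -(w (.inl 1) * s 0) + w (.inr 0) * s 3 - w (.inr 2) * s 6 - w (.inr 3) * s 10 - w (.inr 4) * s 2
  | 14 => w (.inl 0) * s 0 + w (.inr 1) * s 3 - w (.inr 2) * s 5 - w (.inr 3) * s 9 - w (.inr 4) * s 1
  | _ => w (.inl 4) * s 0 + w (.inr 0) * s 1 - w (.inr 1) * s 2 + w (.inr 2) * s 4 - w (.inr 3) * s 8

/-- The Clifford action of a vector on a half-spinor. -/
def spinMul : Vec k →ₗ[k] Spin k →ₗ[k] Spin k :=
  LinearMap.mk₂ k spinMulFun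
    (by intro w w' s; ext i; fin_cases i <;> simp [spinMulFun] <;> ring)
    (by intro c w s; ext i; fin_cases i <;> simp [spinMulFun] <;> ring)
    (by intro w s s'; ext i; fin_cases i <;> simp [spinMulFun] <;> ring)
    (by intro c w s; ext i; fin_cases i <;> simp [spinMulFun] <;> ring)

theorem spinMul_apply (w : Vec k) (s : Spin k) : spinMul w s = spinMulFun w s := rfl

/-- The identification of the vector representation with its dual. -/
def swap : Vec k →ₗ[k] Vec k := LinearMap.funLeft k k Sum.swap

theorem swap_apply (w : Vec k) (a : Fin 5 ⊕ Fin 5) : swap w a = w a.swap := rfl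

@[simp] theorem swap_swap (w : Vec k) : swap (swap w) = w := by
  ext a; simp [swap_apply]

/-- The invariant form on the vector representation. -/
def form : Vec k →ₗ[k] Vec k →ₗ[k] k :=
  LinearMap.mk₂ k (fun w w' => w ⬝ᵥ swap w') (by intros; simp [add_dotProduct])
    (by intros; simp [smul_dotProduct]) (by intros; simp [dotProduct_add])
    (by intros; simp [dotProduct_smul])

theorem form_apply (w w' : Vec k) : form w w' = w ⬝ᵥ swap w' := rfl

theorem form_comm (w w' : Vec k) : form w w' = form w' w := by
  simp only [form_apply, dotProduct, Fintype.sum_sum_type, swap_apply, Sum.swap_inl, Sum.swap_inr]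
  rw [add_comm]
  simp only [mul_comm]

@[simp] theorem form_swap_swap (w w' : Vec k) : form (swap w) (swap w') = form w w' := by
  rw [form_apply, swap_swap, dotProduct_comm, ← form_apply, form_comm]

theorem form_swap_left (w w' : Vec k) : form (swap w) w' = form w (swap w') := by
  rw [← form_swap_swap, swap_swap]

theorem eq_of_form {w w' : Vec k} (h : ∀ v, form v w = form v w') : w = w' := by
  ext a
  simpa [form_apply, swap_apply] using h (Pi.single a.swap 1)

/-- The coordinates of `spinPair s t`. -/
def spinPairFun (s t : Spin k) : Vec k
  | .inl 0 => s 15 * t 1 + s 13 * t 3 + s 11 * t 5 + s 9 * t 7 + s 7 * t 9 + s 5 * t 11 + s 3 * t 13 + s 1 * t 15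
  | .inl 1 => -s 15 * t 2 + s 14 * t 3 - s 11 * t 6 - s 10 * t 7 - s 7 * t 10 - s 6 * t 11 + s 3 * t 14 - s 2 * t 15
  | .inl 2 => s 15 * t 4 - s 14 * t 5 - s 13 * t 6 - s 12 * t 7 - s 7 * t 12 - s 6 * t 13 - s 5 * t 14 + s 4 * t 15
  | .inl 3 => -s 15 * t 8 - s 14 * t 9 - s 13 * t 10 + s 12 * t 11 + s 11 * t 12 - s 10 * t 13 - s 9 * t 14 - s 8 * t 15
  | .inl 4 => -s 14 * t 1 - s 13 * t 2 - s 11 * t 4 + s 8 * t 7 + s 7 * t 8 - s 4 * t 11 - s 2 * t 13 - s 1 * t 14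
  | .inr 0 => s 14 * t 0 + s 12 * t 2 + s 10 * t 4 + s 8 * t 6 + s 6 * t 8 + s 4 * t 10 + s 2 * t 12 + s 0 * t 14
  | .inr 1 => -s 13 * t 0 + s 12 * t 1 + s 9 * t 4 + s 8 * t 5 + s 5 * t 8 + s 4 * t 9 + s 1 * t 12 - s 0 * t 13
  | .inr 2 => s 11 * t 0 - s 10 * t 1 + s 9 * t 2 + s 8 * t 3 + s 3 * t 8 + s 2 * t 9 - s 1 * t 10 + s 0 * t 11
  | .inr 3 => s 7 * t 0 + s 6 * t 1 - s 5 * t 2 + s 4 * t 3 + s 3 * t 4 - s 2 * t 5 + s 1 * t 6 + s 0 * t 7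
  | .inr 4 => s 15 * t 0 + s 12 * t 3 + s 10 * t 5 - s 9 * t 6 - s 6 * t 9 + s 5 * t 10 + s 3 * t 12 + s 0 * t 15

/-- The equivariant map from pairs of half-spinors to vectors. -/
def spinPair : Spin k →ₗ[k] Spin k →ₗ[k] Vec k :=
  LinearMap.mk₂ k spinPairFun
    (by intro w w' s; ext (i | i) <;> fin_cases i <;> simp [spinPairFun] <;> ring)
    (by intro c w s; ext (i | i) <;> fin_cases i <;> simp [spinPairFun] <;> ring)
    (by intro w s s'; ext (i | i) <;> fin_cases i <;> simp [spinPairFun] <;> ring)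
    (by intro c w s; ext (i | i) <;> fin_cases i <;> simp [spinPairFun] <;> ring)

theorem spinPair_apply (s t : Spin k) : spinPair s t = spinPairFun s t := rfl

theorem spinPair_comm (s t : Spin k) : spinPair s t = spinPair t s := by
  ext (i | i) <;> fin_cases i <;> simp [spinPair_apply, spinPairFun] <;> ring

theorem dot_sixteen (s t : Spin k) :
    s ⬝ᵥ t = s 0 * t 0 + s 1 * t 1 + s 2 * t 2 + s 3 * t 3 + s 4 * t 4 + s 5 * t 5 + s 6 * t 6
      + s 7 * t 7 + s 8 * t 8 + s 9 * t 9 + s 10 * t 10 + s 11 * t 11 + s 12 * t 12 + s 13 * t 13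
      + s 14 * t 14 + s 15 * t 15 := by
  simp only [dotProduct, Fin.sum_univ_succ, Fin.succ_zero_eq_one, Fin.succ_one_eq_two]
  simp [Fin.succ]
  ring

/-- Since `form` is nondegenerate, this determines `spinPair` from the Clifford action; later
identities for `spinPair` are obtained by pairing both sides with a vector. -/
theorem form_spinPair (w : Vec k) (s t : Spin k) : form w (spinPair s t) = spinMul w s ⬝ᵥ t := by
  rw [dot_sixteen]
  simp [form_apply, dotProduct, Fintype.sum_sum_type, swap_apply, Fin.sum_univ_five,
    spinPair_apply, spinPairFun, spinMul_apply, spinMulFun]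
  ring

theorem spinMul_dot (w : Vec k) (s t : Spin k) : spinMul w s ⬝ᵥ t = s ⬝ᵥ spinMul w t := by
  rw [← form_spinPair, spinPair_comm, form_spinPair, dotProduct_comm]

/-- The Clifford relation. -/
theorem spinMul_swap_spinMul (w w' : Vec k) (s : Spin k) :
    spinMul (swap w) (spinMul w' s) + spinMul (swap w') (spinMul w s) = form w w' • s := by
  have h : form w w' = ∑ i : Fin 5, (w (.inl i) * w' (.inr i) + w (.inr i) * w' (.inl i)) := by
    simp [form_apply, dotProduct, Fintype.sum_sum_type, swap_apply, Finset.sum_add_distrib]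
  rw [h, Fin.sum_univ_five]
  ext i
  fin_cases i <;> simp [spinMul_apply, spinMulFun, swap_apply] <;> ring

/-- The fundamental identity for half-spinors in dimension 10. -/
theorem spinMul_spinPair_self (s : Spin k) : spinMul (spinPair s s) s = 0 := by
  ext i
  fin_cases i <;> simp [spinMul_apply, spinMulFun, spinPair_apply, spinPairFun] <;> ring

attribute [irreducible] spinMul spinPair

end Spinors

/-! ### Basis vectors acting as signed partial permutations of the weight vectors. -/

section SpinIrreducible

variable {k : Type*} [Field k]

/-- The signs of the nonzero entries of the matrix of `spinMul (Pi.single a 1)`. -/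
def spinSign (a : Fin 5 ⊕ Fin 5) (J : Fin 16) : ℤ :=
  Sum.elim
    ![![1, 0, 1, 0, 1, 0, 1, 0, 1, 0, 1, 0, 1, 0, 1, 0],
      ![-1, 1, 0, 0, 1, 1, 0, 0, 1, 1, 0, 0, 1, -1, 0, 0],
      ![1, -1, 1, 1, 0, 0, 0, 0, 1, 1, -1, 1, 0, 0, 0, 0],
      ![1, 1, -1, 1, 1, -1, 1, 1, 0, 0, 0, 0, 0, 0, 0, 0],
      ![1, 0, 0, 1, 0, 1, -1, 0, 0, -1, 1, 0, 1, 0, 0, 1]]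
    ![![0, 1, 0, 1, 0, 1, 0, 1, 0, 1, 0, 1, 0, 1, 0, 1],
      ![0, 0, -1, 1, 0, 0, -1, -1, 0, 0, -1, -1, 0, 0, 1, -1],
      ![0, 0, 0, 0, 1, -1, -1, -1, 0, 0, 0, 0, -1, -1, -1, 1],
      ![0, 0, 0, 0, 0, 0, 0, 0, -1, -1, -1, 1, 1, -1, -1, -1],
      ![0, -1, -1, 0, -1, 0, 0, 1, 1, 0, 0, -1, 0, -1, -1, 0]] a J

/-- The positions of the nonzero entries of the matrix of `spinMul (Pi.single a 1)`. -/
def spinIndex (a : Fin 5 ⊕ Fin 5) (J : Fin 16) : Fin 16 :=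
  15 ^^^ J ^^^ (![1, 2, 4, 8, 0] (a.elim id id))

-- With the action in integer tables, combinatorial facts about weight vectors become finite checks
-- for `decide`, independent of the field.
set_option maxHeartbeats 2000000 in
theorem spinMul_single (a : Fin 5 ⊕ Fin 5) (s : Spin k) (J : Fin 16) :
    spinMul (Pi.single a 1) s J = (spinSign a J : k) * s (spinIndex a J) := by
  rcases a with i | i <;> fin_cases i <;> fin_cases J <;>
    simp [spinMul_apply, spinMulFun, spinSign, spinIndex]

end SpinIrreducible

/-! ### Irreducibility of half-spinors under the even Clifford algebra. -/

section SpinIrreducible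

variable {k : Type*} [Field k]

@[simp] theorem swap_single (a : Fin 5 ⊕ Fin 5) (c : k) :
    swap (Pi.single a c : Vec k) = Pi.single a.swap c := by
  ext b
  simp only [swap_apply, Pi.single_apply]
  congr 1
  rw [eq_iff_iff]
  exact ⟨fun h => by simp [← h], fun h => by simp [h]⟩

theorem spinMul_single_mul_single (a b : Fin 5 ⊕ Fin 5) (s : Spin k) (J : Fin 16) :
    spinMul (Pi.single a 1) (spinMul (Pi.single b 1) s) J =
      ((spinSign a J * spinSign b (spinIndex a J) : ℤ) : k) * s (spinIndex b (spinIndex a J)) := by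
  rw [spinMul_single, spinMul_single]
  push_cast
  ring

/-- The projection of a half-spinor to the span of the weight vectors on which the weight `ε i`
is positive or negative. -/
def bitProj (a : Fin 5 ⊕ Fin 5) : Spin k →ₗ[k] Spin k :=
  spinMul (Pi.single a 1) ∘ₗ spinMul (Pi.single a 1)

/-- The indices of the weight vectors in the image of `bitProj a`. -/
def bitSet (a : Fin 5 ⊕ Fin 5) (J : Fin 16) : Bool :=
  spinSign a J != 0

/-- As `e a = swap (e a.swap)`, the operator is a product of two dual isotropic vectors, hence an
idempotent of the even Clifford algebra. -/
theorem bitProj_apply (a : Fin 5 ⊕ Fin 5) (s : Spin k) (J : Fin 16) :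
    bitProj a s J = if bitSet a J then s J else 0 := by
  have h : ∀ a J, spinIndex a (spinIndex a J) = J ∧
      spinSign a J * spinSign a (spinIndex a J) = if bitSet a J then 1 else 0 := by
    decide
  rw [bitProj, LinearMap.comp_apply, spinMul_single_mul_single, (h a J).1, (h a J).2]
  split_ifs <;> simp

/-- The flip of the `i`-th bit. -/
def flipBit (i : Fin 4) (J : Fin 16) : Fin 16 := J ^^^ (![1, 2, 4, 8] i)

/-- An element of the even Clifford algebra that maps the weight vector `e J` to
`± e (flipBit i J)`. -/
def bitFlip (i : Fin 4) : Spin k →ₗ[k] Spin k :=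
  spinMul (swap (Pi.single (.inl i.castSucc) 1 + Pi.single (.inr i.castSucc) 1)) ∘ₗ
    spinMul (Pi.single (.inl 4) 1 + Pi.single (.inr 4) 1)

theorem bitFlip_apply (i : Fin 4) (J : Fin 16) :
    ∃ c : ℤˣ, ∀ s : Spin k, bitFlip i s J = ((c : ℤ) : k) * s (flipBit i J) := by
  -- All four products of basis vectors lead to the same index, and exactly one has a nonzero sign;
  -- so the total coefficient is a unit.
  have h : ∀ (i : Fin 4) J, ∃ c : ℤˣ, (∀ a b : Bool,
      spinIndex (if b then .inl 4 else .inr 4)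
        (spinIndex (if a then .inl i.castSucc else .inr i.castSucc) J) = flipBit i J) ∧
      spinSign (.inr i.castSucc) J * spinSign (.inl 4) (spinIndex (.inr i.castSucc) J) +
        spinSign (.inr i.castSucc) J * spinSign (.inr 4) (spinIndex (.inr i.castSucc) J) +
        (spinSign (.inl i.castSucc) J * spinSign (.inl 4) (spinIndex (.inl i.castSucc) J) +
        spinSign (.inl i.castSucc) J * spinSign (.inr 4) (spinIndex (.inl i.castSucc) J)) = c := by
    decide
  obtain ⟨c, h1, h2⟩ := h i J
  refine ⟨c, fun s => ?_⟩
  have h3 := h1 true true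
  have h4 := h1 true false
  have h5 := h1 false true
  have h6 := h1 false false
  simp only [if_true, Bool.false_eq_true, if_false] at h3 h4 h5 h6
  simp only [bitFlip, map_add, LinearMap.comp_apply, LinearMap.add_apply, Pi.add_apply,
    spinMul_single_mul_single, swap_single, Sum.swap_inl, Sum.swap_inr, h3, h4, h5, h6]
  rw [← h2]
  push_cast
  ring

theorem bitFlip_single (i : Fin 4) (J : Fin 16) :
    ∃ c : ℤˣ, bitFlip i (Pi.single J 1 : Spin k) = ((c : ℤ) : k) • Pi.single (flipBit i J) 1 := by
  have hinv : ∀ (i : Fin 4) J, flipBit i (flipBit i J) = J := by decide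
  obtain ⟨c, hc⟩ := bitFlip_apply (k := k) i (flipBit i J)
  refine ⟨c, funext fun K => ?_⟩
  by_cases hK : K = flipBit i J
  · subst hK
    rw [hc, hinv]
    simp
  · obtain ⟨d, hd⟩ := bitFlip_apply (k := k) i K
    have hne : flipBit i K ≠ J := fun h => hK (by rw [← h, hinv])
    rw [hd, Pi.single_eq_of_ne hne, Pi.smul_apply, Pi.single_eq_of_ne hK]
    simp

/-- A half-spinor representation is irreducible under the even Clifford algebra. -/
theorem spin_irreducible (U : Submodule k (Spin k))
    (hU : ∀ w w' : Vec k, ∀ s ∈ U, spinMul (swap w) (spinMul w' s) ∈ U) : U = ⊥ ∨ U = ⊤ := by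
  refine or_iff_not_imp_left.2 fun hne => ?_
  obtain ⟨s, hs, hs0⟩ := U.exists_mem_ne_zero_of_ne_bot hne
  obtain ⟨I, hI⟩ := Function.ne_iff.1 hs0
  have hproj : ∀ a, ∀ s ∈ U, bitProj a s ∈ U := fun a s hs => by
    simpa [bitProj] using hU (Pi.single a.swap 1) (Pi.single a 1) s hs
  have hflip : ∀ i J, (Pi.single J 1 : Spin k) ∈ U → (Pi.single (flipBit i J) 1 : Spin k) ∈ U := by
    intro i J hJ
    obtain ⟨c, hc⟩ := bitFlip_single (k := k) i J
    have h := hU (Pi.single (.inl i.castSucc) 1 + Pi.single (.inr i.castSucc) 1)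
      (Pi.single (.inl 4) 1 + Pi.single (.inr 4) 1) _ hJ
    change bitFlip i (Pi.single J 1 : Spin k) ∈ U at h
    rw [hc] at h
    rcases Int.units_eq_one_or c with rfl | rfl
    · simpa using h
    · simpa using h
  -- For each of the first four coordinates choose the projection that keeps `I`. The four resulting
  -- bits determine the index, so the composite isolates the coordinate `I`.
  have hbits : ∀ I : Fin 16, ∃ a : Fin 4 → Fin 5 ⊕ Fin 5,
      ∀ J, (bitSet (a 0) J && bitSet (a 1) J && bitSet (a 2) J && bitSet (a 3) J) =
        decide (J = I) := by
    intro I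
    refine ⟨fun i => if bitSet (.inl i.castSucc) I then .inl i.castSucc else .inr i.castSucc, ?_⟩
    revert I
    decide
  obtain ⟨a, ha⟩ := hbits I
  have hsingle : (Pi.single I 1 : Spin k) ∈ U := by
    have h := hproj (a 0) _ (hproj (a 1) _ (hproj (a 2) _ (hproj (a 3) s hs)))
    have h' : bitProj (a 0) (bitProj (a 1) (bitProj (a 2) (bitProj (a 3) s))) =
        s I • Pi.single I 1 := by
      ext J
      have hJ := ha J
      simp only [bitProj_apply, Pi.smul_apply, smul_eq_mul]
      by_cases hJI : J = I
      · subst hJI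
        simp only [decide_true, Bool.and_eq_true] at hJ
        simp [hJ.1.1.1, hJ.1.1.2, hJ.1.2, hJ.2]
      · rw [Pi.single_eq_of_ne hJI, mul_zero]
        simp only [hJI, decide_false] at hJ
        cases h0 : bitSet (a 0) J <;> cases h1 : bitSet (a 1) J <;>
          cases h2 : bitSet (a 2) J <;> cases h3 : bitSet (a 3) J <;> simp_all
    rw [h'] at h
    exact (U.smul_mem_iff hI).1 h
  have hall : ∀ J, (Pi.single J 1 : Spin k) ∈ U := by
    have hpath : ∀ I J : Fin 16, ∃ b : Fin 4 → Bool,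
        (let J₀ := cond (b 0) (flipBit 0 I) I
         let J₁ := cond (b 1) (flipBit 1 J₀) J₀
         let J₂ := cond (b 2) (flipBit 2 J₁) J₁
         cond (b 3) (flipBit 3 J₂) J₂) = J := by
      intro I J
      -- Flip exactly the bits in which `I` and `J` differ.
      refine ⟨fun i => (I ^^^ J).val.testBit i, ?_⟩
      revert I J
      decide
    have hstep : ∀ (b : Bool) i J, (Pi.single J 1 : Spin k) ∈ U →
        (Pi.single (cond b (flipBit i J) J) 1 : Spin k) ∈ U := by
      intro b i J hJ
      cases b
      · exact hJ
      · exact hflip i J hJ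
    intro J
    obtain ⟨b, rfl⟩ := hpath I J
    exact hstep _ _ _ (hstep _ _ _ (hstep _ _ _ (hstep _ _ _ hsingle)))
  refine (Submodule.eq_top_iff').2 fun t => ?_
  rw [← Finset.univ_sum_single t]
  refine U.sum_mem fun J _ => ?_
  have h := U.smul_mem (t J) (hall J)
  rwa [← Pi.single_smul, smul_eq_mul, mul_one] at h

end SpinIrreducible

/-! ### The decomposition of the 27-dimensional representation under `𝔤(0)` -/

section Model

variable {k : Type*} [Field k]

/-- The 27-dimensional representation as the sum of the trivial, a half-spinor and the vector
representation of `𝔰𝔬₁₀`. -/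
abbrev Model (k : Type*) := k × Spin k × Vec k

/-- The half-spinor coordinates on the 27-dimensional space. -/
def spinCoord (v : J27 k) : Spin k :=
  ![v.1 2 0, v.2.1 2 2, v.2.1 1 2, v.1 1 0, v.2.2 1 1, v.2.1 2 0, v.2.1 1 0, v.2.2 1 2, v.2.2 0 1,
    v.2.1 2 1, v.2.1 1 1, v.2.2 0 2, v.2.2 2 1, v.1 0 1, v.1 0 2, v.2.2 2 2]

/-- The vector coordinates on the 27-dimensional space. -/
def vecCoord (v : J27 k) : Vec k :=
  Sum.elim ![v.1 1 1, v.1 1 2, v.2.1 0 0, v.2.1 0 1, v.2.1 0 2]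
    ![v.1 2 2, -v.1 2 1, -v.2.2 0 0, -v.2.2 1 0, -v.2.2 2 0]

/-- The inverse of `coord`. -/
def ofModel (m : Model k) : J27 k :=
  (!![m.1, m.2.1 13, m.2.1 14; m.2.1 3, m.2.2 (.inl 0), m.2.2 (.inl 1);
      m.2.1 0, -m.2.2 (.inr 1), m.2.2 (.inr 0)],
   !![m.2.2 (.inl 2), m.2.2 (.inl 3), m.2.2 (.inl 4); m.2.1 6, m.2.1 10, m.2.1 2;
      m.2.1 5, m.2.1 9, m.2.1 1],
   !![-m.2.2 (.inr 2), m.2.1 8, m.2.1 11; -m.2.2 (.inr 3), m.2.1 4, m.2.1 7;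
      -m.2.2 (.inr 4), m.2.1 12, m.2.1 15])

set_option maxHeartbeats 1000000 in
variable (k) in
/-- The coordinates on the 27-dimensional space. -/
def coord : J27 k ≃ₗ[k] Model k where
  toFun v := (v.1 0 0, spinCoord v, vecCoord v)
  invFun := ofModel
  map_add' v w := by
    refine Prod.ext rfl (Prod.ext ?_ ?_)
    · ext i; fin_cases i <;> rfl
    · ext (i | i) <;> fin_cases i <;> simp [vecCoord] <;> ring
  map_smul' c v := by
    refine Prod.ext rfl (Prod.ext ?_ ?_)
    · ext i; fin_cases i <;> rfl
    · ext (i | i) <;> fin_cases i <;> simp [vecCoord]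
  left_inv v := by
    refine Prod.ext ?_ (Prod.ext ?_ ?_) <;> ext i j <;> fin_cases i <;> fin_cases j <;>
      simp [ofModel, spinCoord, vecCoord]
  right_inv m := by
    refine Prod.ext rfl (Prod.ext ?_ ?_)
    · ext i; fin_cases i <;> rfl
    · ext (i | i) <;> fin_cases i <;> simp [vecCoord, ofModel]

theorem coord_apply (v : J27 k) : coord k v = (v.1 0 0, spinCoord v, vecCoord v) := rfl

/-- The derivative at `v`, in the direction `w`, of the cubic norm
`(α, s, u) ↦ (α * form u u - spinMul u s ⬝ᵥ s) / 2`. -/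
def modelDeriv (v w : Model k) : k :=
  w.1 * (form v.2.2 v.2.2 / 2) + v.1 * form v.2.2 w.2.2 - spinMul v.2.2 v.2.1 ⬝ᵥ w.2.1 -
    spinMul w.2.2 v.2.1 ⬝ᵥ v.2.1 / 2

theorem form_eq (w w' : Vec k) :
    form w w' = w (.inl 0) * w' (.inr 0) + w (.inr 0) * w' (.inl 0) + w (.inl 1) * w' (.inr 1)
      + w (.inr 1) * w' (.inl 1) + w (.inl 2) * w' (.inr 2) + w (.inr 2) * w' (.inl 2)
      + w (.inl 3) * w' (.inr 3) + w (.inr 3) * w' (.inl 3) + w (.inl 4) * w' (.inr 4)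
      + w (.inr 4) * w' (.inl 4) := by
  simp [form_apply, dotProduct, Fintype.sum_sum_type, swap_apply, Fin.sum_univ_five]
  ring

-- This ties the matrix model to the 1 + 16 + 10 model. Apart from identifying the grading element,
-- what follows uses only the right-hand side.
set_option maxHeartbeats 1000000 in
theorem cubicNormDeriv_eq [CharZero k] (v w : J27 k) :
    cubicNormDeriv v w = modelDeriv (coord k v) (coord k w) := by
  simp only [modelDeriv, coord_apply, form_eq, dot_sixteen, spinMul_apply, cubicNormDeriv,
    trace_adjugate_mul]
  simp only [Matrix.trace_fin_three, Matrix.mul_apply, Fin.sum_univ_three]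
  simp [spinMulFun, spinCoord, vecCoord]
  ring

end Model

section Elements

variable {k : Type*} [Field k]

/-! ### Clifford identities -/

theorem spinMul_spinMul_swap (w w' : Vec k) (s : Spin k) :
    spinMul w (spinMul (swap w') s) + spinMul w' (spinMul (swap w) s) = form w w' • s := by
  simpa using spinMul_swap_spinMul (swap w) (swap w') s

/-- Three applications of the Clifford relation carry `w` from the left end of the product to the
right end. -/
theorem spinMul_three (w v u : Vec k) (s : Spin k) :
    spinMul w (spinMul (swap v) (spinMul u s)) + spinMul u (spinMul (swap v) (spinMul w s)) =
      form w v • spinMul u s - form w u • spinMul v s + form v u • spinMul w s := by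
  have h1 := spinMul_spinMul_swap w v (spinMul u s)
  have h2 := congrArg (spinMul v) (spinMul_swap_spinMul w u s)
  have h3 := spinMul_spinMul_swap v u (spinMul w s)
  rw [map_add, map_smul] at h2
  linear_combination h1 - h2 + h3

/-! ### The spin action of skew endomorphisms. -/

section SpinAct

/-- The endomorphism of the half-spinor representation given by a skew endomorphism `A` of the
vector representation. -/
def spinAct : Matrix (Fin 5 ⊕ Fin 5) (Fin 5 ⊕ Fin 5) k →ₗ[k] Module.End k (Spin k) where
  toFun A := (2⁻¹ : k) • ∑ a, spinMul (swap (A.col a)) ∘ₗ spinMul (Pi.single a.swap 1)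
  map_add' A B := by
    have h : ∀ a, (A + B).col a = A.col a + B.col a := fun _ => rfl
    simp only [h, map_add, LinearMap.add_comp, Finset.sum_add_distrib, smul_add]
  map_smul' c A := by
    have h : ∀ a, (c • A).col a = c • A.col a := fun _ => rfl
    simp only [h, map_smul, LinearMap.smul_comp, ← Finset.smul_sum, RingHom.id_apply,
      smul_comm c]

theorem spinAct_apply (A : Matrix (Fin 5 ⊕ Fin 5) (Fin 5 ⊕ Fin 5) k) (s : Spin k) :
    spinAct A s = (2⁻¹ : k) • ∑ a, spinMul (swap (A.col a)) (spinMul (Pi.single a.swap 1) s) := by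
  simp [spinAct]

/-- The endomorphism `A` of the vector representation is skew for the invariant form. -/
def IsSkew (A : Matrix (Fin 5 ⊕ Fin 5) (Fin 5 ⊕ Fin 5) k) : Prop :=
  ∀ w w', form (A.mulVec w) w' = -form w (A.mulVec w')

theorem swap_eq_mulVec (w : Vec k) : swap w = (LieAlgebra.Orthogonal.JD (Fin 5) k).mulVec w := by
  ext (i | i) <;>
    simp [LieAlgebra.Orthogonal.JD, swap_apply, Matrix.mulVec, dotProduct, Matrix.one_apply]

theorem mem_so10_iff (A : Matrix (Fin 5 ⊕ Fin 5) (Fin 5 ⊕ Fin 5) k) :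
    A ∈ LieAlgebra.Orthogonal.typeD (Fin 5) k ↔ IsSkew A := by
  rw [LieAlgebra.Orthogonal.typeD, mem_skewAdjointMatricesLieSubalgebra,
    mem_skewAdjointMatricesSubmodule, Matrix.IsSkewAdjoint, Matrix.IsAdjointPair]
  have h1 : ∀ w w', form (A.mulVec w) w' =
      w ⬝ᵥ (A.transpose * LieAlgebra.Orthogonal.JD (Fin 5) k).mulVec w' := by
    intro w w'
    rw [form_apply, swap_eq_mulVec, ← Matrix.mulVec_mulVec, Matrix.dotProduct_mulVec w,
      Matrix.vecMul_transpose]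
  have h2 : ∀ w w', -form w (A.mulVec w') =
      w ⬝ᵥ (LieAlgebra.Orthogonal.JD (Fin 5) k * -A).mulVec w' := by
    intro w w'
    rw [form_apply, swap_eq_mulVec, Matrix.mulVec_mulVec, Matrix.mul_neg, Matrix.neg_mulVec,
      dotProduct_neg]
  constructor
  · intro h w w'
    rw [h1, h2, h]
  · intro h
    ext i j
    have := h (Pi.single i 1) (Pi.single j 1)
    rw [h1, h2] at this
    simpa using this

theorem so10_skew (A : so10 k) : IsSkew A.1 := (mem_so10_iff A.1).1 A.2

theorem form_single_right (w : Vec k) (a : Fin 5 ⊕ Fin 5) :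
    form w (Pi.single a 1) = w a.swap := by
  rw [form_apply, swap_single, dotProduct_single, mul_one]

theorem IsSkew.trace_eq_zero [CharZero k] {A : Matrix (Fin 5 ⊕ Fin 5) (Fin 5 ⊕ Fin 5) k}
    (hA : IsSkew A) : A.trace = 0 := by
  have h : ∀ a, A a.swap a.swap = -A a a := by
    intro a
    have := hA (Pi.single a.swap 1) (Pi.single a 1)
    rw [form_single_right, form_comm, form_single_right] at this
    simpa using this
  have h2 : A.trace = -A.trace := by
    conv_lhs => rw [Matrix.trace, ← (Equiv.sumComm (Fin 5) (Fin 5)).sum_comp]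
    rw [Matrix.trace, ← Finset.sum_neg_distrib]
    exact Finset.sum_congr rfl fun a _ => h a
  exact self_eq_neg.1 h2

/-- Infinitesimal invariance of `⟨w·s, t⟩`. After the symmetry of Clifford multiplication is used,
the last two terms are half a sum of triple products over the dual bases `A e_a`, `e_(a.swap)`. By
`spinMul_three` the three scalar sums give `-A w`, `-A w` and the trace of `A`, which is zero. -/
theorem spinMul_spinAct [CharZero k] {A : Matrix (Fin 5 ⊕ Fin 5) (Fin 5 ⊕ Fin 5) k}
    (hA : IsSkew A) (w : Vec k) (s t : Spin k) :
    spinMul (A.mulVec w) s ⬝ᵥ t + spinMul w (spinAct A s) ⬝ᵥ t + spinMul w s ⬝ᵥ spinAct A t =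
      0 := by
  have h1 : spinMul w s ⬝ᵥ spinAct A t = ((2⁻¹ : k) •
      ∑ a, spinMul (Pi.single a.swap 1) (spinMul (swap (A.col a)) (spinMul w s))) ⬝ᵥ t := by
    rw [spinAct_apply, dotProduct_smul, smul_dotProduct, dotProduct_sum, sum_dotProduct]
    simp only [← spinMul_dot]
  have h2 : spinMul w (spinAct A s) = (2⁻¹ : k) •
      ∑ a, spinMul w (spinMul (swap (A.col a)) (spinMul (Pi.single a.swap 1) s)) := by
    rw [spinAct_apply, map_smul, map_sum]
  have h3 : ∑ a, form w (A.col a) • spinMul (Pi.single a.swap 1) s = -spinMul (A.mulVec w) s := by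
    have h : -A.mulVec w = ∑ a, form w (A.col a) • (Pi.single a.swap 1 : Vec k) := by
      ext b
      rw [Finset.sum_apply, Finset.sum_eq_single b.swap]
      · have := hA w (Pi.single b.swap 1)
        rw [form_single_right, Sum.swap_swap, Matrix.mulVec_single_one] at this
        simp [this]
      · intro a _ hab
        rw [Pi.smul_apply, Pi.single_eq_of_ne, smul_zero]
        rintro rfl
        simp at hab
      · simp
    rw [← LinearMap.neg_apply, ← map_neg, h, map_sum, LinearMap.sum_apply]
    simp only [map_smul, LinearMap.smul_apply]
  have h4 : ∑ a, form w (Pi.single a.swap 1) • spinMul (A.col a) s = spinMul (A.mulVec w) s := by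
    have h : A.mulVec w = ∑ a, w a • A.col a := by
      ext b
      simp [Matrix.mulVec, dotProduct, mul_comm]
    rw [h, map_sum, LinearMap.sum_apply]
    simp only [map_smul, LinearMap.smul_apply, form_single_right, Sum.swap_swap]
  have h5 : ∑ a, form (A.col a) (Pi.single a.swap 1) • spinMul w s = 0 := by
    rw [← Finset.sum_smul]
    simp only [form_single_right, Sum.swap_swap]
    rw [show ∑ a, A.col a a = A.trace from rfl, hA.trace_eq_zero, zero_smul]
  have h6 : ∑ a, spinMul w (spinMul (swap (A.col a)) (spinMul (Pi.single a.swap 1) s)) +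
      ∑ a, spinMul (Pi.single a.swap 1) (spinMul (swap (A.col a)) (spinMul w s)) =
      (-2 : k) • spinMul (A.mulVec w) s := by
    rw [← Finset.sum_add_distrib]
    simp only [spinMul_three, Finset.sum_add_distrib, Finset.sum_sub_distrib, h3, h4, h5]
    module
  rw [h1, h2, ← add_dotProduct, ← add_dotProduct, add_assoc, ← smul_add, h6, smul_smul]
  have : (2⁻¹ : k) * -2 = -1 := by
    rw [mul_neg, inv_mul_cancel₀ two_ne_zero]
  rw [this]
  simp

end SpinAct

end Elements

set_option linter.unusedSectionVars false
set_option linter.unusedSimpArgs false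

/-! ### The elements of `E₆` -/

namespace Shortcut

variable {k : Type*} [Field k] [CharZero k]

scoped instance : LieRing (e6 k) := LieSubalgebra.lieRing k _ _
scoped instance : LieAlgebra k (e6 k) := LieSubalgebra.lieAlgebra k _ _
scoped instance : AddCommGroup (e6 k) := LieRing.toAddCommGroup
scoped instance : AddCommMonoid (e6 k) := AddCommGroup.toAddCommMonoid
scoped instance : AddGroup (e6 k) := AddCommGroup.toAddGroup
scoped instance : SubtractionMonoid (e6 k) := AddGroup.toSubtractionMonoid
scoped instance : SubNegMonoid (e6 k) := AddGroup.toSubNegMonoid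
scoped instance : AddMonoid (e6 k) := SubNegMonoid.toAddMonoid
scoped instance : AddZeroClass (e6 k) := AddMonoid.toAddZeroClass
scoped instance : Add (e6 k) := AddSemigroup.toAdd
scoped instance : Neg (e6 k) := SubNegMonoid.toNeg
scoped instance : Sub (e6 k) := SubNegMonoid.toSub
scoped instance : Zero (e6 k) := NegZeroClass.toZero
scoped instance : Module k (e6 k) := LieAlgebra.toModule
scoped instance : SMul k (e6 k) := Module.toDistribMulAction.toSMul

end Shortcut

open scoped Shortcut

section E6Elements

variable {k : Type*} [Field k] [CharZero k]

/-- The action of `E₆` on the 27-dimensional representation, in coordinates. -/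
noncomputable def act : e6 k →ₗ⁅k⁆ Module.End k (Model k) :=
  (coord k).lieConj.toLieHom.comp (e6 k).incl

theorem act_apply (X : e6 k) (m : Model k) : act X m = coord k (X.1 ((coord k).symm m)) := rfl

theorem act_lie (X Y : e6 k) (m : Model k) :
    act ⁅X, Y⁆ m = act X (act Y m) - act Y (act X m) := by
  rw [LieHom.map_lie, LieRing.of_associative_ring_bracket]
  rfl

theorem act_injective : Function.Injective (act (k := k)) := fun _ _ h =>
  Subtype.ext ((coord k).lieConj.injective h)

theorem e6_ext {X Y : e6 k} (h : ∀ m, act X m = act Y m) : X = Y :=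
  act_injective (LinearMap.ext h)

/-- The polarization of `modelDeriv`. -/
def modelPolar (u v w : Model k) : k :=
  u.1 * form v.2.2 w.2.2 + v.1 * form u.2.2 w.2.2 + w.1 * form u.2.2 v.2.2
    - spinMul w.2.2 u.2.1 ⬝ᵥ v.2.1 - spinMul u.2.2 v.2.1 ⬝ᵥ w.2.1 - spinMul v.2.2 u.2.1 ⬝ᵥ w.2.1

theorem modelPolar_self (v w : Model k) : modelPolar v v w = 2 * modelDeriv v w := by
  simp only [modelPolar, modelDeriv]
  ring

theorem modelPolar_comm (u v w : Model k) : modelPolar u v w = modelPolar v u w := by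
  simp only [modelPolar, form_comm u.2.2 v.2.2]
  rw [spinMul_dot w.2.2, dotProduct_comm u.2.1]
  ring

theorem modelPolar_right_comm (u v w : Model k) : modelPolar u v w = modelPolar u w v := by
  simp only [modelPolar, form_comm v.2.2 w.2.2]
  rw [spinMul_dot u.2.2, dotProduct_comm v.2.1]
  ring

theorem modelPolar_add_right (u v w w' : Model k) :
    modelPolar u v (w + w') = modelPolar u v w + modelPolar u v w' := by
  simp only [modelPolar, Prod.fst_add, Prod.snd_add, map_add, LinearMap.add_apply, dotProduct_add,
    add_dotProduct]
  ring

theorem modelPolar_add_mid (u v v' w : Model k) :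
    modelPolar u (v + v') w = modelPolar u v w + modelPolar u v' w := by
  rw [modelPolar_right_comm, modelPolar_add_right, modelPolar_right_comm u w,
    modelPolar_right_comm u w]

theorem modelPolar_add_left (u u' v w : Model k) :
    modelPolar (u + u') v w = modelPolar u v w + modelPolar u' v w := by
  rw [modelPolar_comm, modelPolar_add_mid, modelPolar_comm v, modelPolar_comm v]

theorem modelDeriv_act (X : e6 k) (m : Model k) : modelDeriv m (act X m) = 0 := by
  have h := X.2 ((coord k).symm m)
  rwa [cubicNormDeriv_eq, LinearEquiv.apply_symm_apply] at h

/-- Full polarization of the condition defining `e6`, by inclusion-exclusion over `u`, `v`, `w`.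
Specializing the three arguments to scalars, spinors or vectors gives all constraints on the blocks
of `X`. -/
theorem modelPolar_act (X : e6 k) (u v w : Model k) :
    modelPolar (act X u) v w + modelPolar u (act X v) w + modelPolar u v (act X w) = 0 := by
  have h : ∀ m, modelPolar m m (act X m) = 0 := fun m => by
    rw [modelPolar_self, modelDeriv_act, mul_zero]
  have h1 := h u
  have h2 := h v
  have h3 := h w
  have h12 := h (u + v)
  have h13 := h (u + w)
  have h23 := h (v + w)
  have h123 := h (u + v + w)
  simp only [map_add, modelPolar_add_left, modelPolar_add_mid, modelPolar_add_right]
    at h12 h13 h23 h123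
  have e1 := modelPolar_right_comm u v (act X w)
  have e2 := modelPolar_comm v u (act X w)
  have e3 := modelPolar_comm w u (act X v)
  have e4 := modelPolar_comm w v (act X u)
  have e5 : modelPolar (act X u) v w = modelPolar v w (act X u) := by
    rw [modelPolar_comm, modelPolar_right_comm]
  have e6 : modelPolar u (act X v) w = modelPolar u w (act X v) := modelPolar_right_comm _ _ _
  have h2' : (2 : k) * (modelPolar (act X u) v w + modelPolar u (act X v) w +
      modelPolar u v (act X w)) = 0 := by
    linear_combination h123 - h12 - h13 - h23 + h1 + h2 + h3 + 2 * e5 + 2 * e6 - e2 - e3 - e4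
  exact (mul_eq_zero.1 h2').resolve_left two_ne_zero

/-- The element of `E₆` given by an endomorphism that annihilates the cubic norm. -/
noncomputable def ofEnd (T : Module.End k (Model k)) (hT : ∀ m, modelDeriv m (T m) = 0) : e6 k :=
  ⟨(coord k).symm.conj T, fun v => by
    rw [cubicNormDeriv_eq, LinearEquiv.conj_apply_apply, LinearEquiv.symm_symm,
      LinearEquiv.apply_symm_apply]
    exact hT _⟩

theorem act_ofEnd (T : Module.End k (Model k)) (hT : ∀ m, modelDeriv m (T m) = 0) :
    act (ofEnd T hT) = T := by
  refine LinearMap.ext fun m => ?_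
  rw [act_apply, ofEnd, LinearEquiv.conj_apply_apply, LinearEquiv.symm_symm,
    LinearEquiv.apply_symm_apply, LinearEquiv.apply_symm_apply]

theorem spinMul_swap_self (w : Vec k) (s : Spin k) :
    spinMul w (spinMul (swap w) s) = (form w w / 2) • s := by
  have h := spinMul_spinMul_swap w w s
  rw [← two_smul k, ← eq_inv_smul_iff₀ two_ne_zero, smul_smul] at h
  rw [h, div_eq_inv_mul]

/-- For `t = s` this says that `spinPair s s` is an isotropic vector. -/
theorem form_spinPair_self (s t : Spin k) : form (spinPair s s) (spinPair s t) = 0 := by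
  rw [form_spinPair, spinMul_spinPair_self, zero_dotProduct]

/-- The endomorphism `lo ξ`. -/
def loEnd (ξ : Spin k) : Module.End k (Model k) where
  toFun m := (0, m.1 • ξ, spinPair ξ m.2.1)
  map_add' m m' := by simp [add_smul]
  map_smul' c m := by simp [mul_smul]

theorem loEnd_apply (ξ : Spin k) (m : Model k) :
    loEnd ξ m = (0, m.1 • ξ, spinPair ξ m.2.1) := rfl

theorem modelDeriv_loEnd (ξ : Spin k) (m : Model k) : modelDeriv m (loEnd ξ m) = 0 := by
  have h : spinMul (spinPair ξ m.2.1) m.2.1 ⬝ᵥ m.2.1 = 0 := by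
    rw [← form_spinPair, form_comm, spinPair_comm ξ, form_spinPair_self]
  rw [loEnd_apply, modelDeriv]
  dsimp only
  rw [dotProduct_smul, smul_eq_mul, h, form_spinPair, spinMul_dot, dotProduct_comm ξ]
  ring

/-- The elements of `𝔤(-1)`. -/
noncomputable def lo : Spin k →ₗ[k] e6 k where
  toFun ξ := ofEnd (loEnd ξ) (modelDeriv_loEnd ξ)
  map_add' ξ ξ' := e6_ext fun m => by
    rw [map_add, LinearMap.add_apply, act_ofEnd, act_ofEnd, act_ofEnd]
    simp [loEnd_apply]
  map_smul' c ξ := e6_ext fun m => by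
    rw [map_smul, LinearMap.smul_apply, act_ofEnd, act_ofEnd]
    simp [loEnd_apply, smul_comm c]

theorem act_lo (ξ : Spin k) (m : Model k) : act (lo ξ) m = (0, m.1 • ξ, spinPair ξ m.2.1) := by
  have h : act (lo ξ) = loEnd ξ := act_ofEnd _ (modelDeriv_loEnd ξ)
  rw [h, loEnd_apply]

/-- The endomorphism `hi η`. -/
def hiEnd (η : Spin k) : Module.End k (Model k) where
  toFun m := (η ⬝ᵥ m.2.1, spinMul (swap m.2.2) η, 0)
  map_add' m m' := by simp [dotProduct_add]
  map_smul' c m := by simp [dotProduct_smul]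

theorem hiEnd_apply (η : Spin k) (m : Model k) :
    hiEnd η m = (η ⬝ᵥ m.2.1, spinMul (swap m.2.2) η, 0) := rfl

theorem modelDeriv_hiEnd (η : Spin k) (m : Model k) : modelDeriv m (hiEnd η m) = 0 := by
  rw [hiEnd_apply, modelDeriv]
  dsimp only
  rw [map_zero, map_zero, LinearMap.zero_apply, zero_dotProduct, spinMul_dot, spinMul_swap_self,
    dotProduct_smul, dotProduct_comm m.2.1, smul_eq_mul]
  ring

/-- The elements of `𝔤(1)`. -/
noncomputable def hi : Spin k →ₗ[k] e6 k where
  toFun η := ofEnd (hiEnd η) (modelDeriv_hiEnd η)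
  map_add' ξ ξ' := e6_ext fun m => by
    rw [map_add, LinearMap.add_apply, act_ofEnd, act_ofEnd, act_ofEnd]
    simp [hiEnd_apply, add_dotProduct]
  map_smul' c ξ := e6_ext fun m => by
    rw [map_smul, LinearMap.smul_apply, act_ofEnd, act_ofEnd]
    simp [hiEnd_apply]

theorem act_hi (η : Spin k) (m : Model k) :
    act (hi η) m = (η ⬝ᵥ m.2.1, spinMul (swap m.2.2) η, 0) := by
  have h : act (hi η) = hiEnd η := act_ofEnd _ (modelDeriv_hiEnd η)
  rw [h, hiEnd_apply]

/-- The endomorphism `mid (A, c)`. -/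
def midEnd (A : Matrix (Fin 5 ⊕ Fin 5) (Fin 5 ⊕ Fin 5) k) (c : k) : Module.End k (Model k) where
  toFun m := (4 / 3 * c * m.1, spinAct A m.2.1 + (c / 3) • m.2.1,
    A.mulVec m.2.2 - (2 / 3 * c) • m.2.2)
  map_add' m m' := by
    refine Prod.ext ?_ (Prod.ext ?_ ?_)
    · simp only [Prod.fst_add]; ring
    · simp only [Prod.fst_add, Prod.snd_add, map_add]; module
    · simp only [Prod.snd_add, Matrix.mulVec_add]; module
  map_smul' a m := by
    refine Prod.ext ?_ (Prod.ext ?_ ?_)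
    · simp only [Prod.smul_fst, smul_eq_mul, RingHom.id_apply]; ring
    · simp only [Prod.smul_fst, Prod.smul_snd, map_smul, RingHom.id_apply]; module
    · simp only [Prod.smul_snd, Matrix.mulVec_smul, RingHom.id_apply]; module

theorem midEnd_apply (A : Matrix (Fin 5 ⊕ Fin 5) (Fin 5 ⊕ Fin 5) k) (c : k) (m : Model k) :
    midEnd A c m = (4 / 3 * c * m.1, spinAct A m.2.1 + (c / 3) • m.2.1,
      A.mulVec m.2.2 - (2 / 3 * c) • m.2.2) := rfl

theorem modelDeriv_midEnd {A : Matrix (Fin 5 ⊕ Fin 5) (Fin 5 ⊕ Fin 5) k} (hA : IsSkew A) (c : k)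
    (m : Model k) : modelDeriv m (midEnd A c m) = 0 := by
  have h := spinMul_spinAct hA m.2.2 m.2.1 m.2.1
  rw [spinMul_dot m.2.2 (spinAct _ _), dotProduct_comm (spinAct _ _)] at h
  have h' := hA m.2.2 m.2.2
  rw [form_comm] at h'
  have h'' : form m.2.2 (A.mulVec m.2.2) = 0 := self_eq_neg.1 h'
  rw [midEnd_apply, modelDeriv]
  dsimp only
  rw [map_sub, map_sub, LinearMap.sub_apply, map_smul, map_smul, LinearMap.smul_apply, h'',
    dotProduct_add, dotProduct_smul, sub_dotProduct, smul_dotProduct]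
  simp only [smul_eq_mul]
  linear_combination (-1 / 2 : k) * h

/-- The elements of `𝔤(0)`. -/
noncomputable def mid : (so10 k × k) →ₗ[k] e6 k where
  toFun p := ofEnd (midEnd p.1.1 p.2) (modelDeriv_midEnd (so10_skew p.1) p.2)
  map_add' p q := e6_ext fun m => by
    rw [map_add, LinearMap.add_apply, act_ofEnd, act_ofEnd, act_ofEnd, midEnd_apply, midEnd_apply,
      midEnd_apply]
    have hA : (p + q).1.1 = p.1.1 + q.1.1 := rfl
    have hc : (p + q).2 = p.2 + q.2 := rfl
    rw [hA, hc]
    refine Prod.ext ?_ (Prod.ext ?_ ?_)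
    · simp only [Prod.fst_add, Prod.snd_add]; ring
    · simp only [Prod.fst_add, Prod.snd_add, map_add, LinearMap.add_apply]
      module
    · simp only [Prod.fst_add, Prod.snd_add, Matrix.add_mulVec]; module
  map_smul' c p := e6_ext fun m => by
    rw [map_smul, LinearMap.smul_apply, act_ofEnd, act_ofEnd, midEnd_apply, midEnd_apply]
    have hA : (c • p).1.1 = c • p.1.1 := rfl
    have hc : (c • p).2 = c * p.2 := rfl
    rw [hA, hc]
    refine Prod.ext ?_ (Prod.ext ?_ ?_)
    · simp only [Prod.smul_fst, Prod.smul_snd, smul_eq_mul, RingHom.id_apply]; ring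
    · simp only [Prod.smul_fst, Prod.smul_snd, map_smul,
        LinearMap.smul_apply, RingHom.id_apply, smul_eq_mul]
      module
    · simp only [Prod.smul_fst, Prod.smul_snd, Matrix.smul_mulVec,
        RingHom.id_apply, smul_eq_mul]
      module

theorem act_mid (p : so10 k × k) (m : Model k) :
    act (mid p) m = (4 / 3 * p.2 * m.1, spinAct p.1.1 m.2.1 + (p.2 / 3) • m.2.1,
        p.1.1.mulVec m.2.2 - (2 / 3 * p.2) • m.2.2) := by
  have h : act (mid p) = midEnd p.1.1 p.2 :=
    act_ofEnd _ (modelDeriv_midEnd (so10_skew p.1) p.2)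
  rw [h, midEnd_apply]

attribute [irreducible] act lo hi mid

end E6Elements

/-! ### Every element is a sum of `lo`, `mid` and `hi`. -/

section Decomposition

variable {k : Type*} [Field k] [CharZero k]

/-- If `w` is isotropic and `τ w ≠ 0`, the relation makes `w` orthogonal to everything, so `w = 0`.
If `w` is not isotropic, `w' = w` gives `3 * form w w • τ w = 0`. Linearity of `τ` is not needed. -/
theorem eq_zero_of_form_smul {E : Type*} [AddCommGroup E] [Module k E] {τ : Vec k → E}
    (h0 : τ 0 = 0) (h : ∀ w w', (2 * form w w') • τ w + form w w • τ w' = 0) (w : Vec k) :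
    τ w = 0 := by
  by_cases hw : form w w = 0
  · by_contra hτ
    have h1 : ∀ w', form w w' = 0 := by
      intro w'
      have := h w w'
      rw [hw, zero_smul, add_zero] at this
      simpa using (smul_eq_zero.1 this).resolve_right hτ
    have h2 : w = 0 := eq_of_form fun v => by rw [form_comm, h1, map_zero]
    exact hτ (by rw [h2, h0])
  · have h1 := h w w
    rw [← add_smul] at h1
    refine (smul_eq_zero.1 h1).resolve_left ?_
    have : 2 * form w w + form w w = 3 * form w w := by ring
    rw [this]
    exact mul_ne_zero three_ne_zero hw

theorem form_eq_zero {w : Vec k} (h : ∀ v, form w v = 0) : w = 0 :=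
  eq_of_form fun v => by rw [form_comm, h, map_zero]

theorem dot_eq_zero {s : Spin k} (h : ∀ t, s ⬝ᵥ t = 0) : s = 0 := by
  ext i
  simpa using h (Pi.single i 1)

theorem model_mk_zero : ((0, 0, 0) : Model k) = 0 := rfl

/-- The value of an element of `E₆` at the first basis vector. -/
theorem act_one_vec (X : e6 k) : (act X (1, 0, 0)).2.2 = 0 := by
  refine form_eq_zero fun w => ?_
  have h := modelPolar_act X (1, 0, 0) (1, 0, 0) (0, 0, w)
  simp only [modelPolar, map_zero, LinearMap.zero_apply, dotProduct_zero, zero_dotProduct] at h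
  have h2 : (2 : k) * form (act X (1, 0, 0)).2.2 w = 0 := by linear_combination h
  exact (mul_eq_zero.1 h2).resolve_left two_ne_zero

/-- An element of `E₆` that kills the first basis vector, maps vectors to spinors and has no
component from spinors to scalars kills vectors. -/
theorem act_vec_eq_zero {X : e6 k} (h1 : act X (1, 0, 0) = 0)
    (h2 : ∀ w, (act X (0, 0, w)).2.2 = 0) (h3 : ∀ s, (act X (0, s, 0)).1 = 0) (w : Vec k) :
    act X (0, 0, w) = 0 := by
  have h4 : ∀ s, (act X (0, s, 0)).2.2 = 0 := by
    intro s
    refine form_eq_zero fun w => ?_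
    have h := modelPolar_act X (1, 0, 0) (0, s, 0) (0, 0, w)
    rw [h1] at h
    simpa [modelPolar] using h
  have h0 : act X ((0, 0, 0) : Model k) = 0 := map_zero _
  have h5 : ∀ w, (act X (0, 0, w)).1 = 0 := by
    refine eq_zero_of_form_smul (by rw [h0]; rfl) fun w w' => ?_
    have h := modelPolar_act X (0, 0, w) (0, 0, w) (0, 0, w')
    simp only [modelPolar, h2, map_zero, LinearMap.zero_apply, dotProduct_zero, zero_dotProduct,
      form_comm w' w] at h
    simp only [smul_eq_mul]
    linear_combination h
  have h6 : ∀ w, (act X (0, 0, w)).2.1 = 0 := by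
    -- With `σ w` the spinor component of `X w`, polarization gives `w'·σ w + w·σ w' = 0`, in
    -- particular `w·σ w = 0`. Multiplying by `w` and applying the Clifford relation turns this into
    -- the hypothesis of `eq_zero_of_form_smul`.
    have key : ∀ w w', spinMul w' (act X (0, 0, w)).2.1 + spinMul w (act X (0, 0, w')).2.1 = 0 := by
      intro w w'
      refine dot_eq_zero fun s => ?_
      have h := modelPolar_act X (0, s, 0) (0, 0, w) (0, 0, w')
      simp only [modelPolar, h2, h3, h4, map_zero, LinearMap.zero_apply, dotProduct_zero,
        zero_dotProduct] at h
      rw [add_dotProduct, spinMul_dot w', spinMul_dot w, dotProduct_comm, spinMul_dot, 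
        dotProduct_comm _ (spinMul w s)]
      rw [spinMul_dot w' s] at h
      linear_combination -h
    refine eq_zero_of_form_smul (by rw [h0]; rfl) fun w w' => ?_
    have e1 := congrArg (spinMul (swap w)) (key w w')
    have e2 := spinMul_swap_spinMul w w' (act X (0, 0, w)).2.1
    have e3 := spinMul_swap_spinMul w w (act X (0, 0, w')).2.1
    have e4 := congrArg (spinMul (swap w')) (key w w)
    rw [map_add, map_zero] at e1 e4
    linear_combination (norm := module) (2 : k) • e1 - (2 : k) • e2 - e3 + e4
  exact Prod.ext (h5 w) (Prod.ext (h6 w) (h2 w))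

theorem prod_decomp (m : Model k) : m = m.1 • (1, 0, 0) + (0, m.2.1, 0) + (0, 0, m.2.2) := by
  simp

set_option maxHeartbeats 2000000 in
/-- An element of `E₆` that kills the first basis vector and the vectors, and has no component
from spinors to scalars, is zero. -/
theorem eq_zero_of_act [IsAlgClosed k] {X : e6 k} (h1 : act X (1, 0, 0) = 0)
    (h2 : ∀ w, act X (0, 0, w) = 0) (h3 : ∀ s, (act X (0, s, 0)).1 = 0) : X = 0 := by
  have h4 : ∀ s, (act X (0, s, 0)).2.2 = 0 := by
    intro s
    refine form_eq_zero fun w => ?_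
    have h := modelPolar_act X (1, 0, 0) (0, s, 0) (0, 0, w)
    rw [h1, h2] at h
    simpa [modelPolar] using h
  let Y : Module.End k (Spin k) :=
    LinearMap.fst k _ _ ∘ₗ LinearMap.snd k _ _ ∘ₗ act X ∘ₗ LinearMap.inr k _ _ ∘ₗ
      LinearMap.inl k _ _
  have hY : ∀ s, act X (0, s, 0) = (0, Y s, 0) := fun s =>
    Prod.ext (h3 s) (Prod.ext rfl (h4 s))
  have key : ∀ w s t, spinMul w s ⬝ᵥ Y t = -(spinMul w (Y s) ⬝ᵥ t) := by
    intro w s t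
    have h := modelPolar_act X (0, s, 0) (0, t, 0) (0, 0, w)
    rw [hY, hY, h2] at h
    simp only [modelPolar, map_zero, LinearMap.zero_apply, dotProduct_zero,
        zero_dotProduct, Prod.fst_zero, Prod.snd_zero] at h
    linear_combination -h
  -- The element `[X, hi (w'·s)] - hi (w'·Y s)` again kills the first basis vector, has no
  -- vector-to-vector block, and by `key` has no spinor-to-scalar block. So it kills vectors;
  -- evaluated on `w` this says that `Y` commutes with the even Clifford algebra.
  have hcomm : ∀ w w' s, Y (spinMul (swap w) (spinMul w' s)) =
      spinMul (swap w) (spinMul w' (Y s)) := by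
    intro w w' s
    have hact : ∀ m, act (⁅X, hi (spinMul w' s)⁆ - hi (spinMul w' (Y s))) m =
        act X (act (hi (spinMul w' s)) m) - act (hi (spinMul w' s)) (act X m) -
          act (hi (spinMul w' (Y s))) m := by
      intro m
      rw [map_sub, LinearMap.sub_apply, act_lie]
    have h := act_vec_eq_zero (X := ⁅X, hi (spinMul w' s)⁆ - hi (spinMul w' (Y s))) ?_ ?_ ?_ w
    · rw [hact, h2, map_zero, act_hi, act_hi] at h
      simp only [dotProduct_zero, hY] at h
      have := congrArg (fun m => m.2.1) h
      simpa [sub_eq_zero] using this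
    · rw [hact, h1, map_zero, act_hi, act_hi]
      simp [model_mk_zero]
    · intro w
      rw [hact, h2, map_zero, act_hi, act_hi]
      simp only [dotProduct_zero, hY]
      simp
    · intro t
      rw [hact, act_hi, act_hi, hY, act_hi]
      simp only [map_zero, LinearMap.zero_apply]
      have e : ((spinMul w' s ⬝ᵥ t, 0, 0) : Model k) = (spinMul w' s ⬝ᵥ t) • (1, 0, 0) := by simp
      rw [e, map_smul, h1]
      simp [key]
  -- Schur's lemma: an eigenspace of `Y` is stable under the even Clifford algebra, so `Y` is the
  -- scalar `μ`; then `key` gives `μ = -μ` as soon as one matrix entry of a Clifford multiplication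
  -- is nonzero.
  obtain ⟨μ, hμ⟩ := Module.End.exists_eigenvalue Y
  have htop : Y.eigenspace μ = ⊤ := by
    refine (spin_irreducible _ fun w w' s hs => ?_).resolve_left hμ
    rw [Module.End.mem_eigenspace_iff] at hs ⊢
    rw [hcomm, hs, map_smul, map_smul]
  have hYμ : ∀ s, Y s = μ • s := fun s =>
    Module.End.mem_eigenspace_iff.1 (htop ▸ Submodule.mem_top)
  have hμ0 : μ = 0 := by
    have h := key (Pi.single (.inl 0) 1) (Pi.single 0 1) (Pi.single 14 1)
    have e : spinMul (Pi.single (.inl 0) 1) (Pi.single 0 1 : Spin k) 14 = 1 := by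
      rw [spinMul_single]
      simp [spinSign, spinIndex]
    rw [hYμ, hYμ, map_smul, smul_dotProduct, dotProduct_smul, dotProduct_single, e] at h
    simp only [mul_one, smul_eq_mul] at h
    exact self_eq_neg.1 h
  refine e6_ext fun m => ?_
  rw [prod_decomp m, map_add, map_add, map_smul, h1, h2, hY, hYμ, hμ0]
  simp

set_option maxHeartbeats 2000000 in
/-- Every element of `E₆` is a sum of elements of degree `-1`, `0` and `1`. -/
theorem exists_decomp [IsAlgClosed k] (X : e6 k) : ∃ ξ p η, X = lo ξ + mid p + hi η := by
  let e : Model k := (1, 0, 0)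
  -- The parameters are read off from blocks of `X`: `mid (A, c)` acts on the scalar by `4/3 * c`
  -- and on vectors by `A - 2/3 * c`, which explains the factor `3/4` here and the correction term
  -- in `A`.
  let c : k := 3 / 4 * (act X e).1
  let A : Matrix (Fin 5 ⊕ Fin 5) (Fin 5 ⊕ Fin 5) k := LinearMap.toMatrix'
    (LinearMap.snd k _ _ ∘ₗ LinearMap.snd k _ _ ∘ₗ act X ∘ₗ LinearMap.inr k _ _ ∘ₗ
      LinearMap.inr k _ _) + (2 / 3 * c) • 1
  have hA : ∀ w, A.mulVec w = (act X (0, 0, w)).2.2 + (2 / 3 * c) • w := by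
    intro w
    simp only [A, Matrix.add_mulVec, LinearMap.toMatrix'_mulVec, Matrix.smul_mulVec,
      Matrix.one_mulVec]
    rfl
  have hskew : IsSkew A := by
    intro w w'
    have h := modelPolar_act X (1, 0, 0) (0, 0, w) (0, 0, w')
    simp only [modelPolar, map_zero, LinearMap.zero_apply, dotProduct_zero, zero_dotProduct] at h
    rw [hA, hA, map_add, map_add, map_smul, map_smul, LinearMap.add_apply, LinearMap.smul_apply]
    simp only [smul_eq_mul, c, e]
    linear_combination h
  let p : so10 k × k := (⟨A, (mem_so10_iff A).2 hskew⟩, c)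
  let η : Spin k := fun i => (act X (0, Pi.single i 1, 0)).1
  have hη : ∀ s, η ⬝ᵥ s = (act X (0, s, 0)).1 := by
    intro s
    let φ : Spin k →ₗ[k] k := LinearMap.fst k _ _ ∘ₗ act X ∘ₗ LinearMap.inr k _ _ ∘ₗ
      LinearMap.inl k _ _
    have h : φ s = ∑ i, s i * φ (Pi.single i 1) := by
      conv_lhs => rw [← Finset.univ_sum_single s, map_sum]
      refine Finset.sum_congr rfl fun i _ => ?_
      rw [← smul_eq_mul, ← map_smul, ← Pi.single_smul, smul_eq_mul, mul_one]
    change _ = φ s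
    rw [h, dotProduct]
    exact Finset.sum_congr rfl fun i _ => mul_comm _ _
  refine ⟨(act X e).2.1, p, η, ?_⟩
  rw [← sub_eq_zero]
  have hact : ∀ m, act (X - (lo (act X e).2.1 + mid p + hi η)) m =
      act X m - (act (lo (act X e).2.1) m + act (mid p) m + act (hi η) m) := by
    intro m
    rw [map_sub, map_add, map_add]
    rfl
  have e1 : act (X - (lo (act X e).2.1 + mid p + hi η)) (1, 0, 0) = 0 := by
    rw [hact, act_lo, act_mid, act_hi]
    refine Prod.ext ?_ (Prod.ext ?_ ?_)
    · simp [p, c, e]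
      ring
    · simp [p, c, e]
    · simpa [p, c, e] using act_one_vec X
  have e3 : ∀ s, (act (X - (lo (act X e).2.1 + mid p + hi η)) (0, s, 0)).1 = 0 := by
    intro s
    rw [hact, act_lo, act_mid, act_hi]
    simp [hη]
  refine eq_zero_of_act e1 (act_vec_eq_zero e1 (fun w => ?_) e3) e3
  rw [hact, act_lo, act_mid, act_hi]
  have : p.1.1 = A := rfl
  simp [this, hA, p]

end Decomposition

/-! ### Brackets and graded pieces. -/

section Brackets

variable {k : Type*} [Field k] [CharZero k]

/-- Transposing reverses the two Clifford factors. Skewness of `A` together with the Clifford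
relation restores their order up to a multiple of the trace, which vanishes. -/
theorem spinAct_transpose {A : Matrix (Fin 5 ⊕ Fin 5) (Fin 5 ⊕ Fin 5) k} (hA : IsSkew A)
    (s t : Spin k) : spinAct A.transpose s ⬝ᵥ t = s ⬝ᵥ spinAct A t := by
  have h1 : s ⬝ᵥ spinAct A t = ((2⁻¹ : k) •
      ∑ a, spinMul (Pi.single a.swap 1) (spinMul (swap (A.col a)) s)) ⬝ᵥ t := by
    rw [spinAct_apply, dotProduct_smul, smul_dotProduct, dotProduct_sum, sum_dotProduct]
    simp only [← spinMul_dot]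
  have h2 : ∀ a, swap (A.transpose.col a) = -A.col a.swap := by
    intro a
    ext b
    have := hA (Pi.single b.swap 1) (Pi.single a.swap 1)
    rw [form_single_right, form_comm, form_single_right] at this
    simp only [Matrix.mulVec_single_one, Sum.swap_swap] at this
    exact this
  have h3 : spinAct A.transpose s = (2⁻¹ : k) •
      ∑ a, -spinMul (A.col a) (spinMul (swap (Pi.single a.swap 1)) s) := by
    rw [spinAct_apply, ← (Equiv.sumComm (Fin 5) (Fin 5)).sum_comp]
    congr 1
    refine Finset.sum_congr rfl fun a _ => ?_
    rw [h2]
    simp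
  rw [h1, h3]
  congr 2
  rw [← sub_eq_zero, ← Finset.sum_sub_distrib]
  have h4 : ∀ a, -spinMul (A.col a) (spinMul (swap (Pi.single a.swap 1)) s) -
      spinMul (Pi.single a.swap 1) (spinMul (swap (A.col a)) s) =
        -(form (A.col a) (Pi.single a.swap 1) • s) := by
    intro a
    rw [← spinMul_spinMul_swap]
    abel
  simp only [h4, Finset.sum_neg_distrib, ← Finset.sum_smul, form_single_right, Sum.swap_swap]
  rw [show ∑ a, A.col a a = A.trace from rfl, hA.trace_eq_zero, zero_smul, neg_zero]

theorem lie_hi_hi (η η' : Spin k) : ⁅hi η, hi η'⁆ = 0 := by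
  refine e6_ext fun m => ?_
  rw [act_lie, act_hi, act_hi, act_hi, act_hi, map_zero]
  simp only [map_zero, LinearMap.zero_apply]
  rw [← spinMul_dot, dotProduct_comm, sub_self]

theorem lie_lo_lo (ξ ξ' : Spin k) : ⁅lo ξ, lo ξ'⁆ = 0 := by
  refine e6_ext fun m => ?_
  rw [act_lie, act_lo, act_lo, act_lo, act_lo, map_zero]
  simp only [map_smul, zero_smul, spinPair_comm ξ']
  exact sub_self _

theorem act_lie_hi_lo (η ξ : Spin k) (m : Model k) : act ⁅hi η, lo ξ⁆ m =
    ((η ⬝ᵥ ξ) * m.1, spinMul (swap (spinPair ξ m.2.1)) η - (η ⬝ᵥ m.2.1) • ξ,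
      -spinPair ξ (spinMul (swap m.2.2) η)) := by
  rw [act_lie, act_hi, act_lo, act_hi, act_lo]
  simp [mul_comm]

/-- The spinor-to-spinor block never has to be compared, which is what keeps the bracket
computations short. -/
theorem eq_of_act [IsAlgClosed k] {X Y : e6 k} (h1 : act X (1, 0, 0) = act Y (1, 0, 0))
    (h2 : ∀ w, act X (0, 0, w) = act Y (0, 0, w))
    (h3 : ∀ s, (act X (0, s, 0)).1 = (act Y (0, s, 0)).1) : X = Y := by
  have h : ∀ m, act (X - Y) m = act X m - act Y m := fun m => by
    rw [map_sub, LinearMap.sub_apply]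
  rw [← sub_eq_zero]
  refine eq_zero_of_act ?_ (fun w => ?_) (fun s => ?_)
  · rw [h, h1, sub_self]
  · rw [h, h2, sub_self]
  · rw [h, Prod.fst_sub, h3, sub_self]

theorem lie_mid_lo [IsAlgClosed k] (p : so10 k × k) (ξ : Spin k) :
    ⁅mid p, lo ξ⁆ = lo (spinAct p.1.1 ξ - p.2 • ξ) := by
  refine eq_of_act ?_ (fun w => ?_) (fun s => ?_)
  · rw [act_lie, act_lo, act_mid, act_mid, act_lo, act_lo]
    refine Prod.ext ?_ (Prod.ext ?_ ?_)
    · simp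
    · simp only [one_smul, mul_one, Prod.snd_sub, Prod.fst_sub]
      module
    · simp
  · rw [act_lie, act_lo, act_mid, act_mid, act_lo, act_lo]
    simp [model_mk_zero]
  · rw [act_lie, act_lo, act_mid, act_mid, act_lo, act_lo]
    simp

theorem lie_mid_hi [IsAlgClosed k] (p : so10 k × k) (η : Spin k) :
    ⁅mid p, hi η⁆ = hi (p.2 • η - spinAct p.1.1.transpose η) := by
  have hd : ∀ s, spinAct p.1.1.transpose η ⬝ᵥ s = η ⬝ᵥ spinAct p.1.1 s :=
    spinAct_transpose (so10_skew p.1) η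
  rw [← sub_eq_zero]
  have h : ∀ m, act (⁅mid p, hi η⁆ - hi (p.2 • η - spinAct p.1.1.transpose η)) m =
      act (mid p) (act (hi η) m) - act (hi η) (act (mid p) m) -
        act (hi (p.2 • η - spinAct p.1.1.transpose η)) m := fun m => by
    rw [map_sub, LinearMap.sub_apply, act_lie]
  have e1 : act (⁅mid p, hi η⁆ - hi (p.2 • η - spinAct p.1.1.transpose η)) (1, 0, 0) = 0 := by
    rw [h, act_hi, act_mid, act_mid, act_hi, act_hi]
    simp
  have e3 : ∀ s, (act (⁅mid p, hi η⁆ - hi (p.2 • η - spinAct p.1.1.transpose η))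
      (0, s, 0)).1 = 0 := by
    intro s
    rw [h, act_hi, act_mid, act_mid, act_hi, act_hi]
    simp only [Prod.fst_sub, dotProduct_add, dotProduct_smul, sub_dotProduct, smul_dotProduct, hd,
      smul_eq_mul]
    ring
  refine eq_zero_of_act e1 (act_vec_eq_zero e1 (fun w => ?_) e3) e3
  rw [h, act_hi, act_mid, act_mid, act_hi, act_hi]
  simp

/-- Only scalars and vectors are checked; that `spinAct` respects commutators is then a consequence
and not an input. -/
theorem lie_mid_mid [IsAlgClosed k] (p q : so10 k × k) :
    ⁅mid p, mid q⁆ = mid (⁅p.1, q.1⁆, 0) := by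
  refine eq_of_act ?_ (fun w => ?_) (fun s => ?_)
  · rw [act_lie, act_mid, act_mid, act_mid, act_mid, act_mid]
    refine Prod.ext ?_ (Prod.ext ?_ ?_)
    · simp only [Prod.fst_sub]
      ring
    · simp
    · simp
  · rw [act_lie, act_mid, act_mid, act_mid, act_mid, act_mid]
    refine Prod.ext ?_ (Prod.ext ?_ ?_)
    · simp
    · simp
    · have hb : (⁅p.1, q.1⁆ : so10 k).1 = p.1.1 * q.1.1 - q.1.1 * p.1.1 := rfl
      simp only [Prod.snd_sub, hb, Matrix.sub_mulVec, Matrix.mulVec_sub, Matrix.mulVec_smul,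
        ← Matrix.mulVec_mulVec]
      module
  · rw [act_lie, act_mid, act_mid, act_mid, act_mid, act_mid]
    simp

theorem decomp_eq_zero {ξ η : Spin k} {p : so10 k × k} (h : lo ξ + mid p + hi η = 0) :
    ξ = 0 ∧ p = 0 ∧ η = 0 := by
  have hm : ∀ m, act (lo ξ) m + act (mid p) m + act (hi η) m = 0 := by
    intro m
    have := congrArg (fun X => act X m) h
    simpa using this
  have h1 := hm (1, 0, 0)
  rw [act_lo, act_mid, act_hi] at h1
  have h2 : p.2 = 0 := by simpa using congrArg Prod.fst h1
  have h3 : ξ = 0 := by simpa using congrArg (fun m => m.2.1) h1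
  have h4 : p.1.1 = 0 := by
    refine Matrix.ext_of_mulVec_single fun a => ?_
    have h5 := hm (0, 0, Pi.single a 1)
    rw [act_lo, act_mid, act_hi, h2] at h5
    rw [Matrix.zero_mulVec]
    simpa using congrArg (fun m => m.2.2) h5
  refine ⟨h3, Prod.ext (Subtype.ext h4) h2, dot_eq_zero fun s => ?_⟩
  have h6 := hm (0, s, 0)
  rw [act_lo, act_mid, act_hi] at h6
  simpa using congrArg Prod.fst h6

theorem lo_zero : lo (0 : Spin k) = 0 := map_zero lo

theorem hi_zero : hi (0 : Spin k) = 0 := map_zero hi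

theorem mid_zero : mid (0 : so10 k × k) = 0 := map_zero mid

theorem lo_injective : Function.Injective (lo (k := k)) :=
  (injective_iff_map_eq_zero _).2 fun ξ h =>
    (decomp_eq_zero (ξ := ξ) (p := 0) (η := 0) (by simpa using h)).1

theorem hi_injective : Function.Injective (hi (k := k)) :=
  (injective_iff_map_eq_zero _).2 fun ξ h =>
    (decomp_eq_zero (ξ := 0) (p := 0) (η := ξ) (by simpa using h)).2.2

theorem mid_injective : Function.Injective (mid (k := k)) :=
  (injective_iff_map_eq_zero _).2 fun ξ h =>
    (decomp_eq_zero (ξ := 0) (p := ξ) (η := 0) (by simpa using h)).2.1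

theorem coord_gradingEnd (v : J27 k) : coord k (gradingEnd k v) =
    (4 / 3 * (coord k v).1, (1 / 3 : k) • (coord k v).2.1, (-2 / 3 : k) • (coord k v).2.2) := by
  rw [coord_apply, coord_apply]
  refine Prod.ext ?_ (Prod.ext ?_ ?_)
  · simp [gradingEnd, gradingMatrix]
    ring
  · ext i
    fin_cases i <;> simp [gradingEnd, gradingMatrix, spinCoord] <;> ring
  · ext (i | i) <;> fin_cases i <;> simp [gradingEnd, gradingMatrix, vecCoord] <;> ring

theorem gradingElt_eq : gradingElt k = mid (0, 1) := by
  refine e6_ext fun m => ?_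
  rw [act_apply, act_mid]
  refine (coord_gradingEnd _).trans ?_
  rw [LinearEquiv.apply_symm_apply]
  refine Prod.ext ?_ (Prod.ext ?_ ?_)
  · simp
  · simp
  · simp only [ZeroMemClass.coe_zero, Matrix.zero_mulVec]
    module

variable [IsAlgClosed k]

theorem lie_gradingElt_lo (ξ : Spin k) : ⁅gradingElt k, lo ξ⁆ = -lo ξ := by
  rw [gradingElt_eq, lie_mid_lo, ← map_neg]
  congr 1
  simp

theorem lie_gradingElt_hi (η : Spin k) : ⁅gradingElt k, hi η⁆ = hi η := by
  rw [gradingElt_eq, lie_mid_hi]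
  congr 1
  simp

theorem lie_gradingElt_mid (p : so10 k × k) : ⁅gradingElt k, mid p⁆ = 0 := by
  rw [gradingElt_eq, lie_mid_mid, zero_lie]
  exact mid_zero

theorem lie_gradingElt (ξ η : Spin k) (p : so10 k × k) :
    ⁅gradingElt k, lo ξ + mid p + hi η⁆ = -lo ξ + hi η := by
  rw [lie_add, lie_add, lie_gradingElt_lo, lie_gradingElt_mid, lie_gradingElt_hi, add_zero]

theorem eq_hi_of_lie {ξ η : Spin k} {p : so10 k × k}
    (h : ⁅gradingElt k, lo ξ + mid p + hi η⁆ = lo ξ + mid p + hi η) :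
    lo ξ + mid p + hi η = hi η := by
  rw [lie_gradingElt] at h
  have h2 : lo (-(2 : k) • ξ) + mid (-p) + hi 0 = 0 := by
    rw [map_smul, map_neg, hi_zero]
    linear_combination (norm := module) h
  obtain ⟨h3, h4, -⟩ := decomp_eq_zero h2
  have h5 : lo ξ = 0 := by
    rw [(smul_eq_zero.1 h3).resolve_left (neg_ne_zero.2 two_ne_zero), lo_zero]
  have h6 : mid p = 0 := by
    rw [← neg_eq_zero, ← map_neg, h4, mid_zero]
  rw [h5, h6, zero_add, zero_add]

theorem eq_lo_of_lie {ξ η : Spin k} {p : so10 k × k}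
    (h : ⁅gradingElt k, lo ξ + mid p + hi η⁆ = -(lo ξ + mid p + hi η)) :
    lo ξ + mid p + hi η = lo ξ := by
  rw [lie_gradingElt] at h
  have h2 : lo 0 + mid p + hi ((2 : k) • η) = 0 := by
    rw [map_smul, lo_zero]
    linear_combination (norm := module) h
  obtain ⟨-, h4, h3⟩ := decomp_eq_zero h2
  have h5 : hi η = 0 := by
    rw [(smul_eq_zero.1 h3).resolve_left two_ne_zero, hi_zero]
  have h6 : mid p = 0 := by rw [h4, mid_zero]
  rw [h5, h6, add_zero, add_zero]

theorem eq_mid_of_lie {ξ η : Spin k} {p : so10 k × k}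
    (h : ⁅gradingElt k, lo ξ + mid p + hi η⁆ = 0) : lo ξ + mid p + hi η = mid p := by
  rw [lie_gradingElt] at h
  have h2 : lo (-ξ) + mid 0 + hi η = 0 := by
    rw [map_neg, mid_zero, add_zero, h]
  obtain ⟨h3, -, h4⟩ := decomp_eq_zero h2
  have h5 : lo ξ = 0 := by rw [neg_eq_zero.1 h3, lo_zero]
  have h6 : hi η = 0 := by rw [h4, hi_zero]
  rw [h5, h6, zero_add, add_zero]

theorem mem_g_one {X : e6 k} : X ∈ g k 1 ↔ ∃ η, X = hi η := by
  constructor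
  · intro h
    obtain ⟨ξ, p, η, rfl⟩ := exists_decomp X
    rw [mem_piece, one_smul] at h
    exact ⟨η, eq_hi_of_lie h⟩
  · rintro ⟨η, rfl⟩
    rw [mem_piece, lie_gradingElt_hi, one_smul]

theorem mem_g_neg_one {X : e6 k} : X ∈ g k (-1) ↔ ∃ ξ, X = lo ξ := by
  constructor
  · intro h
    obtain ⟨ξ, p, η, rfl⟩ := exists_decomp X
    rw [mem_piece, neg_one_smul] at h
    exact ⟨ξ, eq_lo_of_lie h⟩
  · rintro ⟨ξ, rfl⟩
    rw [mem_piece, lie_gradingElt_lo, neg_one_smul]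

theorem mem_g_zero {X : e6 k} : X ∈ g k 0 ↔ ∃ p, X = mid p := by
  constructor
  · intro h
    obtain ⟨ξ, p, η, rfl⟩ := exists_decomp X
    rw [mem_piece, zero_smul] at h
    exact ⟨p, eq_mid_of_lie h⟩
  · rintro ⟨p, rfl⟩
    rw [mem_piece, lie_gradingElt_mid, zero_smul]

variable (k) in
theorem g_sup_eq_top : g k (-1) ⊔ g k 0 ⊔ g k 1 = ⊤ := by
  refine Submodule.eq_top_iff'.2 fun X => ?_
  obtain ⟨ξ, p, η, rfl⟩ := exists_decomp X
  exact Submodule.add_mem_sup (Submodule.add_mem_sup (mem_g_neg_one.2 ⟨ξ, rfl⟩)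
    (mem_g_zero.2 ⟨p, rfl⟩)) (mem_g_one.2 ⟨η, rfl⟩)

/-- The map `mid` with values in `𝔤(0)`. -/
noncomputable def midZero : (so10 k × k) →ₗ[k] g0 k :=
  mid.codRestrict (g0 k).toSubmodule fun p => mem_g_zero.2 ⟨p, rfl⟩

theorem coe_midZero (p : so10 k × k) : (midZero p : e6 k) = mid p := rfl

theorem midZero_lie (p q : so10 k × k) : midZero ⁅p, q⁆ = ⁅midZero p, midZero q⁆ := by
  have h : ⁅p, q⁆ = (⁅p.1, q.1⁆, 0) := by
    refine Prod.ext rfl ?_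
    change p.2 * q.2 - q.2 * p.2 = 0
    ring
  refine Subtype.ext ?_
  rw [LieSubalgebra.coe_bracket, coe_midZero, coe_midZero, coe_midZero, lie_mid_mid, h]

theorem midZero_bijective : Function.Bijective (midZero (k := k)) := by
  refine ⟨fun p q h => mid_injective (congrArg Subtype.val h), fun X => ?_⟩
  obtain ⟨p, hp⟩ := mem_g_zero.1 X.2
  exact ⟨p, Subtype.ext hp.symm⟩

variable (k) in
/-- The identification of `𝔤(0)` with `𝔰𝔬₁₀ ⊕ k`. -/
noncomputable def midEquiv : (so10 k × k) ≃ₗ⁅k⁆ g0 k :=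
  LieEquiv.ofBijective { midZero with map_lie' := fun {p q} => midZero_lie p q } midZero_bijective

theorem so10Embedding_midEquiv (A : so10 k) : so10Embedding (midEquiv k) A = mid (A, 0) := rfl

theorem so10Ad_lo (A : so10 k) (ξ : Spin k) :
    so10Ad (midEquiv k) A (lo ξ) = lo (spinAct A.1 ξ) := by
  rw [so10Ad, so10Embedding_midEquiv, LieAlgebra.ad_apply, lie_mid_lo, zero_smul, sub_zero]

theorem so10Ad_hi (A : so10 k) (η : Spin k) :
    so10Ad (midEquiv k) A (hi η) = hi (-spinAct A.1.transpose η) := by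
  rw [so10Ad, so10Embedding_midEquiv, LieAlgebra.ad_apply, lie_mid_hi, zero_smul, zero_sub]

end Brackets

/-! ### Commuting pairs in `𝔤₁` -/

section Commuting

variable {k : Type*} [Field k] [CharZero k]

/-- Comparing `B(s,s)·s = 0` at `s + t` and `s - t` isolates the part linear in `t`. -/
theorem spinMul_spinPair_polar (s t : Spin k) :
    spinMul (spinPair s s) t = -(2 : k) • spinMul (spinPair s t) s := by
  have h1 := spinMul_spinPair_self (s + t)
  have h2 := spinMul_spinPair_self (s - t)
  simp only [map_add, map_sub, LinearMap.add_apply, LinearMap.sub_apply, spinMul_spinPair_self,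
    spinPair_comm t s] at h1 h2
  have h3 : (2 : k) • (spinMul (spinPair s s) t + (2 : k) • spinMul (spinPair s t) s) = 0 := by
    linear_combination (norm := module) h1 - h2
  have h4 := (smul_eq_zero.1 h3).resolve_left two_ne_zero
  rw [neg_smul]
  exact eq_neg_of_add_eq_zero_left h4

/-- Pair with `w` and apply the Clifford relation to `B(s,s)` and `w` at `s`, where one of the two
products vanishes. -/
theorem spinPair_spinMul_swap (s t : Spin k) :
    spinPair s (spinMul (swap (spinPair s s)) t) = (s ⬝ᵥ t) • spinPair s s := by
  refine eq_of_form fun w => ?_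
  have h := spinMul_swap_spinMul (spinPair s s) w s
  rw [spinMul_spinPair_self, map_zero, add_zero] at h
  rw [form_spinPair, dotProduct_comm, spinMul_dot, dotProduct_comm, h, smul_dotProduct, map_smul,
    form_comm, smul_eq_mul, smul_eq_mul, mul_comm]

/-- The spinor `σ = B(η,η)·η'` is annihilated by `B(ξ,ξ)` and by `B(η,η)`, two vectors with nonzero
pairing `N`; the Clifford relation then forces `σ = 0`. -/
theorem form_spinPair_eq_zero_of_commute {η η' ξ ξ' : Spin k}
    (h : ⁅hi η + lo ξ, hi η' + lo ξ'⁆ = 0)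
    (hN : form (swap (spinPair η η)) (spinPair ξ ξ) ≠ 0) :
    form (spinPair η η) (spinPair η' η') = 0 := by
  have h0 : ∀ w, spinPair ξ' (spinMul (swap w) η) = spinPair ξ (spinMul (swap w) η') := by
    intro w
    have h1 : ⁅hi η, lo ξ'⁆ = ⁅hi η', lo ξ⁆ := by
      rw [lie_add, add_lie, add_lie, lie_hi_hi, lie_lo_lo, zero_add, add_zero,
        ← lie_skew (lo ξ)] at h
      rw [← sub_eq_zero]
      linear_combination (norm := module) h
    have h2 := congrArg (fun X => (act X (0, 0, w)).2.2) h1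
    simpa only [act_lie_hi_lo, neg_inj] using h2
  set σ := spinMul (spinPair η η) η' with hσ
  have h1 : spinPair ξ σ = 0 := by
    -- For this `w` the left side of `h0` contains `B(η,η)·η = 0`.
    have := h0 (swap (spinPair η η))
    rw [swap_swap, spinMul_spinPair_self, map_zero] at this
    exact this.symm
  have h2 : spinMul (spinPair ξ ξ) σ = 0 := by
    rw [spinMul_spinPair_polar, h1]
    simp
  have h3 : spinMul (swap (spinPair η η)) σ = 0 := by
    have := spinMul_swap_self (swap (spinPair η η)) η'
    rw [swap_swap, form_swap_swap, form_spinPair_self, zero_div, zero_smul] at this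
    exact this
  have h4 := spinMul_swap_spinMul (swap (spinPair η η)) (spinPair ξ ξ) σ
  rw [h2, h3, map_zero, map_zero, add_zero] at h4
  have h5 := (smul_eq_zero.1 h4.symm).resolve_left hN
  rw [form_spinPair, ← hσ, h5, zero_dotProduct]

/-- The generalized eigenspaces of a semisimple endomorphism are eigenspaces; this is applied to the
eigenvalue zero of `ad x`. -/
theorem isSemisimple_pow_three {E : Type*} [AddCommGroup E] [Module k E] {T : Module.End k E}
    (hT : T.IsSemisimple) {u : E} (h : T (T (T u)) = 0) : T u = 0 := by
  have h1 := hT.isFinitelySemisimple.genEigenspace_eq_eigenspace 0 (k := 3) (by norm_num)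
  have h2 : u ∈ T.genEigenspace 0 3 := by
    rw [show (3 : ℕ∞) = ((3 : ℕ) : ℕ∞) from rfl, Module.End.mem_genEigenspace_nat]
    simpa [pow_succ] using h
  rw [h1, Module.End.mem_eigenspace_iff, zero_smul] at h2
  exact h2

variable [IsAlgClosed k]

/-- The degree places the bracket in `𝔤(1)`, so its spinor can be read off from the spinor-to-scalar
block. -/
theorem lie_lie_hi_lo_hi (a b c : Spin k) : ⁅⁅hi a, lo b⁆, hi c⁆ =
    hi ((a ⬝ᵥ b) • c + (c ⬝ᵥ b) • a - spinMul (swap (spinPair a c)) b) := by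
  have h0 : ⁅⁅hi a, lo b⁆, hi c⁆ ∈ g k 1 := by
    rw [mem_piece, one_smul, leibniz_lie, leibniz_lie, lie_gradingElt_hi, lie_gradingElt_hi,
      lie_gradingElt_lo, lie_neg, add_neg_cancel, zero_lie, zero_add]
  obtain ⟨T, hT⟩ := mem_g_one.1 h0
  rw [hT]
  congr 1
  rw [← sub_eq_zero]
  refine dot_eq_zero fun s => ?_
  have h1 := congrArg (fun X => (act X (0, s, 0)).1) hT
  simp only [act_lie ⁅hi a, lo b⁆, act_lie_hi_lo, act_hi, Prod.fst_sub, dotProduct_sub,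
    dotProduct_smul, smul_eq_mul] at h1
  have h2 : c ⬝ᵥ spinMul (swap (spinPair b s)) a = spinMul (swap (spinPair a c)) b ⬝ᵥ s := by
    rw [dotProduct_comm, ← form_spinPair, ← form_spinPair, form_swap_left, form_comm]
  rw [h2] at h1
  simp only [sub_dotProduct, add_dotProduct, smul_dotProduct, smul_eq_mul]
  linear_combination -h1

theorem lie_lie_hi_lo_lo (a b c : Spin k) : ⁅⁅hi a, lo b⁆, lo c⁆ =
    lo (spinMul (swap (spinPair b c)) a - (a ⬝ᵥ c) • b - (a ⬝ᵥ b) • c) := by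
  have h0 : ⁅⁅hi a, lo b⁆, lo c⁆ ∈ g k (-1) := by
    rw [mem_piece, neg_one_smul, leibniz_lie, leibniz_lie, lie_gradingElt_hi, lie_gradingElt_lo,
      lie_gradingElt_lo, lie_neg, add_neg_cancel, zero_lie, zero_add, lie_neg]
  obtain ⟨T, hT⟩ := mem_g_neg_one.1 h0
  rw [hT]
  congr 1
  have h1 := congrArg (fun X => (act X (1, 0, 0)).2.1) hT
  simp only [act_lie ⁅hi a, lo b⁆, act_lie_hi_lo, act_lo, Prod.fst_sub, Prod.snd_sub, one_smul,
    mul_one] at h1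
  exact h1.symm

theorem lie_lie_hi_lo (η ξ : Spin k) : ⁅hi η + lo ξ, ⁅hi η, lo ξ⁆⁆ =
    -hi ((2 * (η ⬝ᵥ ξ)) • η - spinMul (swap (spinPair η η)) ξ)
      - lo (spinMul (swap (spinPair ξ ξ)) η - (2 * (η ⬝ᵥ ξ)) • ξ) := by
  rw [← lie_skew, lie_add, lie_lie_hi_lo_hi, lie_lie_hi_lo_lo]
  simp only [map_add, map_sub, map_smul]
  module

theorem lie_hi_add_lo (η ξ P Q : Spin k) :
    ⁅hi η + lo ξ, -hi P + lo Q⁆ = ⁅hi η, lo Q⁆ + ⁅hi P, lo ξ⁆ := by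
  rw [lie_add, lie_neg, add_lie, add_lie, lie_hi_hi, lie_lo_lo, ← lie_skew (lo ξ)]
  module

theorem lie_gradingElt_right (η ξ : Spin k) : ⁅hi η + lo ξ, gradingElt k⁆ = -hi η + lo ξ := by
  rw [← lie_skew, lie_add, lie_gradingElt_hi, lie_gradingElt_lo, neg_add, neg_neg]

/-- Put `P = B(η,η)·ξ` and `Q = B(ξ,ξ)·η`. If `N = 0`, then `⟨η, Q⟩ = ⟨P, ξ⟩ = 0`, `B(η,η)·Q = 0`
and `B(ξ,ξ)·P = 0`, while `B(P,η)` and `B(Q,ξ)` are `⟨η, ξ⟩` times `B(η,η)` and `B(ξ,ξ)`. Each of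
the four triple brackets then vanishes separately. -/
theorem lie_hi_add_lo_cube {η ξ : Spin k}
    (hN : form (swap (spinPair η η)) (spinPair ξ ξ) = 0) :
    ⁅hi η + lo ξ, ⁅hi η, lo (spinMul (swap (spinPair ξ ξ)) η)⁆ +
      ⁅hi (spinMul (swap (spinPair η η)) ξ), lo ξ⁆⁆ = 0 := by
  have e1 : η ⬝ᵥ spinMul (swap (spinPair ξ ξ)) η = 0 := by
    rw [dotProduct_comm, ← form_spinPair, form_swap_left, form_comm, hN]
  have e2 : spinMul (swap (spinPair η η)) ξ ⬝ᵥ ξ = 0 := by rw [← form_spinPair, hN]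
  have e3 : spinPair (spinMul (swap (spinPair η η)) ξ) η = (η ⬝ᵥ ξ) • spinPair η η := by
    rw [spinPair_comm, spinPair_spinMul_swap]
  have e4 : spinPair (spinMul (swap (spinPair ξ ξ)) η) ξ = (η ⬝ᵥ ξ) • spinPair ξ ξ := by
    rw [spinPair_comm, spinPair_spinMul_swap, dotProduct_comm]
  have e5 : spinMul (swap (spinPair η η)) (spinMul (swap (spinPair ξ ξ)) η) = 0 := by
    have := spinMul_swap_spinMul (spinPair η η) (swap (spinPair ξ ξ)) η
    rwa [spinMul_spinPair_self, map_zero, add_zero, ← form_swap_left, hN, zero_smul] at this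
  have e6 : spinMul (swap (spinPair ξ ξ)) (spinMul (swap (spinPair η η)) ξ) = 0 := by
    have := spinMul_swap_spinMul (spinPair ξ ξ) (swap (spinPair η η)) ξ
    rwa [spinMul_spinPair_self, map_zero, add_zero, form_comm, hN, zero_smul] at this
  have e7 : ∀ s : Spin k, spinMul (swap ((η ⬝ᵥ ξ) • spinPair η η)) s =
      (η ⬝ᵥ ξ) • spinMul (swap (spinPair η η)) s := fun s => by
    rw [map_smul, map_smul, LinearMap.smul_apply]
  have e8 : ∀ s : Spin k, spinMul (swap ((η ⬝ᵥ ξ) • spinPair ξ ξ)) s =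
      (η ⬝ᵥ ξ) • spinMul (swap (spinPair ξ ξ)) s := fun s => by
    rw [map_smul, map_smul, LinearMap.smul_apply]
  have h1 : ⁅⁅hi η, lo (spinMul (swap (spinPair ξ ξ)) η)⁆, hi η⁆ = 0 := by
    rw [lie_lie_hi_lo_hi, e1, e5, ← hi_zero]
    congr 1
    module
  have h2 : ⁅⁅hi (spinMul (swap (spinPair η η)) ξ), lo ξ⁆, hi η⁆ = 0 := by
    rw [lie_lie_hi_lo_hi, e2, e3, e7, ← hi_zero]
    congr 1
    module
  have h3 : ⁅⁅hi η, lo (spinMul (swap (spinPair ξ ξ)) η)⁆, lo ξ⁆ = 0 := by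
    rw [lie_lie_hi_lo_lo, e1, e4, e8, ← lo_zero]
    congr 1
    module
  have h4 : ⁅⁅hi (spinMul (swap (spinPair η η)) ξ), lo ξ⁆, lo ξ⁆ = 0 := by
    rw [lie_lie_hi_lo_lo, e2, e6, ← lo_zero]
    congr 1
    module
  rw [← lie_skew, lie_add, add_lie, add_lie, h1, h2, h3, h4, add_zero, add_zero, neg_zero]

/-- With `x = hi η + lo ξ`, the element `2⟨η, ξ⟩ z - [hi η, lo ξ]`, where `z` is the grading
element, is chosen so that the terms in `hi η` and `lo ξ` cancel in its bracket with `x`, leaving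
`-hi P + lo Q`. Two further brackets with `x` give zero, so by semisimplicity the first bracket is
already zero. -/
theorem spinMul_eq_zero_of_isSemisimple {η ξ : Spin k}
    (hs : (LieAlgebra.ad k (e6 k) (hi η + lo ξ)).IsSemisimple)
    (hN : form (swap (spinPair η η)) (spinPair ξ ξ) = 0) :
    spinMul (swap (spinPair ξ ξ)) η = 0 ∧ spinMul (swap (spinPair η η)) ξ = 0 := by
  have h1 : ⁅hi η + lo ξ, (2 * (η ⬝ᵥ ξ)) • gradingElt k - ⁅hi η, lo ξ⁆⁆ =
      -hi (spinMul (swap (spinPair η η)) ξ) + lo (spinMul (swap (spinPair ξ ξ)) η) := by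
    have e : ⁅hi η + lo ξ, (2 * (η ⬝ᵥ ξ)) • gradingElt k⁆ =
        (2 * (η ⬝ᵥ ξ)) • (-hi η + lo ξ) := by rw [lie_smul, lie_gradingElt_right]
    rw [lie_sub, e, lie_lie_hi_lo]
    simp only [map_sub, map_smul]
    module
  have h4 : ⁅hi η + lo ξ, (2 * (η ⬝ᵥ ξ)) • gradingElt k - ⁅hi η, lo ξ⁆⁆ = 0 := by
    refine isSemisimple_pow_three hs ?_
    simp only [LieAlgebra.ad_apply]
    rw [h1, lie_hi_add_lo, lie_hi_add_lo_cube hN]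
  rw [h1] at h4
  have h5 : lo (spinMul (swap (spinPair ξ ξ)) η) + mid 0 +
      hi (-spinMul (swap (spinPair η η)) ξ) = 0 := by
    rw [mid_zero, add_zero, map_neg, add_comm]
    exact h4
  obtain ⟨hQ0, -, hP0⟩ := decomp_eq_zero h5
  exact ⟨hQ0, neg_eq_zero.1 hP0⟩

/-- From `P = 0` comes `⟨η, ξ⟩ B(η,η) = 0`. If `B(η,η) ≠ 0`, then `⟨η, ξ⟩ = 0` and `x` commutes with
`[hi η, lo ξ]`, so `(ad x)^3` kills the grading element. By semisimplicity `x` commutes with the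
grading element, which is impossible unless `η = 0`. -/
theorem spinPair_eq_zero_of_isSemisimple {η ξ : Spin k}
    (hs : (LieAlgebra.ad k (e6 k) (hi η + lo ξ)).IsSemisimple)
    (hN : form (swap (spinPair η η)) (spinPair ξ ξ) = 0) : spinPair η η = 0 := by
  obtain ⟨hQ0, hP0⟩ := spinMul_eq_zero_of_isSemisimple hs hN
  have h6 := spinPair_spinMul_swap η ξ
  rw [hP0, map_zero] at h6
  by_contra hb
  have ht0 : η ⬝ᵥ ξ = 0 := (smul_eq_zero.1 h6.symm).resolve_right hb
  have hD : ⁅hi η + lo ξ, ⁅hi η, lo ξ⁆⁆ = 0 := by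
    rw [lie_lie_hi_lo, ht0, mul_zero, zero_smul, zero_smul, hP0, hQ0, sub_self, lo_zero, hi_zero,
      neg_zero, sub_zero]
  have h8 : ⁅hi η + lo ξ, gradingElt k⁆ = 0 := by
    refine isSemisimple_pow_three hs ?_
    simp only [LieAlgebra.ad_apply]
    rw [lie_gradingElt_right, lie_hi_add_lo, lie_add, hD, add_zero]
  rw [lie_gradingElt_right] at h8
  have h9 : lo ξ + mid 0 + hi (-η) = 0 := by
    rw [mid_zero, add_zero, map_neg, add_comm, h8]
  have h10 := neg_eq_zero.1 (decomp_eq_zero h9).2.2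
  exact hb (by rw [h10, map_zero])

theorem form_spinPair_eq_zero_of_commute_isSemisimple {η η' ξ ξ' : Spin k}
    (h : ⁅hi η + lo ξ, hi η' + lo ξ'⁆ = 0)
    (hs : (LieAlgebra.ad k (e6 k) (hi η + lo ξ)).IsSemisimple) :
    form (spinPair η η) (spinPair η' η') = 0 := by
  by_cases hN : form (swap (spinPair η η)) (spinPair ξ ξ) = 0
  · rw [spinPair_eq_zero_of_isSemisimple hs hN, map_zero, LinearMap.zero_apply]
  · exact form_spinPair_eq_zero_of_commute h hN

end Commuting

/-! ### Exponentials and one-parameter subgroups -/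

section Exponential

variable {k : Type*} [Field k]

/-- The truncated exponential series of an endomorphism. -/
def expEnd {M : Type*} [AddCommGroup M] [Module k M] (T : Module.End k M) (N : ℕ) :
    Module.End k M :=
  ∑ j ∈ Finset.range N, ((Nat.factorial j : k)⁻¹) • T ^ j

theorem expEnd_apply {M : Type*} [AddCommGroup M] [Module k M] (T : Module.End k M) (N : ℕ)
    (x : M) : expEnd T N x = ∑ j ∈ Finset.range N, ((Nat.factorial j : k)⁻¹) • (T ^ j) x := by
  simp [expEnd, LinearMap.sum_apply]

theorem pow_apply_eq_zero_of_le {M : Type*} [AddCommGroup M] [Module k M] {T : Module.End k M}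
    {N K : ℕ} (h : N ≤ K) {x : M} (hx : (T ^ N) x = 0) : (T ^ K) x = 0 := by
  rw [← Nat.sub_add_cancel h, pow_add, Module.End.mul_apply, hx, map_zero]

theorem expEnd_of_le {M : Type*} [AddCommGroup M] [Module k M] {T : Module.End k M} {N K : ℕ}
    (h : N ≤ K) {x : M} (hx : (T ^ N) x = 0) : expEnd T K x = expEnd T N x := by
  rw [expEnd_apply, expEnd_apply]
  symm
  refine Finset.sum_subset (Finset.range_mono h) fun j _ hj => ?_
  rw [pow_apply_eq_zero_of_le (by simpa using hj) hx, smul_zero]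

theorem expEnd_of_pow_eq_zero {M : Type*} [AddCommGroup M] [Module k M] {T : Module.End k M}
    {N K : ℕ} {x : M} (hN : (T ^ N) x = 0) (hK : (T ^ K) x = 0) : expEnd T K x = expEnd T N x := by
  rcases le_total N K with h | h
  · exact expEnd_of_le h hN
  · exact (expEnd_of_le h hK).symm

variable [CharZero k] {M N P : Type*} [AddCommGroup M] [Module k M] [AddCommGroup N] [Module k N]
  [AddCommGroup P] [Module k P] {β : M →ₗ[k] N →ₗ[k] P} {S : Module.End k M} {T : Module.End k N}
  {U : Module.End k P}

theorem apply_divPow {E : Type*} [AddCommGroup E] [Module k E] (R : Module.End k E) (j : ℕ)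
    (e : E) : R (((Nat.factorial j : k)⁻¹) • (R ^ j) e) =
      ((j : k) + 1) • ((Nat.factorial (j + 1) : k)⁻¹) • (R ^ (j + 1)) e := by
  have hj : (j : k) + 1 ≠ 0 := Nat.cast_add_one_ne_zero j
  rw [map_smul, pow_succ' R, Module.End.mul_apply, smul_smul, Nat.factorial_succ]
  congr 1
  push_cast
  field_simp

/-- The Leibniz rule in divided powers, where it has no binomial coefficients. In the induction the
factor `n + 1` is split as `p.1 + p.2` over the antidiagonal. -/
theorem divPow_bilin (h : ∀ x y, U (β x y) = β (S x) y + β x (T y)) (x : M) (y : N) (n : ℕ) :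
    ((Nat.factorial n : k)⁻¹) • (U ^ n) (β x y) = ∑ p ∈ Finset.HasAntidiagonal.antidiagonal n,
      β (((Nat.factorial p.1 : k)⁻¹) • (S ^ p.1) x) (((Nat.factorial p.2 : k)⁻¹) • (T ^ p.2) y) := by
  induction n with
  | zero => simp
  | succ n ih =>
    have hn : (n : k) + 1 ≠ 0 := Nat.cast_add_one_ne_zero n
    rw [← smul_right_inj hn, ← apply_divPow, ih, map_sum]
    simp only [h, apply_divPow]
    have e1 := Finset.Nat.sum_antidiagonal_succ (n := n) (f := fun p => (p.1 : k) •
      β (((Nat.factorial p.1 : k)⁻¹) • (S ^ p.1) x) (((Nat.factorial p.2 : k)⁻¹) • (T ^ p.2) y))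
    have e2 := Finset.Nat.sum_antidiagonal_succ' (n := n) (f := fun p => (p.2 : k) •
      β (((Nat.factorial p.1 : k)⁻¹) • (S ^ p.1) x) (((Nat.factorial p.2 : k)⁻¹) • (T ^ p.2) y))
    simp only [Nat.cast_zero, zero_smul, zero_add, Nat.cast_add, Nat.cast_one, add_zero] at e1 e2
    rw [Finset.sum_add_distrib, Finset.smul_sum]
    have e3 : ∀ p ∈ Finset.HasAntidiagonal.antidiagonal (n + 1), ((n : k) + 1) •
        β (((Nat.factorial p.1 : k)⁻¹) • (S ^ p.1) x) (((Nat.factorial p.2 : k)⁻¹) • (T ^ p.2) y) =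
        (p.1 : k) •
        β (((Nat.factorial p.1 : k)⁻¹) • (S ^ p.1) x) (((Nat.factorial p.2 : k)⁻¹) • (T ^ p.2) y) +
        (p.2 : k) •
        β (((Nat.factorial p.1 : k)⁻¹) • (S ^ p.1) x)
          (((Nat.factorial p.2 : k)⁻¹) • (T ^ p.2) y) := by
      intro p hp
      rw [← add_smul]
      congr 1
      rw [← Nat.cast_add, Finset.HasAntidiagonal.mem_antidiagonal.1 hp, Nat.cast_add, Nat.cast_one]
    rw [Finset.sum_congr rfl e3, Finset.sum_add_distrib, e1, e2]
    simp only [map_smul, LinearMap.smul_apply]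
    exact congrArg₂ (· + ·) (Finset.sum_congr rfl fun p _ => by module) rfl

theorem pow_bilin_eq_zero (h : ∀ x y, U (β x y) = β (S x) y + β x (T y)) {x : M} {y : N} {m n : ℕ}
    (hx : (S ^ m) x = 0) (hy : (T ^ n) y = 0) : (U ^ (m + n)) (β x y) = 0 := by
  have h1 := divPow_bilin h x y (m + n)
  rw [Finset.sum_eq_zero] at h1
  · exact (smul_eq_zero.1 h1).resolve_left
      (inv_ne_zero (Nat.cast_ne_zero.2 (Nat.factorial_ne_zero _)))
  · intro p hp
    rw [Finset.HasAntidiagonal.mem_antidiagonal] at hp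
    rcases le_or_gt m p.1 with h2 | h2
    · rw [pow_apply_eq_zero_of_le h2 hx, smul_zero, map_zero, LinearMap.zero_apply]
    · rw [pow_apply_eq_zero_of_le (by omega) hy, smul_zero, map_zero]

/-- Exponentials of compatible operators are compatible with `β`. It serves for the Lie bracket, for
`spinPair` and for `form`. Nilpotency is required only at the given vectors, so infinite-dimensional
modules cause no difficulty. -/
theorem expEnd_bilin (h : ∀ x y, U (β x y) = β (S x) y + β x (T y)) {x : M} {y : N} {m n : ℕ}
    (hx : (S ^ m) x = 0) (hy : (T ^ n) y = 0) :
    expEnd U (m + n) (β x y) = β (expEnd S m x) (expEnd T n y) := by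
  rw [expEnd_apply, expEnd_apply, expEnd_apply]
  simp only [divPow_bilin h, map_sum, LinearMap.sum_apply]
  have h0 := Finset.sum_product (Finset.range m) (Finset.range n) fun p : ℕ × ℕ =>
    β (((Nat.factorial p.1 : k)⁻¹) • (S ^ p.1) x) (((Nat.factorial p.2 : k)⁻¹) • (T ^ p.2) y)
  rw [Finset.sum_comm, ← h0,
    ← Finset.sum_fiberwise_of_maps_to (t := Finset.range (m + n)) (g := fun p : ℕ × ℕ => p.1 + p.2)]
  · refine Finset.sum_congr rfl fun j _ => ?_
    symm
    refine Finset.sum_subset (fun p hp => ?_) fun p hp hp' => ?_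
    · simpa using (Finset.mem_filter.1 hp).2
    · rw [Finset.HasAntidiagonal.mem_antidiagonal] at hp
      rcases le_or_gt m p.1 with h2 | h2
      · rw [pow_apply_eq_zero_of_le h2 hx, smul_zero, map_zero, LinearMap.zero_apply]
      · rcases le_or_gt n p.2 with h3 | h3
        · rw [pow_apply_eq_zero_of_le h3 hy, smul_zero, map_zero]
        · exact absurd (Finset.mem_filter.2 ⟨Finset.mem_product.2
            ⟨Finset.mem_range.2 h2, Finset.mem_range.2 h3⟩, hp⟩) hp'
  · intro p hp
    simp only [Finset.mem_product, Finset.mem_range] at hp ⊢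
    omega

variable {L : Type*} [LieRing L] [LieAlgebra k L]

theorem IsExpAd.map_lie {n : L} {g : L ≃ₗ[k] L} (hg : IsExpAd n g) (x y : L) :
    g ⁅x, y⁆ = ⁅g x, g y⁆ := by
  obtain ⟨N, hN, hg⟩ := hg
  have hp : ∀ z, (LieAlgebra.ad k L n ^ N) z = 0 := fun z => by rw [hN, LinearMap.zero_apply]
  have h1 := expEnd_bilin (β := (LieModule.toEnd k L L).toLinearMap) (S := LieAlgebra.ad k L n)
    (T := LieAlgebra.ad k L n) (U := LieAlgebra.ad k L n) (fun x y => leibniz_lie n x y)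
    (hp x) (hp y)
  rw [expEnd_of_le (Nat.le_add_right N N) (hp _)] at h1
  simp only [expEnd_apply] at h1
  simp only [← hg] at h1
  exact h1

theorem IsMultOneParam.map_lie {h : L} {lam : kˣ →* (L ≃ₗ[k] L)} (hl : IsMultOneParam h lam)
    (t : kˣ) (x y : L) : lam t ⁅x, y⁆ = ⁅lam t x, lam t y⁆ := by
  have hx : x ∈ ⨆ i : ℤ, (LieAlgebra.ad k L h).eigenspace (i : k) := by
    rw [hl.1]; trivial
  have hy : y ∈ ⨆ i : ℤ, (LieAlgebra.ad k L h).eigenspace (i : k) := by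
    rw [hl.1]; trivial
  induction hx using Submodule.iSup_induction' with
  | zero => simp
  | add x x' _ _ h1 h2 => rw [add_lie, map_add, h1, h2, map_add, add_lie]
  | mem i x hx =>
    induction hy using Submodule.iSup_induction' with
    | zero => simp
    | add y y' _ _ h1 h2 => rw [lie_add, map_add, h1, h2, map_add, lie_add]
    | mem j y hy =>
      have hxy : ⁅x, y⁆ ∈ (LieAlgebra.ad k L h).eigenspace ((i + j : ℤ) : k) := by
        rw [Module.End.mem_eigenspace_iff] at hx hy ⊢
        rw [LieAlgebra.ad_apply] at hx hy ⊢
        rw [leibniz_lie, hx, hy, smul_lie, lie_smul, ← add_smul, Int.cast_add]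
      rw [hl.2 t i x hx, hl.2 t j y hy, hl.2 t _ _ hxy, smul_lie, lie_smul, smul_smul, zpow_add,
        Units.val_mul]

theorem map_lie_of_mem_connectedSubgroup {m : LieSubalgebra k L} {g : L ≃ₗ[k] L}
    (hg : g ∈ connectedSubgroup m) (x y : L) : g ⁅x, y⁆ = ⁅g x, g y⁆ := by
  induction hg using Subgroup.closure_induction generalizing x y with
  | mem g hg =>
    rcases hg with ⟨n, _, hn⟩ | ⟨h, _, lam, hl, t, rfl⟩
    · exact hn.map_lie x y
    · exact hl.map_lie t x y
  | one => rfl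
  | mul g g' _ _ h1 h2 => rw [LinearEquiv.mul_apply, h2, h1]; rfl
  | inv g _ h1 =>
    have h2 : ∀ z, g (g⁻¹ z) = z := fun z => g.apply_symm_apply z
    refine g.injective ?_
    rw [h1, h2, h2, h2]

/-- Applied to the grading element, this shows that the groups of subalgebras of `𝔤(0)` preserve the
graded pieces. -/
theorem apply_eq_of_mem_connectedSubgroup {m : LieSubalgebra k L} {g : L ≃ₗ[k] L}
    (hg : g ∈ connectedSubgroup m) {z : L} (hz : ∀ n ∈ m, ⁅n, z⁆ = 0) : g z = z := by
  induction hg using Subgroup.closure_induction with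
  | mem g hg =>
    rcases hg with ⟨n, hn, N, hN, hg⟩ | ⟨h, hh, lam, hl, t, rfl⟩
    · have h1 : ((LieAlgebra.ad k L n) ^ 1) z = 0 := by rw [pow_one]; exact hz n hn
      have h2 : ((LieAlgebra.ad k L n) ^ N) z = 0 := by rw [hN]; rfl
      rw [hg, ← expEnd_apply, expEnd_of_pow_eq_zero h1 h2, expEnd_apply]
      simp
    · have h1 : z ∈ (LieAlgebra.ad k L h).eigenspace ((0 : ℤ) : k) := by
        rw [Module.End.mem_eigenspace_iff, LieAlgebra.ad_apply, hz h hh, Int.cast_zero, zero_smul]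
      rw [hl.2 t 0 z h1, zpow_zero, Units.val_one, one_smul]
  | one => rfl
  | mul g g' _ _ h1 h2 => rw [LinearEquiv.mul_apply, h2, h1]
  | inv g _ h1 =>
    refine g.injective ?_
    rw [h1]
    exact g.apply_symm_apply z

theorem mem_piece_of_mem_connectedSubgroup {m : LieSubalgebra k L} {g : L ≃ₗ[k] L}
    (hg : g ∈ connectedSubgroup m) {z : L} (hz : ∀ n ∈ m, ⁅n, z⁆ = 0) {i : k} {x : L}
    (hx : x ∈ piece z i) : g x ∈ piece z i := by
  rw [mem_piece] at hx ⊢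
  have h1 := map_lie_of_mem_connectedSubgroup hg z x
  rw [hx, apply_eq_of_mem_connectedSubgroup hg hz, map_smul] at h1
  exact h1.symm

theorem isSemisimple_ad_of_mem_connectedSubgroup {m : LieSubalgebra k L} {g : L ≃ₗ[k] L}
    (hg : g ∈ connectedSubgroup m) {x : L} (hx : (LieAlgebra.ad k L x).IsSemisimple) :
    (LieAlgebra.ad k L (g x)).IsSemisimple := by
  refine (LinearEquiv.isSemisimple_iff (f := LieAlgebra.ad k L x)
    (g := LieAlgebra.ad k L (g x)) g ?_).1 hx
  ext y
  simp [map_lie_of_mem_connectedSubgroup hg]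

end Exponential

/-! ### Polynomial functions -/

section Polynomial

variable {k V : Type*} [Field k] [AddCommGroup V] [Module k V]

theorem IsHomogeneousPolyFun.dual (φ : Module.Dual k V) : IsHomogeneousPolyFun k 1 φ :=
  ⟨MvPolynomial.X φ, MvPolynomial.isHomogeneous_X k φ, by ext v; simp [polyFun]⟩

theorem IsHomogeneousPolyFun.mul {m n : ℕ} {f f' : V → k} (h : IsHomogeneousPolyFun k m f)
    (h' : IsHomogeneousPolyFun k n f') : IsHomogeneousPolyFun k (m + n) fun v => f v * f' v := by
  obtain ⟨p, hp, rfl⟩ := h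
  obtain ⟨q, hq, rfl⟩ := h'
  exact ⟨p * q, hp.mul hq, by ext v; simp [polyFun]⟩

theorem IsHomogeneousPolyFun.const_mul {n : ℕ} {f : V → k} (h : IsHomogeneousPolyFun k n f)
    (a : k) : IsHomogeneousPolyFun k n fun v => a * f v := by
  obtain ⟨p, hp, rfl⟩ := h
  refine ⟨MvPolynomial.C a * p, ?_, by ext v; simp [polyFun]⟩
  simpa using (MvPolynomial.isHomogeneous_C _ a).mul hp

theorem IsHomogeneousPolyFun.sum {ι : Type*} {s : Finset ι} {n : ℕ} {f : ι → V → k}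
    (h : ∀ i ∈ s, IsHomogeneousPolyFun k n (f i)) :
    IsHomogeneousPolyFun k n fun v => ∑ i ∈ s, f i v := by
  choose! p hp hp' using h
  refine ⟨∑ i ∈ s, p i, MvPolynomial.IsHomogeneous.sum s p n hp, ?_⟩
  ext v
  rw [polyFun, map_sum]
  exact Finset.sum_congr rfl fun i hi => by rw [hp' i hi]; rfl

theorem IsHomogeneousPolyFun.bilin {ι : Type*} [Fintype ι] [DecidableEq ι]
    (β : (ι → k) →ₗ[k] (ι → k) →ₗ[k] k) (u v : V →ₗ[k] (ι → k)) :
    IsHomogeneousPolyFun k 2 fun x => β (u x) (v x) := by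
  have h : (fun x => β (u x) (v x)) = fun x => ∑ i, ∑ j, β (Pi.single i 1) (Pi.single j 1) *
      ((LinearMap.proj i).comp u x * (LinearMap.proj j).comp v x) := by
    ext x
    conv_lhs => rw [pi_eq_sum_univ' (u x), pi_eq_sum_univ' (v x)]
    simp only [map_sum, LinearMap.sum_apply, map_smul, LinearMap.smul_apply, smul_eq_mul,
      LinearMap.comp_apply, LinearMap.proj_apply]
    simp only [Finset.mul_sum]
    rw [Finset.sum_comm]
    refine Finset.sum_congr rfl fun i _ => Finset.sum_congr rfl fun j _ => ?_
    ring
  rw [h]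
  exact .sum fun i _ => .sum fun j _ =>
    ((IsHomogeneousPolyFun.dual ((LinearMap.proj i).comp u)).mul
      (IsHomogeneousPolyFun.dual ((LinearMap.proj j).comp v))).const_mul _

theorem IsHomogeneousPolyFun.isOpen {n : ℕ} {f : V → k} (h : IsHomogeneousPolyFun k n f) :
    @IsOpen V (zariski k V) {v | f v ≠ 0} := by
  obtain ⟨p, -, rfl⟩ := h
  exact TopologicalSpace.isOpen_generateFrom_of_mem ⟨p, rfl⟩

theorem IsHomogeneousPolyFun.eq_zero_of_mem_closure {n : ℕ} {f : V → k}
    (h : IsHomogeneousPolyFun k n f) {s : Set V} (hs : ∀ v ∈ s, f v = 0) {v : V}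
    (hv : v ∈ closure[zariski k V] s) : f v = 0 := by
  by_contra hf
  let _ := zariski k V
  obtain ⟨w, hw, hw'⟩ := mem_closure_iff.1 hv _ h.isOpen hf
  exact hw (hs w hw')

end Polynomial

/-! ### The quartic and the commuting variety -/

section Quartic

variable {k : Type*} [Field k] [CharZero k]

/-- The component in `𝔤(1)`. -/
noncomputable def hiPart : e6 k →ₗ[k] Spin k where
  toFun X J := (act X (0, Pi.single J 1, 0)).1
  map_add' X Y := by
    ext J
    simp
  map_smul' a X := by
    ext J
    simp

/-- The component in `𝔤(-1)`. -/
noncomputable def loPart : e6 k →ₗ[k] Spin k where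
  toFun X := (act X (1, 0, 0)).2.1
  map_add' X Y := by simp
  map_smul' a X := by simp

@[simp] theorem hiPart_hi (η : Spin k) : hiPart (hi η) = η := by
  ext J
  change (act (hi η) _).1 = _
  rw [act_hi]
  simp

@[simp] theorem hiPart_lo (ξ : Spin k) : hiPart (lo ξ) = 0 := by
  ext J
  change (act (lo ξ) _).1 = _
  rw [act_lo]
  rfl

@[simp] theorem hiPart_mid (p : so10 k × k) : hiPart (mid p) = 0 := by
  ext J
  change (act (mid p) _).1 = _
  rw [act_mid]
  simp

@[simp] theorem loPart_hi (η : Spin k) : loPart (hi η) = 0 := by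
  change (act (hi η) _).2.1 = _
  rw [act_hi]
  simp

@[simp] theorem loPart_lo (ξ : Spin k) : loPart (lo ξ) = ξ := by
  change (act (lo ξ) _).2.1 = _
  rw [act_lo]
  simp

/-- The quartic invariant `(η, η') ↦ (B(η, η), B(η', η'))`. -/
def quartic (η η' : Spin k) : k :=
  form (spinPair η η) (spinPair η' η')

theorem isHomogeneousPolyFun_form {V : Type*} [AddCommGroup V] [Module k V]
    (u v u' v' : V →ₗ[k] Spin k) :
    IsHomogeneousPolyFun k 4 fun x => form (spinPair (u x) (v x)) (spinPair (u' x) (v' x)) := by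
  have h : (fun x => form (spinPair (u x) (v x)) (spinPair (u' x) (v' x))) = fun x =>
      ∑ a : Fin 5 ⊕ Fin 5, spinPair.compr₂ (LinearMap.proj a) (u x) (v x) *
        spinPair.compr₂ (LinearMap.proj a.swap) (u' x) (v' x) := by
    ext x
    rw [form_apply]
    exact Finset.sum_congr rfl fun a _ => by rw [swap_apply]; rfl
  rw [h]
  exact .sum fun a _ => (IsHomogeneousPolyFun.bilin _ u v).mul (IsHomogeneousPolyFun.bilin _ u' v')

theorem form_swap_spinPair (s t s' t' : Spin k) :
    form (swap (spinPair s t)) (spinPair s' t') = ∑ a, spinPair s t a * spinPair s' t' a := by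
  rw [form_swap_left, form_apply, swap_swap]
  rfl

theorem isHomogeneousPolyFun_form_swap {V : Type*} [AddCommGroup V] [Module k V]
    (u v u' v' : V →ₗ[k] Spin k) : IsHomogeneousPolyFun k 4 fun x =>
      form (swap (spinPair (u x) (v x))) (spinPair (u' x) (v' x)) := by
  have h : (fun x => form (swap (spinPair (u x) (v x))) (spinPair (u' x) (v' x))) = fun x =>
      ∑ a : Fin 5 ⊕ Fin 5, spinPair.compr₂ (LinearMap.proj a) (u x) (v x) *
        spinPair.compr₂ (LinearMap.proj a) (u' x) (v' x) := by
    ext x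
    rw [form_swap_spinPair]
    rfl
  rw [h]
  exact .sum fun a _ => (IsHomogeneousPolyFun.bilin _ u v).mul (IsHomogeneousPolyFun.bilin _ u' v')

theorem exists_quartic_ne_zero : ∃ η η' : Spin k, quartic η η' ≠ 0 := by
  -- The two squares under `spinPair` are twice the dual basis vectors `e (.inr 0)` and `e (.inl
  -- 0)`, so the value is `4`.
  refine ⟨Pi.single 0 1 + Pi.single 14 1, Pi.single 1 1 + Pi.single 15 1, ?_⟩
  rw [quartic, form_apply]
  simp [dotProduct, Fintype.sum_sum_type, Fin.sum_univ_five, swap_apply, spinPair_apply, spinPairFun]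

theorem exists_form_swap_ne_zero :
    ∃ η : Spin k, form (swap (spinPair η η)) (spinPair η η) ≠ 0 := by
  refine ⟨Pi.single 0 1 + Pi.single 14 1, ?_⟩
  rw [form_swap_spinPair]
  simp [dotProduct, Fintype.sum_sum_type, Fin.sum_univ_five, spinPair_apply, spinPairFun]

variable [IsAlgClosed k]

theorem mem_odd {X : e6 k} : X ∈ g1 k ↔ ∃ η ξ, X = hi η + lo ξ := by
  rw [g1, odd, Submodule.mem_sup]
  constructor
  · rintro ⟨y, hy, z, hz, rfl⟩
    obtain ⟨ξ, rfl⟩ := mem_g_neg_one.1 hy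
    obtain ⟨η, rfl⟩ := mem_g_one.1 hz
    exact ⟨η, ξ, add_comm _ _⟩
  · rintro ⟨η, ξ, rfl⟩
    exact ⟨lo ξ, mem_g_neg_one.2 ⟨ξ, rfl⟩, hi η, mem_g_one.2 ⟨η, rfl⟩, add_comm _ _⟩

-- The witnesses are a pair in `𝔤(1) × 𝔤(1)`, which commutes because `𝔤(1)` is abelian, for `f ≠ 0`,
-- and a pair `(x, x)` for `N ≠ 0`. Irreducibility would give a commuting pair satisfying both
-- inequalities.
variable (k) in
theorem not_isIrreducible_commutingVariety :
    ¬ @IsIrreducible _ (zariski k (e6 k × e6 k)) (commutingVariety (g1 k)) := by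
  let _ := zariski k (e6 k × e6 k)
  rintro ⟨-, hirr⟩
  obtain ⟨η, η', hη⟩ := exists_quartic_ne_zero (k := k)
  obtain ⟨ζ, hζ⟩ := exists_form_swap_ne_zero (k := k)
  have h1 := (isHomogeneousPolyFun_form (hiPart.comp (LinearMap.fst k (e6 k) (e6 k)))
    (hiPart.comp (LinearMap.fst k (e6 k) (e6 k))) (hiPart.comp (LinearMap.snd k (e6 k) (e6 k)))
    (hiPart.comp (LinearMap.snd k (e6 k) (e6 k)))).isOpen
  have h2 := (isHomogeneousPolyFun_form_swap (hiPart.comp (LinearMap.fst k (e6 k) (e6 k)))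
    (hiPart.comp (LinearMap.fst k (e6 k) (e6 k))) (loPart.comp (LinearMap.fst k (e6 k) (e6 k)))
    (loPart.comp (LinearMap.fst k (e6 k) (e6 k)))).isOpen
  obtain ⟨⟨x, y⟩, ⟨hx, hy, hxy⟩, hf, hN⟩ := hirr _ _ h1 h2
    ⟨(hi η, hi η'), ⟨mem_odd.2 ⟨η, 0, by rw [lo_zero, add_zero]⟩,
      mem_odd.2 ⟨η', 0, by rw [lo_zero, add_zero]⟩, lie_hi_hi η η'⟩, by
      simpa [quartic] using hη⟩
    ⟨(hi ζ + lo ζ, hi ζ + lo ζ), ⟨mem_odd.2 ⟨ζ, ζ, rfl⟩, mem_odd.2 ⟨ζ, ζ, rfl⟩, lie_self _⟩, by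
      simpa using hζ⟩
  obtain ⟨η, ξ, rfl⟩ := mem_odd.1 hx
  obtain ⟨η', ξ', rfl⟩ := mem_odd.1 hy
  have hN' : form (swap (spinPair η η)) (spinPair ξ ξ) ≠ 0 := by simpa using hN
  have hf' : form (spinPair η η) (spinPair η' η') ≠ 0 := by simpa using hf
  exact hf' (form_spinPair_eq_zero_of_commute hxy hN')

theorem mem_projOne {c : Submodule k (e6 k)} (hc : c ≤ g1 k) {X : e6 k} :
    X ∈ projOne (gradingElt k) c ↔ ∃ η ξ, hi η + lo ξ ∈ c ∧ X = hi η := by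
  rw [projOne, Submodule.mem_inf, Submodule.mem_sup]
  constructor
  · rintro ⟨⟨y, hy, z, hz, rfl⟩, h⟩
    obtain ⟨ξ', rfl⟩ := mem_g_neg_one.1 hz
    obtain ⟨η, ξ, rfl⟩ := mem_odd.1 (hc hy)
    obtain ⟨ζ, hζ⟩ := mem_g_one.1 h
    refine ⟨η, ξ, hy, ?_⟩
    have h1 := congrArg hiPart hζ
    simp only [map_add, hiPart_hi, hiPart_lo, add_zero] at h1
    rw [hζ, h1]
  · rintro ⟨η, ξ, h, rfl⟩
    refine ⟨⟨_, h, lo (-ξ), mem_g_neg_one.2 ⟨_, rfl⟩, ?_⟩, mem_g_one.2 ⟨η, rfl⟩⟩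
    rw [map_neg, add_neg_cancel_right]

theorem lie_gradingElt_of_mem_even {n : e6 k} (hn : n ∈ even k (gradingElt k)) :
    ⁅n, gradingElt k⁆ = 0 := by
  rw [← lie_skew, neg_eq_zero]
  have h : n ∈ piece (gradingElt k) (0 : k) := hn
  rw [mem_piece, zero_smul] at h
  exact h

theorem exists_hi_lo_of_mem_connectedSubgroup {g : e6 k ≃ₗ[k] e6 k}
    (hg : g ∈ connectedSubgroup (even k (gradingElt k))) (η ξ : Spin k) :
    ∃ ζ θ, g (hi η) = hi ζ ∧ g (hi η + lo ξ) = hi ζ + lo θ := by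
  have hz : ∀ n ∈ even k (gradingElt k), ⁅n, gradingElt k⁆ = 0 := fun n hn =>
    lie_gradingElt_of_mem_even hn
  obtain ⟨ζ, hζ⟩ := mem_g_one.1 (mem_piece_of_mem_connectedSubgroup hg hz (mem_g_one.2 ⟨η, rfl⟩))
  obtain ⟨θ, hθ⟩ := mem_g_neg_one.1
    (mem_piece_of_mem_connectedSubgroup hg hz (mem_g_neg_one.2 ⟨ξ, rfl⟩))
  exact ⟨ζ, θ, hζ, by rw [map_add g, hζ, hθ]⟩

/-- Invariance of the quartic under `G₀` is not used: lift both projections to `c`, move the lifts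
by `g`, and observe that the result is again a commuting pair with semisimple first member. -/
theorem quartic_eq_zero_of_mem_sweep {c : Submodule k (e6 k)}
    (hc : IsCartanSubspace (g1 k) c) {q : e6 k × e6 k} (hq : q ∈ sweep (gradingElt k) c) :
    quartic (hiPart q.1) (hiPart q.2) = 0 := by
  obtain ⟨g, hg, a, ha, b, hb, hq⟩ := hq
  obtain ⟨hle, hcomm, hss⟩ := hc.prop
  obtain ⟨η, ξ, hx, ha'⟩ := (mem_projOne hle).1 ha
  obtain ⟨η', ξ', hy, hb'⟩ := (mem_projOne hle).1 hb
  obtain ⟨ζ, θ, h1, h2⟩ := exists_hi_lo_of_mem_connectedSubgroup hg η ξ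
  obtain ⟨ζ', θ', h1', h2'⟩ := exists_hi_lo_of_mem_connectedSubgroup hg η' ξ'
  have h3 := isSemisimple_ad_of_mem_connectedSubgroup hg (hss _ hx)
  have h4 := map_lie_of_mem_connectedSubgroup hg (hi η + lo ξ) (hi η' + lo ξ')
  have h5 : g ⁅hi η + lo ξ, hi η' + lo ξ'⁆ = 0 := by
    rw [hcomm _ hx _ hy]
    exact g.map_zero
  rw [h5, h2, h2'] at h4
  rw [h2] at h3
  have h6 : hiPart q.1 = ζ := by rw [hq, ha', h1, hiPart_hi]
  have h7 : hiPart q.2 = ζ' := by rw [hq, hb', h1', hiPart_hi]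
  rw [h6, h7]
  exact form_spinPair_eq_zero_of_commute_isSemisimple h4.symm h3

theorem quartic_eq_zero_of_mem_closure_sweep {c : Submodule k (e6 k)}
    (hc : IsCartanSubspace (g1 k) c) {q : e6 k × e6 k}
    (hq : q ∈ closure[zariski k (e6 k × e6 k)] (sweep (gradingElt k) c)) :
    quartic (hiPart q.1) (hiPart q.2) = 0 :=
  (isHomogeneousPolyFun_form (hiPart.comp (LinearMap.fst k (e6 k) (e6 k)))
    (hiPart.comp (LinearMap.fst k (e6 k) (e6 k))) (hiPart.comp (LinearMap.snd k (e6 k) (e6 k)))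
    (hiPart.comp (LinearMap.snd k (e6 k) (e6 k)))).eq_zero_of_mem_closure
    (fun _ hv => quartic_eq_zero_of_mem_sweep hc hv) hq

theorem not_spade {c : Submodule k (e6 k)} (hc : IsCartanSubspace (g1 k) c) :
    ¬ Spade (gradingElt k) c := by
  intro h
  obtain ⟨η, η', hη⟩ := exists_quartic_ne_zero (k := k)
  have h1 : (hi η, hi η') ∈ closure[zariski k (e6 k × e6 k)] (sweep (gradingElt k) c) := by
    rw [h]
    exact ⟨mem_g_one.2 ⟨η, rfl⟩, mem_g_one.2 ⟨η', rfl⟩⟩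
  have h2 := quartic_eq_zero_of_mem_closure_sweep hc h1
  rw [hiPart_hi, hiPart_hi] at h2
  exact hη h2

end Quartic

/-! ### Weights of the half-spinor representations -/

section Weights

variable {k : Type*} [Field k] [CharZero k]

theorem IsSkew.apply_swap {A : Matrix (Fin 5 ⊕ Fin 5) (Fin 5 ⊕ Fin 5) k} (hA : IsSkew A)
    (a b : Fin 5 ⊕ Fin 5) : A a.swap b.swap = -A b a := by
  have := hA (Pi.single b.swap 1) (Pi.single a 1)
  rw [form_single_right, form_comm, form_single_right] at this
  simp only [Matrix.mulVec_single_one, Sum.swap_swap] at this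
  exact this

theorem IsSkew.of_apply_swap {A : Matrix (Fin 5 ⊕ Fin 5) (Fin 5 ⊕ Fin 5) k}
    (hA : ∀ a b, A a.swap b.swap = -A b a) : IsSkew A := by
  have h : ∀ w w', form (A.mulVec w) w' = ∑ a, ∑ b, A a b * w b * w' a.swap := by
    intro w w'
    rw [form_apply]
    refine Finset.sum_congr rfl fun a _ => ?_
    rw [swap_apply, Matrix.mulVec, dotProduct, Finset.sum_mul]
  intro w w'
  rw [form_comm w, h, h, ← (Equiv.sumComm (Fin 5) (Fin 5)).sum_comp, Finset.sum_comm,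
    ← Finset.sum_neg_distrib]
  rw [← (Equiv.sumComm (Fin 5) (Fin 5)).sum_comp]
  refine Finset.sum_congr rfl fun a _ => ?_
  rw [← Finset.sum_neg_distrib]
  refine Finset.sum_congr rfl fun b _ => ?_
  simp only [Equiv.sumComm_apply, hA, Sum.swap_swap]
  ring

/-- The image of an element of `𝔰𝔬₁₀` under the automorphism `A ↦ -Aᵀ`, which exchanges the two
half-spinor representations. -/
def dual (A : so10 k) : so10 k :=
  ⟨-A.1.transpose, (mem_so10_iff _).2 <| IsSkew.of_apply_swap fun a b => by
    simp [(so10_skew A).apply_swap]⟩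

theorem coe_dual (A : so10 k) : (dual A).1 = -A.1.transpose := rfl

theorem dual_dual (A : so10 k) : dual (dual A) = A :=
  Subtype.ext (by simp [coe_dual])

theorem so10Ad_hi_dual [IsAlgClosed k] (A : so10 k) (η : Spin k) :
    so10Ad (midEquiv k) A (hi η) = hi (spinAct (dual A).1 η) := by
  rw [so10Ad_hi, coe_dual, map_neg spinAct, LinearMap.neg_apply]

/-- The element `w ∧ w'` of `𝔰𝔬₁₀`. -/
def wedge (w w' : Vec k) : so10 k :=
  ⟨Matrix.vecMulVec w (swap w') - Matrix.vecMulVec w' (swap w), (mem_so10_iff _).2 <|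
    IsSkew.of_apply_swap fun a b => by simp [Matrix.vecMulVec_apply, swap_apply]; ring⟩

theorem wedge_mulVec (w w' v : Vec k) :
    (wedge w w').1.mulVec v = form w' v • w - form w v • w' := by
  ext a
  simp [wedge, Matrix.sub_mulVec, Matrix.vecMulVec_mulVec, form_comm _ v, form_apply v,
    dotProduct_comm v]

theorem eq_sum_single (w : Vec k) : w = ∑ a, w a • (Pi.single a 1 : Vec k) := by
  conv_lhs => rw [pi_eq_sum_univ' w]

/-- Up to a scalar, `w ∧ w'` acts as a product of two Clifford multiplications; hence `𝔰𝔬₁₀`-stable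
subspaces are stable under the even Clifford algebra. -/
theorem spinAct_wedge (w w' : Vec k) (s : Spin k) : spinAct (wedge w w').1 s =
    spinMul (swap w) (spinMul w' s) - (form w w' / 2) • s := by
  have h : ∀ a, (wedge w w').1.col a = w' a.swap • w - w a.swap • w' := by
    intro a
    ext b
    simp [wedge, Matrix.vecMulVec_apply, swap_apply]
    ring
  have h1 : ∀ w : Vec k, spinMul w s = ∑ a : Fin 5 ⊕ Fin 5,
      w a.swap • spinMul (Pi.single a.swap 1) s := by
    intro w
    conv_lhs => rw [eq_sum_single w, map_sum, LinearMap.sum_apply,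
      ← (Equiv.sumComm (Fin 5) (Fin 5)).sum_comp]
    simp only [map_smul, LinearMap.smul_apply, Equiv.sumComm_apply]
  have h3 : ∀ w w' : Vec k, ∑ a : Fin 5 ⊕ Fin 5, w' a.swap •
      spinMul (swap w) (spinMul (Pi.single a.swap 1) s) = spinMul (swap w) (spinMul w' s) := by
    intro w w'
    rw [h1 w', map_sum]
    simp only [map_smul]
  rw [spinAct_apply]
  simp only [h, map_sub, map_smul, LinearMap.sub_apply, LinearMap.smul_apply]
  rw [Finset.sum_sub_distrib, h3, h3]
  have h2 := spinMul_swap_spinMul w w' s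
  rw [← eq_sub_iff_add_eq'] at h2
  rw [h2, inv_smul_eq_iff₀ two_ne_zero]
  module

/-- The half-spinor representations of `𝔰𝔬₁₀` are irreducible. -/
theorem spinAct_irreducible (U : Submodule k (Spin k))
    (hU : ∀ A : so10 k, ∀ s ∈ U, spinAct A.1 s ∈ U) : U = ⊥ ∨ U = ⊤ := by
  refine spin_irreducible U fun w w' s hs => ?_
  have h := spinAct_wedge w w' s
  rw [eq_sub_iff_add_eq] at h
  rw [← h]
  exact U.add_mem (hU _ s hs) (U.smul_mem _ hs)

theorem spinPair_spinAct {A : Matrix (Fin 5 ⊕ Fin 5) (Fin 5 ⊕ Fin 5) k} (hA : IsSkew A)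
    (s t : Spin k) :
    A.mulVec (spinPair s t) = spinPair (spinAct A s) t + spinPair s (spinAct A t) := by
  refine eq_of_form fun w => ?_
  have h := spinMul_spinAct hA w s t
  rw [map_add, form_spinPair, form_spinPair]
  rw [← form_spinPair, hA] at h
  linear_combination -h

theorem spinAct_eq_sum (A : Matrix (Fin 5 ⊕ Fin 5) (Fin 5 ⊕ Fin 5) k) (s : Spin k) :
    spinAct A s = (2⁻¹ : k) • ∑ a, ∑ b, A b a •
      spinMul (Pi.single b.swap 1) (spinMul (Pi.single a.swap 1) s) := by
  rw [spinAct_apply]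
  congr 1
  refine Finset.sum_congr rfl fun a _ => ?_
  rw [eq_sum_single (A.col a), map_sum, map_sum, LinearMap.sum_apply]
  refine Finset.sum_congr rfl fun b _ => ?_
  rw [map_smul, map_smul, swap_single, LinearMap.smul_apply]
  rfl

/-- Twice the value of the weight of the basis vector `e J` at `ε i`. -/
def spinWeight (J : Fin 16) (i : Fin 5) : ℤ :=
  if bitSet (.inr i) J then 1 else -1

theorem cartanElt_eq (a : Fin 5 → k) :
    (cartanElt a).1 = Matrix.diagonal (Sum.elim a (-a)) := by
  rw [cartanElt]
  ext (i | i) (j | j) <;> simp [Matrix.diagonal_apply, Matrix.fromBlocks]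

theorem dual_cartanElt (a : Fin 5 → k) : dual (cartanElt a) = cartanElt (-a) := by
  refine Subtype.ext ?_
  rw [coe_dual, cartanElt_eq, cartanElt_eq, Matrix.diagonal_transpose, Matrix.diagonal_neg]
  congr 1
  ext (i | i) <;> simp

/-- For a diagonal matrix only the terms `bitProj` survive. The projections for `inl i` and `inr i`
are complementary, so each coordinate contributes `± a i / 2`. -/
theorem spinAct_cartanElt (a : Fin 5 → k) (s : Spin k) (J : Fin 16) :
    spinAct (cartanElt a).1 s J = (∑ i, (spinWeight J i : k) / 2 * a i) * s J := by
  have h : ∀ b c, (cartanElt a).1 b c = if b = c then Sum.elim a (-a) b else 0 := by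
    intro b c
    rw [cartanElt_eq, Matrix.diagonal_apply]
  have h1 : spinAct (cartanElt a).1 s = (2⁻¹ : k) • ∑ c, Sum.elim a (-a) c • bitProj c.swap s := by
    rw [spinAct_eq_sum]
    congr 1
    refine Finset.sum_congr rfl fun c _ => ?_
    rw [Finset.sum_eq_single c]
    · rw [h, if_pos rfl]
      rfl
    · intro b _ hb
      rw [h, if_neg hb, zero_smul]
    · simp
  have h2 : ∀ i, bitSet (.inl i) J = !bitSet (.inr i) J := by
    revert J
    decide
  rw [h1]
  rw [Pi.smul_apply, Finset.sum_apply, Fintype.sum_sum_type, ← Finset.sum_add_distrib,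
    Finset.sum_mul, smul_eq_mul, Finset.mul_sum]
  refine Finset.sum_congr rfl fun i _ => ?_
  simp only [Pi.smul_apply, smul_eq_mul, bitProj_apply, Sum.elim_inl, Sum.elim_inr, Sum.swap_inl,
    Sum.swap_inr, Pi.neg_apply, h2, spinWeight]
  cases bitSet (.inr i) J <;> simp <;> ring

/-- The positions of the possibly nonzero entries of a positive matrix. -/
def posPair : Fin 5 ⊕ Fin 5 → Fin 5 ⊕ Fin 5 → Bool
  | .inl i, .inl j => decide (i < j)
  | .inl i, .inr j => decide (i ≠ j)
  | .inr i, .inr j => decide (j < i)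
  | .inr _, .inl _ => false

/-- Skewness carries triangularity of the upper left block over to the lower right one and kills the
diagonal of the upper right block. -/
theorem IsPositive.apply_eq_zero {A : so10 k} (hA : IsPositive A) {b a : Fin 5 ⊕ Fin 5}
    (h : posPair b a = false) : A.1 b a = 0 := by
  have hs := (so10_skew A).apply_swap
  rcases b with i | i <;> rcases a with j | j
  · exact hA.2 i j (by simpa [posPair] using h)
  · have h1 : i = j := by simpa [posPair] using h
    subst h1
    have := hs (.inl i) (.inr i)
    simp only [Sum.swap_inl, Sum.swap_inr] at this
    have h2 := hs (.inr i) (.inl i)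
    simp only [Sum.swap_inl, Sum.swap_inr] at h2
    exact self_eq_neg.1 h2
  · exact congrFun (congrFun hA.1 i) j
  · have h1 := hs (.inl i) (.inl j)
    simp only [Sum.swap_inl] at h1
    rw [h1, neg_eq_zero]
    exact hA.2 j i (by simpa [posPair] using h)

theorem spinMul_mul_single_eq_zero {a b : Fin 5 ⊕ Fin 5} {I : Fin 16}
    (h : ∀ J, spinSign a J * spinSign b (spinIndex a J) = 0 ∨ spinIndex b (spinIndex a J) ≠ I) :
    spinMul (Pi.single a 1) (spinMul (Pi.single b 1) (Pi.single I 1 : Spin k)) = 0 := by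
  ext J
  rw [spinMul_single_mul_single]
  rcases h J with h | h
  · rw [h, Int.cast_zero, zero_mul]
    rfl
  · rw [Pi.single_eq_of_ne h, mul_zero]
    rfl

theorem IsPositive.spinAct_single {A : so10 k} (hA : IsPositive A) :
    spinAct A.1 (Pi.single 15 1) = 0 := by
  have h : ∀ b a, posPair b a = true → ∀ J, spinSign b.swap J * spinSign a.swap
      (spinIndex b.swap J) = 0 ∨ spinIndex a.swap (spinIndex b.swap J) ≠ 15 := by
    decide
  rw [spinAct_eq_sum, Finset.sum_eq_zero fun a _ => Finset.sum_eq_zero fun b _ => ?_, smul_zero]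
  cases hp : posPair b a
  · rw [hA.apply_eq_zero hp, zero_smul]
  · rw [spinMul_mul_single_eq_zero (h b a hp), smul_zero]

theorem IsPositive.spinAct_dual_single {A : so10 k} (hA : IsPositive A) :
    spinAct (dual A).1 (Pi.single 0 1) = 0 := by
  have h : ∀ b a, posPair b a = true → ∀ J, spinSign a.swap J * spinSign b.swap
      (spinIndex a.swap J) = 0 ∨ spinIndex b.swap (spinIndex a.swap J) ≠ 0 := by
    decide
  rw [spinAct_eq_sum, Finset.sum_eq_zero fun a _ => Finset.sum_eq_zero fun b _ => ?_, smul_zero]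
  cases hp : posPair a b
  · rw [coe_dual, Matrix.neg_apply, Matrix.transpose_apply, hA.apply_eq_zero hp, neg_zero,
      zero_smul]
  · rw [spinMul_mul_single_eq_zero (h a b hp), smul_zero]

variable [IsAlgClosed k]

/-- The sign comes from `𝔤(1)` carrying the dual action: basis vectors have the opposite weights to
those in `𝔤(-1)`. -/
theorem isWeightVector_hi_single {J : Fin 16} {w : Fin 5 → k}
    (h : ∀ i, w i = -(spinWeight J i : k) / 2) :
    IsWeightVector (so10Ad (midEquiv k)) w (hi (Pi.single J 1)) := by
  intro a
  rw [so10Ad_hi_dual, dual_cartanElt, ← map_smul]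
  congr 1
  ext K
  rw [spinAct_cartanElt, Pi.smul_apply, smul_eq_mul]
  by_cases hK : K = J
  · subst hK
    congr 1
    refine Finset.sum_congr rfl fun i _ => ?_
    rw [h, Pi.neg_apply]
    ring
  · rw [Pi.single_eq_of_ne hK, mul_zero, mul_zero]

theorem isWeightVector_lo_single {J : Fin 16} {w : Fin 5 → k}
    (h : ∀ i, w i = (spinWeight J i : k) / 2) :
    IsWeightVector (so10Ad (midEquiv k)) w (lo (Pi.single J 1)) := by
  intro a
  rw [so10Ad_lo, ← map_smul]
  congr 1
  ext K
  rw [spinAct_cartanElt, Pi.smul_apply, smul_eq_mul]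
  by_cases hK : K = J
  · subst hK
    simp only [h]
  · rw [Pi.single_eq_of_ne hK, mul_zero, mul_zero]

theorem single_one_ne_zero (J : Fin 16) : (Pi.single J 1 : Spin k) ≠ 0 := by
  simp

theorem isWeightVector_pi5 : IsWeightVector (so10Ad (midEquiv k)) (pi5 k) (hi (Pi.single 0 1)) := by
  have h : ∀ i, spinWeight 0 i = -1 := by decide
  refine isWeightVector_hi_single fun i => ?_
  rw [h]
  fin_cases i <;> simp [pi5]

theorem isWeightVector_pi5' :
    IsWeightVector (so10Ad (midEquiv k)) (pi5' k) (hi (Pi.single 14 1)) := by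
  have h : ∀ i, spinWeight 14 i = ![-1, 1, 1, 1, 1] i := by decide
  refine isWeightVector_hi_single fun i => ?_
  rw [h]
  fin_cases i <;> simp [pi5']

theorem isWeightVector_pi4 :
    IsWeightVector (so10Ad (midEquiv k)) (pi4 k) (lo (Pi.single 15 1)) := by
  have h : ∀ i, spinWeight 15 i = ![1, 1, 1, 1, -1] i := by decide
  refine isWeightVector_lo_single fun i => ?_
  rw [h]
  fin_cases i <;> simp [pi4]

variable (k)

theorem isHighestWeightIrrep_g_one :
    IsHighestWeightIrrep (so10Ad (midEquiv k)) (pi5 k) (g k 1) where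
  stable A := so10Ad_mem _ A
  irreducible W hW hs := by
    have h := spinAct_irreducible (W.comap hi) fun A s hs' => by
      have := hs (dual A) _ hs'
      rw [so10Ad_hi_dual, dual_dual] at this
      exact this
    refine h.imp (fun h => ?_) fun h => le_antisymm hW fun X hX => ?_
    · refine (Submodule.eq_bot_iff _).2 fun X hX => ?_
      obtain ⟨η, rfl⟩ := mem_g_one.1 (hW hX)
      have h1 : η ∈ W.comap hi := hX
      rw [h, Submodule.mem_bot] at h1
      rw [h1, hi_zero]
    · obtain ⟨η, rfl⟩ := mem_g_one.1 hX
      have h1 : η ∈ W.comap hi := by rw [h]; trivial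
      exact h1
  highest := by
    refine ⟨hi (Pi.single 0 1), mem_g_one.2 ⟨_, rfl⟩, fun h => ?_, isWeightVector_pi5,
      fun A hA => ?_⟩
    · exact single_one_ne_zero 0 (hi_injective (h.trans hi_zero.symm))
    · rw [so10Ad_hi_dual, hA.spinAct_dual_single, hi_zero]

theorem isHighestWeightIrrep_g_neg_one :
    IsHighestWeightIrrep (so10Ad (midEquiv k)) (pi4 k) (g k (-1)) where
  stable A := so10Ad_mem _ A
  irreducible W hW hs := by
    have h := spinAct_irreducible (W.comap lo) fun A s hs' => by
      have := hs A _ hs'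
      rw [so10Ad_lo] at this
      exact this
    refine h.imp (fun h => ?_) fun h => le_antisymm hW fun X hX => ?_
    · refine (Submodule.eq_bot_iff _).2 fun X hX => ?_
      obtain ⟨η, rfl⟩ := mem_g_neg_one.1 (hW hX)
      have h1 : η ∈ W.comap lo := hX
      rw [h, Submodule.mem_bot] at h1
      rw [h1, lo_zero]
    · obtain ⟨η, rfl⟩ := mem_g_neg_one.1 hX
      have h1 : η ∈ W.comap lo := by rw [h]; trivial
      exact h1
  highest := by
    refine ⟨lo (Pi.single 15 1), mem_g_neg_one.2 ⟨_, rfl⟩, fun h => ?_, isWeightVector_pi4,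
      fun A hA => ?_⟩
    · exact single_one_ne_zero 15 (lo_injective (h.trans lo_zero.symm))
    · rw [so10Ad_lo, hA.spinAct_single, lo_zero]

end Weights

/-! ### The vector representation in `S²(𝔤(1)*)` -/

section VectorRep

variable {k : Type*} [Field k] [CharZero k]

/-- The first wedge sends `v` to `v a • e b` plus a multiple of `e a.swap`; the second maps `e b` to
`e c` and kills the other term by the inequalities on `a`, `b`, `c`. -/
theorem single_mem_of_so10 {U : Submodule k (Vec k)}
    (hU : ∀ A : so10 k, ∀ v ∈ U, A.1.mulVec v ∈ U) {v : Vec k} (hv : v ∈ U)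
    {a b c : Fin 5 ⊕ Fin 5} (ha : v a ≠ 0) (hba' : b ≠ a.swap) (hcb : c ≠ b.swap)
    (hca : c ≠ a) : (Pi.single c 1 : Vec k) ∈ U := by
  have h1 := hU (wedge (Pi.single b 1) (Pi.single a.swap 1)) v hv
  have h2 := hU (wedge (Pi.single c 1) (Pi.single b.swap 1)) _ h1
  have e : ∀ (x : Fin 5 ⊕ Fin 5) (w : Vec k), form (Pi.single x 1) w = w x.swap := fun x w => by
    rw [form_comm, form_single_right]
  rw [wedge_mulVec, wedge_mulVec] at h2
  simp only [e, Sum.swap_swap, Pi.sub_apply, Pi.smul_apply, smul_eq_mul] at h2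
  rw [Pi.single_eq_same, Pi.single_eq_of_ne hba', Pi.single_eq_of_ne, Pi.single_eq_of_ne] at h2
  · simp only [mul_one, mul_zero, sub_zero, zero_smul] at h2
    exact (U.smul_mem_iff ha).1 h2
  · exact fun h => hca (by rw [← Sum.swap_swap c, h, Sum.swap_swap])
  · exact fun h => hcb (by rw [← h, Sum.swap_swap])

/-- The vector representation of `𝔰𝔬₁₀` is irreducible. -/
theorem vec_irreducible (U : Submodule k (Vec k))
    (hU : ∀ A : so10 k, ∀ v ∈ U, A.1.mulVec v ∈ U) : U = ⊥ ∨ U = ⊤ := by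
  refine or_iff_not_imp_left.2 fun hne => ?_
  obtain ⟨v, hv, hv0⟩ := U.exists_mem_ne_zero_of_ne_bot hne
  obtain ⟨a, ha⟩ := Function.ne_iff.1 hv0
  have hex : ∀ a c : Fin 5 ⊕ Fin 5, ∃ b, b ≠ a.swap ∧ c ≠ b.swap := by decide
  have h1 : ∀ c, c ≠ a → (Pi.single c 1 : Vec k) ∈ U := fun c hc => by
    obtain ⟨b, hb', hcb⟩ := hex a c
    exact single_mem_of_so10 hU hv ha hb' hcb hc
  have h2 : ∀ c, (Pi.single c 1 : Vec k) ∈ U := fun c => by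
    by_cases hc : c = a
    · have hd : a.swap ≠ a := by cases a <;> simp
      obtain ⟨b, hb', hcb⟩ := hex a.swap c
      refine single_mem_of_so10 hU (h1 _ hd) (a := a.swap) ?_ hb' hcb ?_
      · simp
      · rw [hc]
        exact hd.symm
    · exact h1 c hc
  refine Submodule.eq_top_iff'.2 fun v => ?_
  rw [eq_sum_single v]
  exact U.sum_mem fun c _ => U.smul_mem _ (h2 c)

/-- The vector representation is self-dual through `swap`; this is why `swap` occurs in `vecQuad`,
whose spinor argument transforms by the dual action. -/
theorem dual_mulVec_swap (A : so10 k) (v : Vec k) :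
    (dual A).1.mulVec (swap v) = swap (A.1.mulVec v) := by
  ext a
  rw [swap_apply, Matrix.mulVec, Matrix.mulVec, dotProduct, dotProduct,
    ← (Equiv.sumComm (Fin 5) (Fin 5)).sum_comp]
  refine Finset.sum_congr rfl fun b _ => ?_
  rw [Equiv.sumComm_apply, swap_apply, Sum.swap_swap, coe_dual, Matrix.neg_apply,
    Matrix.transpose_apply, ← (so10_skew A).apply_swap, Sum.swap_swap]

section

variable {M : Type*} [AddCommGroup M] [Module k M]

/-- The map from the vector representation to the quadratic forms on a module `M` with a map to the
half-spinor representation. -/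
noncomputable def vecQuad (p : M →ₗ[k] Spin k) : Vec k →ₗ[k] QuadraticForm k M where
  toFun v := LinearMap.BilinMap.toQuadraticMap ((spinPair.compr₂ (form (swap v))).compl₁₂ p p)
  map_add' v w := by
    ext x
    simp
  map_smul' a v := by
    ext x
    simp

variable {p : M →ₗ[k] Spin k}

theorem vecQuad_apply (v : Vec k) (x : M) :
    vecQuad p v x = form (swap v) (spinPair (p x) (p x)) := rfl

theorem vecQuad_single (a : Fin 5 ⊕ Fin 5) (x : M) :
    vecQuad p (Pi.single a 1) x = spinPair (p x) (p x) a := by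
  rw [vecQuad_apply, swap_single, form_comm, form_single_right, Sum.swap_swap]

theorem quadAction_vecQuad {T : Module.End k M} {A : so10 k}
    (hT : ∀ x, p (T x) = spinAct (dual A).1 (p x)) (v : Vec k) :
    quadAction T (vecQuad p v) = vecQuad p (A.1.mulVec v) := by
  ext x
  have h1 : quadAction T (vecQuad p v) x = -(form (swap v) (spinPair (p x) (p (T x))) +
      form (swap v) (spinPair (p (T x)) (p x))) :=
    congrArg Neg.neg (LinearMap.BilinMap.polar_toQuadraticMap _ _)
  rw [h1, vecQuad_apply, hT, ← map_add, add_comm, ← spinPair_spinAct (so10_skew (dual A)),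
    ← so10_skew (dual A), dual_mulVec_swap]

/-- The kernel is a subrepresentation of the irreducible vector representation, and it is proper
because `B(s,s)` is not identically zero. -/
theorem eq_zero_of_vecQuad {T : so10 k → Module.End k M} (hp : Function.Surjective p)
    (hT : ∀ A x, p (T A x) = spinAct (dual A).1 (p x))
    {v : Vec k} (h : vecQuad p v = 0) : v = 0 := by
  rcases vec_irreducible (LinearMap.ker (vecQuad p)) fun A w hw => by
    rw [LinearMap.mem_ker] at hw ⊢
    rw [← quadAction_vecQuad (hT A), hw, map_zero] with h1 | h1
  · have h2 : v ∈ LinearMap.ker (vecQuad p) := h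
    rwa [h1] at h2
  · exfalso
    obtain ⟨η, η', hη⟩ := exists_quartic_ne_zero (k := k)
    obtain ⟨x, rfl⟩ := hp η
    refine hη ?_
    have h2 : ∀ v : Vec k, vecQuad p v = 0 := fun v => by
      have h3 : v ∈ LinearMap.ker (vecQuad p) := by rw [h1]; trivial
      exact h3
    have h4 : spinPair (p x) (p x) = 0 := by
      ext a
      have h5 := vecQuad_single (p := p) a x
      rw [h2] at h5
      exact h5.symm
    rw [quartic, h4, map_zero, LinearMap.zero_apply]

theorem isHighestWeightIrrep_range_vecQuad {T : so10 k → Module.End k M} (hp : Function.Surjective p)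
    (hT : ∀ A x, p (T A x) = spinAct (dual A).1 (p x)) :
    IsHighestWeightIrrep (fun A => quadAction (T A)) (pi1 k) (LinearMap.range (vecQuad p)) where
  stable A Q hQ := by
    obtain ⟨v, rfl⟩ := hQ
    exact ⟨_, (quadAction_vecQuad (hT A) v).symm⟩
  irreducible W hW hs := by
    have h := vec_irreducible (W.comap (vecQuad p)) fun A v hv => by
      have := hs A _ hv
      rw [quadAction_vecQuad (hT A)] at this
      exact this
    refine h.imp (fun h => (Submodule.eq_bot_iff _).2 fun Q hQ => ?_)
      fun h => le_antisymm hW fun Q hQ => ?_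
    · obtain ⟨v, rfl⟩ := hW hQ
      have h1 : v ∈ W.comap (vecQuad p) := hQ
      rw [h, Submodule.mem_bot] at h1
      rw [h1, map_zero]
    · obtain ⟨v, rfl⟩ := hQ
      have h1 : v ∈ W.comap (vecQuad p) := by rw [h]; trivial
      exact h1
  highest := by
    refine ⟨vecQuad p (Pi.single (.inl 0) 1), ⟨_, rfl⟩, fun h => ?_, fun a => ?_, fun A hA => ?_⟩
    · have h1 := congrFun (eq_zero_of_vecQuad hp hT h) (.inl 0)
      simp at h1
    · rw [quadAction_vecQuad (hT _), ← map_smul, cartanElt_eq]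
      congr 1
      rw [Matrix.diagonal_mulVec_single, ← Pi.single_smul]
      simp [pi1, Fin.sum_univ_five]
    · rw [quadAction_vecQuad (hT _), Matrix.mulVec_single_one]
      have h1 : A.1.col (.inl 0) = 0 := by
        ext b
        refine hA.apply_eq_zero ?_
        rcases b with i | i <;> simp [posPair]
      rw [h1, map_zero]

end

variable [IsAlgClosed k]

theorem hiPart_so10Ad (A : so10 k) {x : e6 k} (hx : x ∈ g k 1) :
    hiPart (so10Ad (midEquiv k) A x) = spinAct (dual A).1 (hiPart x) := by
  obtain ⟨η, rfl⟩ := mem_g_one.1 hx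
  rw [so10Ad_hi_dual, hiPart_hi, hiPart_hi]

/-- The coordinates on `𝔤(1)`. -/
noncomputable def hiCoord (k : Type*) [Field k] [CharZero k] : g k 1 →ₗ[k] Spin k :=
  hiPart.comp (g k 1).subtype

theorem hiCoord_apply (x : g k 1) : hiCoord k x = hiPart (x : e6 k) := rfl

theorem hiCoord_surjective : Function.Surjective (hiCoord k) := fun η =>
  ⟨⟨hi η, mem_g_one.2 ⟨η, rfl⟩⟩, hiPart_hi η⟩

theorem hiCoord_so10Ad (A : so10 k) (x : g k 1) :
    hiCoord k ((so10Ad (midEquiv k) A).restrict (so10Ad_mem (midEquiv k) A) x) =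
      spinAct (dual A).1 (hiCoord k x) :=
  hiPart_so10Ad A x.2

variable (k) in
theorem isHighestWeightIrrep_so10Quad : IsHighestWeightIrrep (so10Quad (midEquiv k)) (pi1 k)
    (LinearMap.range (vecQuad (hiCoord k))) :=
  isHighestWeightIrrep_range_vecQuad hiCoord_surjective hiCoord_so10Ad

end VectorRep

/-! ### Invariance of the quartic -/

section Invariance

variable {k : Type*} [Field k] [CharZero k]

theorem form_dual_add (A : so10 k) (v w : Vec k) :
    form (A.1.mulVec v) w + form v (A.1.mulVec w) = 0 := by
  rw [so10_skew A]
  exact neg_add_cancel _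

/-- The exponential is passed from spinors to vectors through `spinPair`, then to scalars through
`form`, where the operator is zero and its exponential is the identity. -/
theorem quartic_expEnd {A : so10 k} {N : ℕ} {η η' : Spin k}
    (h : (spinAct A.1 ^ N) η = 0) (h' : (spinAct A.1 ^ N) η' = 0) :
    quartic (expEnd (spinAct A.1) N η) (expEnd (spinAct A.1) N η') = quartic η η' := by
  have hB : ∀ s t, A.1.mulVecLin (spinPair s t) =
      spinPair (spinAct A.1 s) t + spinPair s (spinAct A.1 t) :=
    spinPair_spinAct (so10_skew A)
  have hF : ∀ v w, (0 : Module.End k k) (form v w) =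
      form (A.1.mulVecLin v) w + form v (A.1.mulVecLin w) := fun v w => (form_dual_add A v w).symm
  rw [quartic, ← expEnd_bilin hB h h, ← expEnd_bilin hB h' h',
    ← expEnd_bilin hF (pow_bilin_eq_zero hB h h) (pow_bilin_eq_zero hB h' h')]
  -- For `N = 0` the truncated exponential is an empty sum, hence zero; but then the hypothesis says
  -- `η = 0`.
  rcases Nat.eq_zero_or_pos N with rfl | hN
  · rw [pow_zero, Module.End.one_apply] at h
    simp [quartic, h]
  · rw [expEnd_of_le (N := 1) (by omega) (by simp), expEnd_apply]
    simp [quartic]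

theorem mul_zpow_eq_of_smul {t : kˣ} {i : ℤ} {c : k} (h : (i : k) * c = 0) :
    ((t ^ i : kˣ) : k) * c = c := by
  rcases mul_eq_zero.1 h with h | h
  · rw [Int.cast_eq_zero.1 h, zpow_zero, Units.val_one, one_mul]
  · rw [h, mul_zero]

/-- By multilinearity all four arguments may be eigenvectors. Infinitesimal invariance makes the
value zero unless the eigenvalues sum to zero, and in that case the powers of `t` cancel. -/
theorem form_spinPair_torus {A : so10 k} {t : kˣ} {R : Module.End k (Spin k)}
    (htop : (⨆ i : ℤ, (spinAct A.1).eigenspace (i : k)) = ⊤)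
    (hR : ∀ i : ℤ, ∀ s ∈ (spinAct A.1).eigenspace (i : k), R s = ((t ^ i : kˣ) : k) • s)
    (s₁ s₂ s₃ s₄ : Spin k) :
    form (spinPair (R s₁) (R s₂)) (spinPair (R s₃) (R s₄)) =
      form (spinPair s₁ s₂) (spinPair s₃ s₄) := by
  have hmem : ∀ s : Spin k, s ∈ ⨆ i : ℤ, (spinAct A.1).eigenspace (i : k) := fun s => by
    rw [htop]; trivial
  have h₁ := hmem s₁
  have h₂ := hmem s₂
  have h₃ := hmem s₃
  have h₄ := hmem s₄
  induction h₁ using Submodule.iSup_induction' with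
  | zero => simp
  | add x y _ _ hx hy => simp only [map_add, LinearMap.add_apply, hx, hy]
  | mem i₁ s₁ h₁ =>
  induction h₂ using Submodule.iSup_induction' with
  | zero => simp
  | add x y _ _ hx hy => simp only [map_add, LinearMap.add_apply, hx, hy]
  | mem i₂ s₂ h₂ =>
  induction h₃ using Submodule.iSup_induction' with
  | zero => simp
  | add x y _ _ hx hy => simp only [map_add, LinearMap.add_apply, hx, hy]
  | mem i₃ s₃ h₃ =>
  induction h₄ using Submodule.iSup_induction' with
  | zero => simp
  | add x y _ _ hx hy => simp only [map_add, LinearMap.add_apply, hx, hy]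
  | mem i₄ s₄ h₄ =>
  have key := form_dual_add A (spinPair s₁ s₂) (spinPair s₃ s₄)
  rw [spinPair_spinAct (so10_skew A), spinPair_spinAct (so10_skew A),
    Module.End.mem_eigenspace_iff.1 h₁, Module.End.mem_eigenspace_iff.1 h₂,
    Module.End.mem_eigenspace_iff.1 h₃, Module.End.mem_eigenspace_iff.1 h₄] at key
  rw [hR i₁ s₁ h₁, hR i₂ s₂ h₂, hR i₃ s₃ h₃, hR i₄ s₄ h₄]
  simp only [map_smul, LinearMap.smul_apply, map_add, LinearMap.add_apply, smul_eq_mul] at key ⊢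
  have h5 := mul_zpow_eq_of_smul (t := t) (i := i₁ + i₂ + i₃ + i₄)
    (c := form (spinPair s₁ s₂) (spinPair s₃ s₄)) (by push_cast; linear_combination key)
  rw [zpow_add, zpow_add, zpow_add] at h5
  push_cast at h5
  push_cast
  linear_combination h5

variable [IsAlgClosed k]

theorem lie_mid_hi_dual (A : so10 k) (η : Spin k) :
    ⁅mid (A, 0), hi η⁆ = hi (spinAct (dual A).1 η) :=
  so10Ad_hi_dual A η

theorem ad_pow_hi (A : so10 k) (j : ℕ) (η : Spin k) :
    (LieAlgebra.ad k (e6 k) (mid (A, 0)) ^ j) (hi η) = hi ((spinAct (dual A).1 ^ j) η) := by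
  induction j with
  | zero => rfl
  | succ j ih =>
    rw [pow_succ', Module.End.mul_apply, ih, LieAlgebra.ad_apply, lie_mid_hi_dual, pow_succ',
      Module.End.mul_apply]

theorem IsExpAd.apply_hi {A : so10 k} {g : e6 k ≃ₗ[k] e6 k} (hg : IsExpAd (mid (A, 0)) g) :
    ∃ N, spinAct (dual A).1 ^ N = 0 ∧ ∀ η, g (hi η) = hi (expEnd (spinAct (dual A).1) N η) := by
  obtain ⟨N, hN, hg⟩ := hg
  refine ⟨N, LinearMap.ext fun η => hi_injective ?_, fun η => ?_⟩
  · rw [← ad_pow_hi, hN, LinearMap.zero_apply, LinearMap.zero_apply, hi_zero]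
  · rw [hg, expEnd_apply, map_sum]
    refine Finset.sum_congr rfl fun j _ => ?_
    rw [ad_pow_hi, map_smul]

/-- `hiPart` intertwines the two actions, so it carries an eigenvector decomposition in `𝔤` to one
of spinors. -/
theorem IsMultOneParam.iSup_eigenspace_spinAct {A : so10 k} {lam : kˣ →* (e6 k ≃ₗ[k] e6 k)}
    (h : IsMultOneParam (mid (A, 0)) lam) :
    (⨆ i : ℤ, (spinAct (dual A).1).eigenspace (i : k)) = ⊤ := by
  have h1 : ∀ X : e6 k, hiPart ⁅mid (A, 0), X⁆ = spinAct (dual A).1 (hiPart X) := by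
    intro X
    obtain ⟨ξ, p, η, rfl⟩ := exists_decomp X
    rw [lie_add, lie_add, lie_mid_hi_dual, lie_mid_lo, lie_mid_mid]
    simp only [map_add, hiPart_hi, hiPart_lo, hiPart_mid, zero_add]
  refine Submodule.eq_top_iff'.2 fun η => ?_
  rw [← hiPart_hi η]
  have h2 : hi η ∈ ⨆ i : ℤ, (LieAlgebra.ad k (e6 k) (mid (A, 0))).eigenspace (i : k) := by
    rw [h.1]; trivial
  generalize hi η = X at h2
  induction h2 using Submodule.iSup_induction' with
  | zero => rw [map_zero]; exact Submodule.zero_mem _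
  | add x y _ _ hx hy => rw [map_add]; exact Submodule.add_mem _ hx hy
  | mem i x hx =>
    refine Submodule.mem_iSup_of_mem i ?_
    rw [Module.End.mem_eigenspace_iff] at hx ⊢
    rw [← h1, ← map_smul, ← hx]
    rfl

theorem lie_gradingElt_of_mem_range {n : e6 k} (hn : n ∈ (so10Embedding (midEquiv k)).range) :
    ⁅n, gradingElt k⁆ = 0 := by
  obtain ⟨A, rfl⟩ := hn
  change ⁅mid (A, 0), gradingElt k⁆ = 0
  rw [← lie_skew, lie_gradingElt_mid, neg_zero]

theorem exists_hi_of_mem_SO10 {s : e6 k ≃ₗ[k] e6 k} (hs : s ∈ SO10 (midEquiv k)) (η : Spin k) :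
    ∃ ζ, s (hi η) = hi ζ :=
  mem_g_one.1 (mem_piece_of_mem_connectedSubgroup hs (fun _ hn => lie_gradingElt_of_mem_range hn)
    (mem_g_one.2 ⟨η, rfl⟩))

theorem quartic_of_mem_SO10 {s : e6 k ≃ₗ[k] e6 k} (hs : s ∈ SO10 (midEquiv k)) {η η' ζ ζ' : Spin k}
    (h : s (hi η) = hi ζ) (h' : s (hi η') = hi ζ') : quartic ζ ζ' = quartic η η' := by
  induction hs using Subgroup.closure_induction generalizing η η' ζ ζ' with
  | mem s hs =>
    rcases hs with ⟨n, ⟨A, rfl⟩, hn⟩ | ⟨n, ⟨A, rfl⟩, lam, hl, t, rfl⟩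
    · obtain ⟨N, hN, hexp⟩ := IsExpAd.apply_hi (A := A) hn
      rw [hexp] at h h'
      rw [← hi_injective h, ← hi_injective h']
      exact quartic_expEnd (by rw [hN, LinearMap.zero_apply]) (by rw [hN, LinearMap.zero_apply])
    · have htop := IsMultOneParam.iSup_eigenspace_spinAct (A := A) hl
      have hR : ∀ i : ℤ, ∀ s ∈ (spinAct (dual A).1).eigenspace (i : k),
          hiPart (lam t (hi s)) = ((t ^ i : kˣ) : k) • s := by
        intro i s hs
        rw [hl.2 t i, map_smul, hiPart_hi]
        rw [Module.End.mem_eigenspace_iff] at hs ⊢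
        rw [← map_smul, ← hs]
        exact lie_mid_hi_dual A s
      have h1 := form_spinPair_torus (R := hiPart.comp ((lam t).toLinearMap.comp hi)) htop hR
        η η η' η'
      have e : ∀ s, (hiPart.comp ((lam t).toLinearMap.comp hi)) s = hiPart (lam t (hi s)) :=
        fun _ => rfl
      rw [e, e, h, h', hiPart_hi, hiPart_hi] at h1
      exact h1
  | one =>
    rw [hi_injective h, hi_injective h']
  | mul s s' hs hs' h1 h2 =>
    obtain ⟨θ, hθ⟩ := exists_hi_of_mem_SO10 hs' η
    obtain ⟨θ', hθ'⟩ := exists_hi_of_mem_SO10 hs' η'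
    rw [LinearEquiv.mul_apply, hθ] at h
    rw [LinearEquiv.mul_apply, hθ'] at h'
    rw [h1 h h', h2 hθ hθ']
  | inv s hs h1 =>
    refine (h1 (η := ζ) (η' := ζ') ?_ ?_).symm
    · rw [← h]
      exact s.apply_symm_apply _
    · rw [← h']
      exact s.apply_symm_apply _

section

variable {M : Type*} [AddCommGroup M] [Module k M]

/-- The quartic invariant as a function on `M × M`, for a module `M` with a map to the half-spinor
representation. -/
def quarticFun (p : M →ₗ[k] Spin k) (q : M × M) : k :=
  quartic (p q.1) (p q.2)

theorem quarticFun_ne_zero {p : M →ₗ[k] Spin k} (hp : Function.Surjective p) :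
    quarticFun p ≠ 0 := by
  obtain ⟨η, η', h⟩ := exists_quartic_ne_zero (k := k)
  obtain ⟨x, rfl⟩ := hp η
  obtain ⟨y, rfl⟩ := hp η'
  exact fun h0 => h (congrFun h0 (x, y))

theorem isHomogeneousPolyFun_quarticFun (p : M →ₗ[k] Spin k) :
    IsHomogeneousPolyFun k 4 (quarticFun p) := by
  have h : quarticFun p = fun q : M × M => form (spinPair (p q.1) (p q.1))
    (spinPair (p q.2) (p q.2)) := rfl
  have h1 := isHomogeneousPolyFun_form (p.comp (LinearMap.fst k M M)) (p.comp (LinearMap.fst k M M))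
    (p.comp (LinearMap.snd k M M)) (p.comp (LinearMap.snd k M M))
  simp only [LinearMap.comp_apply, LinearMap.fst_apply, LinearMap.snd_apply] at h1
  rw [h]
  exact h1

/-- Expanding `form` in dual bases exhibits the quartic as an element of `W ⊗ W`. -/
theorem quarticFun_eq_sum (p : M →ₗ[k] Spin k) : quarticFun p = ∑ a : Fin 5 ⊕ Fin 5,
    fun q : M × M => vecQuad p (Pi.single a 1) q.1 * vecQuad p (Pi.single a.swap 1) q.2 := by
  ext q
  rw [Finset.sum_apply, quarticFun, quartic, form_apply]
  refine Finset.sum_congr rfl fun a _ => ?_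
  rw [vecQuad_single, vecQuad_single, swap_apply]

end

theorem hiCoord_eq {x : g k 1} {η : Spin k} (h : (x : e6 k) = hi η) : hiCoord k x = η := by
  rw [hiCoord_apply, h, hiPart_hi]

theorem isInvariant_quarticFun : IsInvariant (SO10 (midEquiv k)) (quarticFun (hiCoord k)) := by
  intro s hs
  have hmem : ∀ x ∈ g k 1, s x ∈ g k 1 := fun x hx =>
    mem_piece_of_mem_connectedSubgroup hs (fun _ hn => lie_gradingElt_of_mem_range hn) hx
  refine ⟨s.toLinearMap.restrict hmem, fun x => rfl, fun x y => ?_⟩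
  obtain ⟨η, hη⟩ := mem_g_one.1 x.2
  obtain ⟨η', hη'⟩ := mem_g_one.1 y.2
  obtain ⟨ζ, hζ⟩ := exists_hi_of_mem_SO10 hs η
  obtain ⟨ζ', hζ'⟩ := exists_hi_of_mem_SO10 hs η'
  have e3 : hiCoord k (s.toLinearMap.restrict hmem x) = ζ :=
    hiCoord_eq ((congrArg s hη).trans hζ)
  have e4 : hiCoord k (s.toLinearMap.restrict hmem y) = ζ' :=
    hiCoord_eq ((congrArg s hη').trans hζ')
  have h1 := quartic_of_mem_SO10 hs hζ hζ'
  rw [← e3, ← e4, ← hiCoord_eq hη, ← hiCoord_eq hη'] at h1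
  exact h1

theorem quarticFun_mem_tensorSquare :
    quarticFun (hiCoord k) ∈ tensorSquare (LinearMap.range (vecQuad (hiCoord k))) := by
  rw [quarticFun_eq_sum]
  exact Submodule.sum_mem _ fun a _ => Submodule.subset_span ⟨_, ⟨_, rfl⟩, _, ⟨_, rfl⟩, rfl⟩

end Invariance

/-! ### Uniqueness of the invariant -/

section Unipotent

variable {k L : Type*} [Field k] [CharZero k] [LieRing L] [LieAlgebra k L]

/-- The exponential of `ad n` for an element `n` with `(ad n) ^ 3 = 0`. -/
def expAdEquiv (n : L) (hn : ∀ x : L, ⁅n, ⁅n, ⁅n, x⁆⁆⁆ = 0) : L ≃ₗ[k] L where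
  toFun x := x + ⁅n, x⁆ + (2⁻¹ : k) • ⁅n, ⁅n, x⁆⁆
  invFun x := x - ⁅n, x⁆ + (2⁻¹ : k) • ⁅n, ⁅n, x⁆⁆
  map_add' x y := by
    simp only [lie_add, smul_add]
    abel
  map_smul' a x := by
    simp only [lie_smul, smul_add, RingHom.id_apply, smul_comm a (2⁻¹ : k)]
  left_inv x := by
    simp only [lie_add, lie_smul, hn, lie_zero, smul_zero]
    have : ((2⁻¹ : k) + 2⁻¹) • ⁅n, ⁅n, x⁆⁆ = ⁅n, ⁅n, x⁆⁆ := by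
      rw [← two_mul, mul_inv_cancel₀ two_ne_zero, one_smul]
    linear_combination (norm := module) this
  right_inv x := by
    simp only [lie_add, lie_sub, lie_smul, hn, lie_zero, smul_zero]
    have : ((2⁻¹ : k) + 2⁻¹) • ⁅n, ⁅n, x⁆⁆ = ⁅n, ⁅n, x⁆⁆ := by
      rw [← two_mul, mul_inv_cancel₀ two_ne_zero, one_smul]
    linear_combination (norm := module) this

theorem expAdEquiv_apply {n : L} (hn : ∀ x : L, ⁅n, ⁅n, ⁅n, x⁆⁆⁆ = 0) (x : L) :
    expAdEquiv (k := k) n hn x = x + ⁅n, x⁆ + (2⁻¹ : k) • ⁅n, ⁅n, x⁆⁆ := rfl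

theorem isExpAd_expAdEquiv {n : L} (hn : ∀ x : L, ⁅n, ⁅n, ⁅n, x⁆⁆⁆ = 0) :
    IsExpAd n (expAdEquiv (k := k) n hn) := by
  refine ⟨3, LinearMap.ext fun x => ?_, fun x => ?_⟩
  · simp [pow_succ, hn]
  · rw [expAdEquiv_apply]
    simp [Finset.sum_range_succ, pow_succ]

end Unipotent

section Uniqueness

variable {k : Type*} [Field k] [CharZero k]

/-- Orthogonal vectors anticommute, so the two factors `u` become adjacent, and their product is
zero because `u` is isotropic. -/
theorem spinAct_wedge_sq {u v : Vec k} (hu : form u u = 0) (huv : form u v = 0) (s : Spin k) :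
    spinAct (wedge u v).1 (spinAct (wedge u v).1 s) = 0 := by
  have h : ∀ s, spinAct (wedge u v).1 s = spinMul (swap u) (spinMul v s) := fun s => by
    rw [spinAct_wedge, huv, zero_div, zero_smul, sub_zero]
  have h1 := spinMul_spinMul_swap v u (spinMul v s)
  rw [form_comm, huv, zero_smul, ← eq_neg_iff_add_eq_zero] at h1
  have h2 := spinMul_swap_self (swap u) (spinMul (swap v) (spinMul v s))
  rw [swap_swap, form_swap_swap, hu, zero_div, zero_smul] at h2
  rw [h, h, h1, map_neg, h2, neg_zero]

theorem wedge_mul_self {u v : Vec k} (hu : form u u = 0) (hv : form v v = 0) (huv : form u v = 0) :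
    (wedge u v).1 * (wedge u v).1 = 0 := by
  refine Matrix.ext_of_mulVec_single fun a => ?_
  rw [Matrix.zero_mulVec, ← Matrix.mulVec_mulVec, wedge_mulVec, wedge_mulVec]
  simp [hu, hv, huv, form_comm v u]

theorem dual_wedge (u v : Vec k) : dual (wedge u v) = wedge (swap u) (swap v) := by
  refine Subtype.ext ?_
  ext a b
  simp [coe_dual, wedge, Matrix.vecMulVec_apply]

theorem exists_vecQuad_bilin {M : Type*} [AddCommGroup M] [Module k M] {p : M →ₗ[k] Spin k}
    {f : M × M → k} (hf : f ∈ Submodule.span k {f : M × M → k |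
      ∃ Q ∈ LinearMap.range (vecQuad p), ∃ Q' ∈ LinearMap.range (vecQuad p),
        f = fun q => Q q.1 * Q' q.2}) :
    ∃ m : Vec k →ₗ[k] Vec k →ₗ[k] k, ∀ x y,
      f (x, y) = m (spinPair (p x) (p x)) (spinPair (p y) (p y)) := by
  induction hf using Submodule.span_induction with
  | mem f hf =>
    obtain ⟨_, ⟨v, rfl⟩, _, ⟨v', rfl⟩, rfl⟩ := hf
    exact ⟨(LinearMap.mul k k).compl₁₂ (form (swap v)) (form (swap v')), fun x y => rfl⟩
  | zero => exact ⟨0, fun x y => rfl⟩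
  | add f f' _ _ h h' =>
    obtain ⟨m, hm⟩ := h
    obtain ⟨m', hm'⟩ := h'
    exact ⟨m + m', fun x y => by rw [Pi.add_apply, hm, hm']; rfl⟩
  | smul a f _ h =>
    obtain ⟨m, hm⟩ := h
    exact ⟨a • m, fun x y => by rw [Pi.smul_apply, hm]; rfl⟩

/-- Equivalently, the vectors `B(s,s)` span; this is injectivity of `vecQuad` for the half-spinor
module itself. -/
theorem dual_eq_zero_of_spinPair {φ : Vec k →ₗ[k] k} (h : ∀ s : Spin k, φ (spinPair s s) = 0) :
    φ = 0 := by
  have h1 : ∀ w, form (swap fun a => φ (Pi.single a 1)) w = φ w := by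
    intro w
    conv_rhs => rw [eq_sum_single w]
    rw [form_swap_left, form_apply, swap_swap, map_sum]
    refine Finset.sum_congr rfl fun a _ => ?_
    rw [map_smul, smul_eq_mul, mul_comm]
  have h2 : (fun a => φ (Pi.single a 1)) = (0 : Vec k) := by
    refine eq_zero_of_vecQuad (p := LinearMap.id) (T := fun A => spinAct (dual A).1)
      Function.surjective_id (fun _ _ => rfl) ?_
    ext s
    rw [vecQuad_apply, h1]
    exact h s
  refine LinearMap.ext fun w => ?_
  rw [← h1, h2, map_zero, map_zero, LinearMap.zero_apply]

theorem bilin_ext_of_spinPair {m m' : Vec k →ₗ[k] Vec k →ₗ[k] k}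
    (h : ∀ s t : Spin k, m (spinPair s s) (spinPair t t) = m' (spinPair s s) (spinPair t t)) :
    m = m' := by
  have h1 : ∀ s : Spin k, m (spinPair s s) = m' (spinPair s s) := fun s => by
    rw [← sub_eq_zero]
    refine dual_eq_zero_of_spinPair fun t => ?_
    rw [LinearMap.sub_apply, h, sub_self]
  refine LinearMap.ext fun v => LinearMap.ext fun w => ?_
  have h2 : m.flip w - m'.flip w = 0 := by
    refine dual_eq_zero_of_spinPair fun s => ?_
    rw [LinearMap.sub_apply, LinearMap.flip_apply, LinearMap.flip_apply, h1, sub_self]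
  have h3 := congrArg (fun φ => φ v) h2
  simpa [sub_eq_zero] using h3

/-- The only term to remove is `B(A s, A s)`. Applying `A` twice to `B(s,s)` produces twice that
term, and `A` squares to zero. -/
theorem spinPair_unipotent {A : so10 k} (hA : A.1 * A.1 = 0)
    (hs : ∀ s, spinAct A.1 (spinAct A.1 s) = 0) (s : Spin k) :
    spinPair (s + spinAct A.1 s) (s + spinAct A.1 s) =
      spinPair s s + A.1.mulVec (spinPair s s) := by
  have h1 := spinPair_spinAct (so10_skew A) s s
  have h2 := spinPair_spinAct (so10_skew A) (spinAct A.1 s) s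
  have h3 := spinPair_spinAct (so10_skew A) s (spinAct A.1 s)
  have h4 : A.1.mulVec (A.1.mulVec (spinPair s s)) = 0 := by
    rw [Matrix.mulVec_mulVec, hA, Matrix.zero_mulVec]
  rw [h1, Matrix.mulVec_add, h2, h3, hs, map_zero, map_zero, LinearMap.zero_apply, zero_add,
    add_zero] at h4
  have h5 : spinPair (spinAct A.1 s) (spinAct A.1 s) = 0 := by
    have : (2 : k) • spinPair (spinAct A.1 s) (spinAct A.1 s) = 0 := by
      rw [two_smul, h4]
    exact (smul_eq_zero.1 this).resolve_left two_ne_zero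
  rw [h1]
  simp only [map_add, LinearMap.add_apply, h5]
  abel

/-- A bilinear form on the vector representation that is invariant under the unipotent elements
`1 + e c ∧ e d` is a multiple of the invariant form. -/
theorem bilin_eq_smul_form {m : Vec k →ₗ[k] Vec k →ₗ[k] k}
    (h : ∀ u v : Vec k, form u u = 0 → form v v = 0 → form u v = 0 → ∀ x y,
      m (x + (wedge u v).1.mulVec x) (y + (wedge u v).1.mulVec y) = m x y) :
    ∃ a : k, m = a • form := by
  -- Replacing `u` by `-u` changes the sign of the nilpotent part; subtracting the two invariance
  -- equations leaves the infinitesimal one.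
  have hC : ∀ u v : Vec k, form u u = 0 → form v v = 0 → form u v = 0 → ∀ x y,
      m ((wedge u v).1.mulVec x) y + m x ((wedge u v).1.mulVec y) = 0 := by
    intro u v hu hv huv x y
    have h1 := h u v hu hv huv x y
    have h2 := h (-u) v (by simp [hu]) hv (by simp [huv]) x y
    have h3 : ∀ x, (wedge (-u) v).1.mulVec x = -(wedge u v).1.mulVec x := fun x => by
      simp only [wedge_mulVec, map_neg, LinearMap.neg_apply]
      module
    rw [h3, h3] at h2
    simp only [map_add, map_neg, LinearMap.add_apply, LinearMap.neg_apply] at h1 h2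
    have h4 : (2 : k) * (m ((wedge u v).1.mulVec x) y + m x ((wedge u v).1.mulVec y)) = 0 := by
      linear_combination h1 - h2
    exact (mul_eq_zero.1 h4).resolve_left two_ne_zero
  set e : Fin 5 ⊕ Fin 5 → Vec k := fun a => Pi.single a 1 with he
  have hform : ∀ a b, form (e a) (e b) = if b = a.swap then 1 else 0 := by
    intro a b
    rw [form_comm]
    change form (e b) (Pi.single a 1) = _
    rw [form_single_right]
    change (Pi.single b 1 : Vec k) a.swap = _
    rw [Pi.single_apply]
    congr 1
    rw [eq_iff_iff]
    exact eq_comm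
  have hns : ∀ a : Fin 5 ⊕ Fin 5, a ≠ a.swap := by decide
  -- The element `e c ∧ e d` maps `e d.swap` to `e c`, so `hC` trades the first argument `e c` for
  -- `e d.swap`.
  have key : ∀ c d b, d ≠ c → d ≠ c.swap →
      m (e c) (e b) + m (e d.swap) ((wedge (e c) (e d)).1.mulVec (e b)) = 0 := by
    intro c d b hdc hdc'
    have h1 := hC (e c) (e d) (by rw [hform, if_neg (hns c)]) (by rw [hform, if_neg (hns d)])
      (by rw [hform, if_neg hdc']) (e d.swap) (e b)
    have h2 : (wedge (e c) (e d)).1.mulVec (e d.swap) = e c := by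
      rw [wedge_mulVec, hform, hform, if_pos rfl, if_neg, one_smul, zero_smul, sub_zero]
      exact fun h => hdc (by rw [← Sum.swap_swap d, h, Sum.swap_swap])
    rwa [h2] at h1
  have hoff : ∀ c b, b ≠ c.swap → m (e c) (e b) = 0 := by
    intro c b hb
    have hex : ∀ c b : Fin 5 ⊕ Fin 5, ∃ d, d ≠ c ∧ d ≠ c.swap ∧ b ≠ d.swap := by decide
    obtain ⟨d, hd, hd', hd''⟩ := hex c b
    have h1 := key c d b hd hd'
    rwa [wedge_mulVec, hform, hform, if_neg hd'', if_neg hb, zero_smul, zero_smul, sub_zero,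
      map_zero, add_zero] at h1
  have hdiag : ∀ c d, d ≠ c → d ≠ c.swap → m (e c) (e c.swap) = m (e d.swap) (e d) := by
    intro c d hdc hdc'
    have h1 := key c d c.swap hdc hdc'
    rw [wedge_mulVec, hform, hform, if_neg, if_pos rfl, zero_smul, one_smul, zero_sub,
      map_neg, ← sub_eq_add_neg, sub_eq_zero] at h1
    · exact h1
    · exact fun h => hdc (by rw [← Sum.swap_swap d, ← h, Sum.swap_swap])
  -- Comparison through `inr 0` works except when `c` is `inl 0` or `inr 0`; the latter case goes by
  -- way of `inl 1`.
  have hall : ∀ c, m (e c) (e c.swap) = m (e (.inl 0)) (e (.inr 0)) := by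
    intro c
    by_cases h1 : c = .inl 0
    · rw [h1]
      rfl
    · by_cases h2 : c = .inr 0
      · rw [h2, hdiag (.inr 0) (.inl 1) (by decide) (by decide)]
        exact hdiag (.inr 1) (.inr 0) (by decide) (by decide)
      · refine hdiag c (.inr 0) (Ne.symm h2) fun h => h1 ?_
        rw [← Sum.swap_swap c, ← h]
        rfl
  refine ⟨m (e (.inl 0)) (e (.inr 0)), LinearMap.ext fun v => LinearMap.ext fun w => ?_⟩
  rw [LinearMap.smul_apply, LinearMap.smul_apply]
  conv_lhs => rw [eq_sum_single v, eq_sum_single w]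
  conv_rhs => rw [eq_sum_single v, eq_sum_single w]
  simp only [map_sum, LinearMap.sum_apply, map_smul, LinearMap.smul_apply, Finset.smul_sum]
  refine Finset.sum_congr rfl fun b _ => Finset.sum_congr rfl fun c _ => ?_
  have h1 : m (e c) (e b) = m (e (.inl 0)) (e (.inr 0)) * form (e c) (e b) := by
    rw [hform]
    split_ifs with hb
    · rw [hb, hall, mul_one]
    · rw [hoff c b hb, mul_zero]
  change w b • v c • m (e c) (e b) = _ • w b • v c • form (e c) (e b)
  rw [h1]
  simp only [smul_eq_mul]
  ring

theorem eq_smul_quarticFun_of_unipotent {M : Type*} [AddCommGroup M] [Module k M]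
    {p : M →ₗ[k] Spin k} (hp : Function.Surjective p) {f : M × M → k}
    (hf : f ∈ Submodule.span k {f : M × M → k |
      ∃ Q ∈ LinearMap.range (vecQuad p), ∃ Q' ∈ LinearMap.range (vecQuad p),
        f = fun q => Q q.1 * Q' q.2})
    (hinv : ∀ u v : Vec k, form u u = 0 → form v v = 0 → form u v = 0 → ∃ T : M → M,
      (∀ x, p (T x) = p x + spinAct (wedge u v).1 (p x)) ∧ ∀ x y, f (T x, T y) = f (x, y)) :
    ∃ a : k, f = a • quarticFun p := by
  obtain ⟨m, hm⟩ := exists_vecQuad_bilin hf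
  have hkey : ∀ u v : Vec k, form u u = 0 → form v v = 0 → form u v = 0 → ∀ x y,
      m (x + (wedge u v).1.mulVec x) (y + (wedge u v).1.mulVec y) = m x y := by
    intro u v hu hv huv
    obtain ⟨T, hT, hTf⟩ := hinv u v hu hv huv
    have h1 : m.compl₁₂ (LinearMap.id + (wedge u v).1.mulVecLin)
        (LinearMap.id + (wedge u v).1.mulVecLin) = m := by
      refine bilin_ext_of_spinPair fun s t => ?_
      obtain ⟨x, rfl⟩ := hp s
      obtain ⟨y, rfl⟩ := hp t
      have h2 := hTf x y
      rw [hm, hm, hT, hT, spinPair_unipotent (wedge_mul_self hu hv huv) (spinAct_wedge_sq hu huv),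
        spinPair_unipotent (wedge_mul_self hu hv huv) (spinAct_wedge_sq hu huv)] at h2
      exact h2
    intro x y
    exact congrArg (fun m => m x y) h1
  obtain ⟨a, ha⟩ := bilin_eq_smul_form hkey
  refine ⟨a, funext fun q => ?_⟩
  have h3 : f q = m (spinPair (p q.1) (p q.1)) (spinPair (p q.2) (p q.2)) := hm q.1 q.2
  rw [h3, ha]
  rfl

variable [IsAlgClosed k]

/-- On `𝔤(±1)` the square of `ad` already vanishes. On `𝔤(0)` every term of the triple commutator
contains `A * A`. -/
theorem lie_mid_three {A : so10 k} (hA : A.1 * A.1 = 0)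
    (hs : ∀ s, spinAct A.1 (spinAct A.1 s) = 0)
    (hd : ∀ s, spinAct (dual A).1 (spinAct (dual A).1 s) = 0) (X : e6 k) :
    ⁅mid (A, 0), ⁅mid (A, 0), ⁅mid (A, 0), X⁆⁆⁆ = 0 := by
  obtain ⟨ξ, p, η, rfl⟩ := exists_decomp X
  have h0 : ∀ ξ, ⁅mid (A, 0), lo ξ⁆ = lo (spinAct A.1 ξ) := so10Ad_lo A
  have h1 : ⁅mid (A, 0), ⁅mid (A, 0), ⁅mid (A, 0), lo ξ⁆⁆⁆ = 0 := by
    rw [h0, h0, hs, lo_zero, lie_zero]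
  have h2 : ⁅mid (A, 0), ⁅mid (A, 0), ⁅mid (A, 0), hi η⁆⁆⁆ = 0 := by
    rw [lie_mid_hi_dual, lie_mid_hi_dual, hd, hi_zero, lie_zero]
  have h3 : ⁅A, ⁅A, ⁅A, p.1⁆⁆⁆ = 0 := by
    refine Subtype.ext ?_
    have e : ∀ B : so10 k, (⁅A, B⁆ : so10 k).1 = A.1 * B.1 - B.1 * A.1 := fun _ => rfl
    have e2 : ∀ B : Matrix (Fin 5 ⊕ Fin 5) (Fin 5 ⊕ Fin 5) k, A.1 * (A.1 * B) = 0 := fun B => by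
      rw [← Matrix.mul_assoc, hA, Matrix.zero_mul]
    rw [e, e, e]
    simp only [Matrix.mul_sub, Matrix.sub_mul, Matrix.mul_assoc, hA, e2, Matrix.mul_zero, sub_zero,
      Matrix.mul_neg, Matrix.neg_mul,
      zero_sub, sub_self, neg_zero]
    rfl
  have h4 : ⁅mid (A, 0), ⁅mid (A, 0), ⁅mid (A, 0), mid p⁆⁆⁆ = 0 := by
    rw [lie_mid_mid, lie_mid_mid, lie_mid_mid]
    change mid (⁅A, ⁅A, ⁅A, p.1⁆⁆⁆, 0) = 0
    rw [h3]
    exact mid_zero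
  rw [lie_add, lie_add, lie_add, lie_add, lie_add, lie_add, h1, h2, h4, add_zero, add_zero]

theorem expAdEquiv_mem_SO10 {A : so10 k}
    (hn : ∀ X : e6 k, ⁅mid (A, 0), ⁅mid (A, 0), ⁅mid (A, 0), X⁆⁆⁆ = 0) :
    expAdEquiv (k := k) (mid (A, 0)) hn ∈ SO10 (midEquiv k) :=
  Subgroup.subset_closure (Or.inl ⟨mid (A, 0), ⟨A, rfl⟩, isExpAd_expAdEquiv hn⟩)

theorem expAdEquiv_hi {A : so10 k} (hn : ∀ X : e6 k, ⁅mid (A, 0), ⁅mid (A, 0), ⁅mid (A, 0), X⁆⁆⁆ = 0)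
    (hd : ∀ s, spinAct (dual A).1 (spinAct (dual A).1 s) = 0) (η : Spin k) :
    expAdEquiv (k := k) (mid (A, 0)) hn (hi η) = hi (η + spinAct (dual A).1 η) := by
  rw [expAdEquiv_apply, lie_mid_hi_dual, lie_mid_hi_dual, hd, hi_zero, map_add]
  have h : (2⁻¹ : k) • (0 : e6 k) = 0 := smul_zero _
  rw [h, add_zero]

theorem exists_unipotent {u v : Vec k} (hu : form u u = 0) (hv : form v v = 0) (huv : form u v = 0)
    {f : g k 1 × g k 1 → k} (hinv : IsInvariant (SO10 (midEquiv k)) f) :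
    ∃ T : g k 1 → g k 1, (∀ x, hiCoord k (T x) =
      hiCoord k x + spinAct (wedge u v).1 (hiCoord k x)) ∧ ∀ x y, f (T x, T y) = f (x, y) := by
  have hd : dual (wedge (swap u) (swap v)) = wedge u v := by
    rw [dual_wedge, swap_swap, swap_swap]
  have hd2 : ∀ s, spinAct (dual (wedge (swap u) (swap v))).1
      (spinAct (dual (wedge (swap u) (swap v))).1 s) = 0 := by
    rw [hd]
    exact spinAct_wedge_sq hu huv
  -- The action on `𝔤(1)` is through `dual`, so `swap u ∧ swap v` is the element acting there as `u
  -- ∧ v`.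
  have hn := lie_mid_three (A := wedge (swap u) (swap v))
    (wedge_mul_self (by simpa using hu) (by simpa using hv) (by simpa using huv))
    (spinAct_wedge_sq (by simpa using hu) (by simpa using huv)) hd2
  obtain ⟨T, hT, hTf⟩ := hinv _ (expAdEquiv_mem_SO10 hn)
  refine ⟨T, fun x => ?_, hTf⟩
  obtain ⟨η, hη⟩ := mem_g_one.1 x.2
  rw [hiCoord_eq hη]
  refine hiCoord_eq ((hT x).trans ?_)
  rw [hη, expAdEquiv_hi hn hd2, hd]

theorem eq_smul_quarticFun {f : g k 1 × g k 1 → k}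
    (hf : f ∈ tensorSquare (LinearMap.range (vecQuad (hiCoord k))))
    (hinv : IsInvariant (SO10 (midEquiv k)) f) : ∃ a : k, f = a • quarticFun (hiCoord k) :=
  eq_smul_quarticFun_of_unipotent hiCoord_surjective hf fun _ _ hu hv huv =>
    exists_unipotent hu hv huv hinv

end Uniqueness

/-! ### Semisimple elements and one-parameter subgroups -/

section Semisimple

open Polynomial in
theorem squarefree_X_pow_three_sub_X {k : Type*} [Field k] [CharZero k] :
    Squarefree (X ^ 3 - X : k[X]) := by
  -- Bézout coefficients for `X ^ 3 - X` and its derivative `3 * X ^ 2 - 1`.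
  refine Separable.squarefree ⟨C (-9 / 2) * X, C (3 / 2) * X ^ 2 - 1, ?_⟩
  have h : (C (-9 / 2) : k[X]) = -3 * C (3 / 2) := by
    rw [show (-9 / 2 : k) = -3 * (3 / 2) by ring, C_mul, C_neg]
    rfl
  have h2 : (2 : k[X]) * C (3 / 2) = 3 := by
    rw [show (2 : k[X]) = C 2 from rfl, ← C_mul, mul_div_cancel₀ _ two_ne_zero]
    rfl
  rw [h]
  simp only [derivative_sub, derivative_X_pow, derivative_X, Nat.cast_ofNat,
    Nat.add_one_sub_one, map_ofNat]
  linear_combination X ^ 2 * h2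

variable {k : Type*} [Field k] [CharZero k]

open Polynomial in
theorem isSemisimple_of_cube_eq {V : Type*} [AddCommGroup V] [Module k V] {f : Module.End k V}
    (h : f ^ 3 = f) : f.IsSemisimple :=
  Module.End.isSemisimple_of_squarefree_aeval_eq_zero squarefree_X_pow_three_sub_X (by simp [h])

theorem isSemisimple_mulLeft_sub_mulRight {V : Type*} [AddCommGroup V] [Module k V]
    [FiniteDimensional k V] {f : Module.End k V} (h : f ^ 3 = f) :
    Module.End.IsSemisimple (LinearMap.mulLeft k f - LinearMap.mulRight k f) := by
  refine Module.End.IsSemisimple.sub_of_commute (LinearMap.commute_mulLeft_right f f)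
    (isSemisimple_of_cube_eq ?_) (isSemisimple_of_cube_eq ?_)
  · rw [LinearMap.pow_mulLeft, h]
  · rw [LinearMap.pow_mulRight, h]

/-- On all endomorphisms, `ad X` is left minus right multiplication, two commuting operators each
equal to its own cube; then restrict to the subalgebra. -/
theorem isSemisimple_ad_of_cube_eq {X : e6 k} (h : X.1 ^ 3 = X.1) :
    (LieAlgebra.ad k (e6 k) X).IsSemisimple := by
  have h1 := isSemisimple_mulLeft_sub_mulRight h
  have h2 : (e6 k).toSubmodule ∈
      Module.End.invtSubmodule (LinearMap.mulLeft k X.1 - LinearMap.mulRight k X.1) := by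
    intro Y hY
    exact (e6 k).lie_mem X.2 hY
  exact h1.restrict h2

variable {L : Type*} [LieRing L] [LieAlgebra k L]

/-- An element with integral eigenvalues that is diagonalizable defines a multiplicative
one-parameter subgroup. -/
theorem exists_isMultOneParam {h : L}
    (htop : (⨆ i : ℤ, (LieAlgebra.ad k L h).eigenspace (i : k)) = ⊤) :
    ∃ lam : kˣ →* (L ≃ₗ[k] L), IsMultOneParam h lam := by
  set E : ℤ → Submodule k L := fun i => (LieAlgebra.ad k L h).eigenspace (i : k) with hE
  have hind : iSupIndep E :=
    (Module.End.eigenspaces_iSupIndep (LieAlgebra.ad k L h)).comp Int.cast_injective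
  have hint : DirectSum.IsInternal E :=
    DirectSum.isInternal_submodule_of_iSupIndep_of_iSup_eq_top hind htop
  set e := LinearEquiv.ofBijective (DirectSum.coeLinearMap E) hint with he
  have hex : ∀ c : ℤ → k, ∃ f : Module.End k L, ∀ i, ∀ x ∈ E i, f x = c i • x := by
    intro c
    refine ⟨(DirectSum.toModule k ℤ L fun i => c i • (E i).subtype).comp e.symm.toLinearMap,
      fun i x hx => ?_⟩
    have h1 : e.symm x = DirectSum.lof k ℤ (fun i => E i) i ⟨x, hx⟩ := by
      rw [LinearEquiv.symm_apply_eq]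
      exact (DirectSum.coeLinearMap_lof E i ⟨x, hx⟩).symm
    rw [LinearMap.comp_apply, LinearEquiv.coe_coe, h1, DirectSum.toModule_lof]
    rfl
  have hext : ∀ f f' : Module.End k L, (∀ i, ∀ x ∈ E i, f x = f' x) → f = f' := by
    intro f f' hff
    refine LinearMap.ext fun x => ?_
    have hx : x ∈ ⨆ i, E i := by rw [htop]; trivial
    induction hx using Submodule.iSup_induction' with
    | zero => rw [map_zero, map_zero]
    | add x y _ _ hx hy => rw [map_add, map_add, hx, hy]
    | mem i x hx => exact hff i x hx
  choose f hf using hex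
  let F : kˣ →* Module.End k L :=
    { toFun t := f fun i => ((t ^ i : kˣ) : k)
      map_one' := hext _ _ fun i x hx => by
        rw [hf _ i x hx, one_zpow, Units.val_one, one_smul]
        rfl
      map_mul' s t := hext _ _ fun i x hx => by
        rw [hf _ i x hx, Module.End.mul_apply, hf _ i x hx, map_smul, hf _ i x hx, smul_smul,
          mul_zpow, Units.val_mul, mul_comm] }
  refine ⟨(LinearMap.GeneralLinearGroup.generalLinearEquiv k L).toMonoidHom.comp F.toHomUnits,
    htop, fun t i x hx => ?_⟩
  exact hf _ i x hx

end Semisimple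

/-! ### A Cartan subspace -/

section Cartan

variable {k : Type*} [Field k] [CharZero k]

theorem act_hi_sq {e : Spin k} (he : spinPair e e = 0) (m : Model k) :
    act (hi e) (act (hi e) m) = 0 := by
  have h : e ⬝ᵥ spinMul (swap m.2.2) e = 0 := by
    rw [dotProduct_comm, ← form_spinPair, he, map_zero]
  rw [act_hi, act_hi]
  dsimp only
  rw [h, map_zero, map_zero, LinearMap.zero_apply]
  rfl

theorem act_lo_sq {e : Spin k} (he : spinPair e e = 0) (m : Model k) :
    act (lo e) (act (lo e) m) = 0 := by
  rw [act_lo, act_lo]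
  dsimp only
  rw [map_smul, he, zero_smul, smul_zero]
  rfl

variable [IsAlgClosed k]

/-- For such a pure spinor, `hi e` and `lo e` square to zero on the 27-dimensional space, so the
cube reduces to `hi·lo·hi + lo·hi·lo`. The triple bracket `[[hi e, lo e], hi e] = 2 hi e` gives
`hi·lo·hi = hi`, and likewise with the roles exchanged. -/
theorem cube_hi_add_lo {e : Spin k} (he : spinPair e e = 0) (he1 : e ⬝ᵥ e = 1) (m : Model k) :
    act (hi e + lo e) (act (hi e + lo e) (act (hi e + lo e) m)) = act (hi e + lo e) m := by
  have h1 : ∀ m, act (hi e) (act (lo e) (act (hi e) m)) = act (hi e) m := by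
    intro m
    have h := lie_lie_hi_lo_hi e e e
    rw [he, map_zero, map_zero, LinearMap.zero_apply, sub_zero, he1, one_smul] at h
    have h2 := congrArg (fun X => act X m) h
    simp only [act_lie, act_hi_sq he, map_zero, sub_zero, zero_sub, map_sub, map_add,
      LinearMap.add_apply] at h2
    have h3 : (2 : k) • act (hi e) (act (lo e) (act (hi e) m)) = (2 : k) • act (hi e) m := by
      linear_combination (norm := module) h2
    exact smul_right_injective _ (two_ne_zero (α := k)) h3
  have h2 : ∀ m, act (lo e) (act (hi e) (act (lo e) m)) = act (lo e) m := by
    intro m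
    have h := lie_lie_hi_lo_lo e e e
    rw [he, map_zero, map_zero, LinearMap.zero_apply, he1, one_smul] at h
    have h2 := congrArg (fun X => act X m) h
    simp only [act_lie, act_lo_sq he, map_zero, sub_zero, zero_sub, map_sub, map_neg,
      LinearMap.neg_apply, LinearMap.sub_apply] at h2
    have h3 : (2 : k) • act (lo e) (act (hi e) (act (lo e) m)) = (2 : k) • act (lo e) m := by
      linear_combination (norm := module) -h2
    exact smul_right_injective _ (two_ne_zero (α := k)) h3
  have h3 : ∀ m, act (hi e + lo e) m = act (hi e) m + act (lo e) m := fun m => by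
    rw [map_add, LinearMap.add_apply]
  rw [h3 m, h3, h3]
  simp only [LinearMap.map_add, act_hi_sq he, act_lo_sq he, h1, h2, LinearMap.map_zero, zero_add,
    add_zero]

theorem isSemisimple_ad_hi_add_lo {e : Spin k} (he : spinPair e e = 0) (he1 : e ⬝ᵥ e = 1) :
    (LieAlgebra.ad k (e6 k) (hi e + lo e)).IsSemisimple := by
  refine isSemisimple_ad_of_cube_eq (LinearMap.ext fun v => (coord k).injective ?_)
  have h := cube_hi_add_lo he he1 (coord k v)
  simp only [act_apply, LinearEquiv.symm_apply_apply] at h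
  exact h

/-- The basis vectors `e I` and `e J` are orthogonal for the pairing `spinPair`. -/
def orthIndex (I J : Fin 16) : Prop :=
  ∀ a, spinSign a J = 0 ∨ spinIndex a J ≠ I

instance (I J : Fin 16) : Decidable (orthIndex I J) := by
  unfold orthIndex
  infer_instance

theorem spinPair_single_eq_zero {I J : Fin 16} (h : orthIndex I J) :
    spinPair (Pi.single I 1 : Spin k) (Pi.single J 1) = 0 := by
  ext a
  have h1 := form_single_right (spinPair (Pi.single I 1 : Spin k) (Pi.single J 1)) a.swap
  rw [Sum.swap_swap, form_comm, form_spinPair, dotProduct_single, mul_one, spinMul_single] at h1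
  rw [← h1]
  rcases h a.swap with h | h
  · rw [h, Int.cast_zero, zero_mul]
    rfl
  · rw [Pi.single_eq_of_ne h, mul_zero]
    rfl

theorem lie_eq_of_commute {s t η ξ : Spin k} (h : ⁅hi s + lo t, hi η + lo ξ⁆ = 0) :
    ⁅hi s, lo ξ⁆ = ⁅hi η, lo t⁆ := by
  rw [lie_add, add_lie, add_lie, lie_hi_hi, lie_lo_lo, zero_add, add_zero,
    ← lie_skew (lo t)] at h
  rw [← sub_eq_zero]
  linear_combination (norm := module) h

/-- Compare spinor components on a test spinor `m`. With `m = e I`, coordinate `I` gives `ξ I = η I`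
and coordinate `J` gives `ξ J = 0`; with `m = e J`, coordinate `I` gives `η J = 0`. -/
theorem coord_of_commute {I : Fin 16} (hI : orthIndex I I) {η ξ : Spin k}
    (h : ⁅hi (Pi.single I 1 : Spin k) + lo (Pi.single I 1 : Spin k), hi η + lo ξ⁆ = 0) :
    ξ I = η I ∧ ∀ J, J ≠ I → orthIndex I J → ξ J = 0 ∧ η J = 0 := by
  have h0 := lie_eq_of_commute h
  have h1 : ∀ m : Spin k, spinMul (swap (spinPair ξ m)) (Pi.single I 1) - (m I) • ξ =
      spinMul (swap (spinPair (Pi.single I 1) m)) η - (η ⬝ᵥ m) • Pi.single I 1 := by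
    intro m
    have h2 := congrArg (fun X => (act X (0, m, 0)).2.1) h0
    simpa only [act_lie_hi_lo, single_dotProduct, one_mul] using h2
  have hII := spinPair_single_eq_zero (k := k) hI
  have h3 : ∀ (w : Vec k), spinMul w (Pi.single I 1 : Spin k) I = 0 := by
    intro w
    have := form_spinPair w (Pi.single I 1 : Spin k) (Pi.single I 1)
    rw [hII, map_zero, dotProduct_single, mul_one] at this
    exact this.symm
  refine ⟨?_, fun J hJ hIJ => ⟨?_, ?_⟩⟩
  · have h4 := congrFun (h1 (Pi.single I 1)) I
    simp only [Pi.sub_apply, Pi.smul_apply, h3, hII, map_zero, LinearMap.zero_apply, Pi.zero_apply,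
      Pi.single_eq_same, dotProduct_single, smul_eq_mul] at h4
    linear_combination -h4
  · have h4 := congrFun (h1 (Pi.single I 1)) J
    have h5 : spinMul (swap (spinPair ξ (Pi.single I 1))) (Pi.single I 1 : Spin k) J = 0 := by
      have := form_spinPair (swap (spinPair ξ (Pi.single I 1))) (Pi.single I 1 : Spin k)
        (Pi.single J 1)
      rw [spinPair_single_eq_zero hIJ, map_zero, dotProduct_single, mul_one] at this
      exact this.symm
    simp only [Pi.sub_apply, Pi.smul_apply, h5, hII, map_zero, LinearMap.zero_apply, Pi.zero_apply,
      Pi.single_eq_same, Pi.single_eq_of_ne hJ, smul_eq_mul] at h4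
    linear_combination -h4
  · have h4 := congrFun (h1 (Pi.single J 1)) I
    simp only [Pi.sub_apply, Pi.smul_apply, h3, spinPair_single_eq_zero hIJ, map_zero,
      LinearMap.zero_apply, Pi.zero_apply, Pi.single_eq_same, Pi.single_eq_of_ne hJ.symm,
      dotProduct_single, smul_eq_mul] at h4
    linear_combination h4

/-- The parametrization of the Cartan subspace. -/
noncomputable def cartanMap (k : Type*) [Field k] [CharZero k] : k × k →ₗ[k] e6 k :=
  LinearMap.coprod (LinearMap.toSpanSingleton k _ (hi (Pi.single 0 1 : Spin k) + lo (Pi.single 0 1 : Spin k)))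
    (LinearMap.toSpanSingleton k _ (hi (Pi.single 14 1 : Spin k) + lo (Pi.single 14 1 : Spin k)))

theorem cartanMap_apply (a b : k) : cartanMap k (a, b) =
    a • (hi (Pi.single 0 1 : Spin k) + lo (Pi.single 0 1 : Spin k)) +
      b • (hi (Pi.single 14 1 : Spin k) + lo (Pi.single 14 1 : Spin k)) := rfl

theorem cartanMap_eq (a b : k) : cartanMap k (a, b) =
    hi (a • Pi.single 0 1 + b • Pi.single 14 1) + lo (a • Pi.single 0 1 + b • Pi.single 14 1) := by
  rw [cartanMap_apply]
  simp only [map_add, map_smul]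
  module

theorem spinPair_zero_fourteen (w : Vec k) :
    spinPair (Pi.single 14 1 : Spin k) (spinMul w (Pi.single 0 1 : Spin k)) =
      spinPair (Pi.single 0 1 : Spin k) (spinMul w (Pi.single 14 1 : Spin k)) := by
  ext (i | i) <;> fin_cases i <;>
    simp [spinPair_apply, spinPairFun, spinMul_apply, spinMulFun]

theorem lie_zero_fourteen : ⁅(hi (Pi.single 0 1 : Spin k) + lo (Pi.single 0 1 : Spin k) : e6 k),
    hi (Pi.single 14 1 : Spin k) + lo (Pi.single 14 1 : Spin k)⁆ = 0 := by
  have h : ⁅(hi (Pi.single 0 1 : Spin k) : e6 k), lo (Pi.single 14 1 : Spin k)⁆ =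
      ⁅(hi (Pi.single 14 1 : Spin k) : e6 k), lo (Pi.single 0 1 : Spin k)⁆ := by
    refine eq_of_act ?_ (fun w => ?_) fun s => ?_
    · rw [act_lie_hi_lo, act_lie_hi_lo]
      simp
    · rw [act_lie_hi_lo, act_lie_hi_lo]
      simp [spinPair_zero_fourteen]
    · rw [act_lie_hi_lo, act_lie_hi_lo]
      simp
  rw [lie_add, add_lie, add_lie, lie_hi_hi, lie_lo_lo, zero_add, add_zero, ← lie_skew (lo _), h]
  exact neg_add_cancel _

end Cartan

/-! ### A basis of `𝔰𝔬₁₀` -/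

section Wedge

variable {k : Type*} [Field k] [CharZero k]

theorem wedge_apply (u v : Vec k) (a b : Fin 5 ⊕ Fin 5) :
    (wedge u v).1 a b = u a * v b.swap - v a * u b.swap := by
  simp [wedge, Matrix.vecMulVec_apply, swap_apply]

/-- The factor `2⁻¹` appears because skewness makes each entry count twice. -/
theorem eq_sum_wedge (A : so10 k) :
    A = (2⁻¹ : k) • ∑ a, ∑ b, A.1 b a • wedge (Pi.single b 1) (Pi.single a.swap 1) := by
  have hs : ∀ a b, (∑ i, ∑ j, A.1 j i •
      wedge (Pi.single j (1 : k)) (Pi.single i.swap (1 : k)) : so10 k).1 a b =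
      ∑ i, ∑ j, A.1 j i * (wedge (Pi.single j (1 : k)) (Pi.single i.swap (1 : k))).1 a b := by
    intro a b
    simp [Matrix.sum_apply]
  refine Subtype.ext (Matrix.ext fun a b => ?_)
  have h1 : ∀ i j : Fin 5 ⊕ Fin 5, (Pi.single i.swap 1 : Vec k) j = if i = j.swap then 1 else 0 := by
    intro i j
    rw [Pi.single_apply]
    refine if_congr ?_ rfl rfl
    constructor
    · rintro rfl
      exact (Sum.swap_swap i).symm
    · rintro rfl
      exact (Sum.swap_swap j).symm
  change A.1 a b = (2⁻¹ : k) • (∑ i, ∑ j, A.1 j i •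
      wedge (Pi.single j (1 : k)) (Pi.single i.swap (1 : k)) : so10 k).1 a b
  rw [hs]
  simp only [wedge_apply, h1, Sum.swap_swap, mul_sub, Finset.sum_sub_distrib]
  simp only [Pi.single_apply, mul_ite, ite_mul, mul_one, mul_zero, zero_mul,
    Finset.sum_ite_irrel, Finset.sum_const_zero, Finset.sum_ite_eq, Finset.sum_ite_eq',
    Finset.mem_univ, if_true, Sum.swap_swap]
  have := (so10_skew A).apply_swap b a
  rw [smul_eq_mul]
  linear_combination 2⁻¹ * this

theorem lie_wedge (A : so10 k) (u v : Vec k) :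
    ⁅A, wedge u v⁆ = wedge (A.1.mulVec u) v + wedge u (A.1.mulVec v) := by
  refine Subtype.ext (Matrix.ext_of_mulVec_single fun a => ?_)
  change (A.1 * (wedge u v).1 - (wedge u v).1 * A.1).mulVec _ =
    ((wedge (A.1.mulVec u) v).1 + (wedge u (A.1.mulVec v)).1).mulVec _
  rw [Matrix.sub_mulVec, ← Matrix.mulVec_mulVec, ← Matrix.mulVec_mulVec, Matrix.add_mulVec]
  simp only [wedge_mulVec, Matrix.mulVec_sub, Matrix.mulVec_smul]
  have h : ∀ w w', form w (A.1.mulVec w') = - form (A.1.mulVec w) w' := by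
    intro w w'
    rw [so10_skew A, neg_neg]
  simp only [h]
  module

end Wedge

/-! ### Contraction and membership for multiplicative one-parameter subgroups. -/

section OneParameter

variable {k L : Type*} [Field k] [LieRing L] [LieAlgebra k L] {h : L} {lam : kˣ →* (L ≃ₗ[k] L)}

theorem IsMultOneParam.contractsToZero (hlam : IsMultOneParam h lam) {v : L} (hv : ⁅h, v⁆ = v) :
    ContractsToZero lam v := by
  refine ⟨1, fun _ => v, fun t => ?_⟩
  rw [Finset.sum_range_one, zero_add, pow_one, hlam.2 t 1 v, zpow_one]
  rw [Module.End.mem_eigenspace_iff, LieAlgebra.ad_apply, hv, Int.cast_one, one_smul]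

theorem IsMultOneParam.mem_connectedSubgroup (hlam : IsMultOneParam h lam)
    {m : LieSubalgebra k L} (hm : h ∈ m) (t : kˣ) : lam t ∈ connectedSubgroup m :=
  Subgroup.subset_closure (Or.inr ⟨h, hm, lam, hlam, t, rfl⟩)

end OneParameter

/-! ### The Cartan subspace and a contracting one-parameter subgroup -/

section CartanSubspace

variable {k : Type*} [Field k] [IsAlgClosed k] [CharZero k]

theorem cartanMap_eq_hi_add_lo (p : k × k) : ∃ s ∈ Submodule.span k
    {(Pi.single 0 1 : Spin k), (Pi.single 14 1 : Spin k)}, cartanMap k p = hi s + lo s :=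
  ⟨p.1 • Pi.single 0 1 + p.2 • Pi.single 14 1, Submodule.mem_span_pair.2 ⟨_, _, rfl⟩,
    cartanMap_eq p.1 p.2⟩

theorem cartanMap_injective : Function.Injective (cartanMap k) := by
  refine (injective_iff_map_eq_zero _).2 fun p hp => ?_
  rw [← Prod.mk.eta (p := p), cartanMap_eq] at hp
  have h1 := congrArg hiPart hp
  rw [map_add, hiPart_hi, hiPart_lo, add_zero, map_zero] at h1
  have h2 := congrFun h1 0
  have h3 := congrFun h1 14
  simp [Pi.single_apply] at h2 h3
  exact Prod.ext h2 h3

theorem isAbelianSemisimple_range_cartanMap :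
    IsAbelianSemisimple (g1 k) (LinearMap.range (cartanMap k)) := by
  refine ⟨?_, ?_, ?_⟩
  · rintro _ ⟨p, rfl⟩
    obtain ⟨s, -, hs⟩ := cartanMap_eq_hi_add_lo p
    exact mem_odd.2 ⟨s, s, hs⟩
  · rintro _ ⟨⟨a, b⟩, rfl⟩ _ ⟨⟨c, d⟩, rfl⟩
    have h := lie_zero_fourteen (k := k)
    have h' := lie_skew (hi (Pi.single 0 1 : Spin k) + lo (Pi.single 0 1 : Spin k) : e6 k)
      (hi (Pi.single 14 1 : Spin k) + lo (Pi.single 14 1 : Spin k))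
    rw [h, neg_eq_zero] at h'
    rw [cartanMap_apply, cartanMap_apply]
    generalize (hi (Pi.single 0 1 : Spin k) + lo (Pi.single 0 1 : Spin k) : e6 k) = E at *
    generalize (hi (Pi.single 14 1 : Spin k) + lo (Pi.single 14 1 : Spin k) : e6 k) = F at *
    simp only [lie_add, add_lie, lie_smul, smul_lie, lie_self, h, h', smul_zero, add_zero]
  · rintro _ ⟨⟨a, b⟩, rfl⟩
    have h := lie_zero_fourteen (k := k)
    have hE := isSemisimple_ad_hi_add_lo (k := k) (e := Pi.single 0 1)
      (spinPair_single_eq_zero (by decide)) (by simp)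
    have hF := isSemisimple_ad_hi_add_lo (k := k) (e := Pi.single 14 1)
      (spinPair_single_eq_zero (by decide)) (by simp)
    rw [cartanMap_apply, map_add, map_smul, map_smul]
    refine Module.End.IsSemisimple.add_of_commute ?_ (Module.End.IsSemisimple_smul a hE)
      (Module.End.IsSemisimple_smul b hF)
    refine Commute.smul_left (Commute.smul_right ?_ _) _
    rw [commute_iff_lie_eq, ← LieHom.map_lie, h, map_zero]

/-- Maximality: every index other than `0` and `14` is orthogonal to one of these two, so commuting
with both generators kills all remaining coordinates. -/
theorem mem_range_cartanMap {x : e6 k} (hx : x ∈ g1 k)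
    (h0 : ⁅(hi (Pi.single 0 1 : Spin k) + lo (Pi.single 0 1 : Spin k) : e6 k), x⁆ = 0)
    (h14 : ⁅(hi (Pi.single 14 1 : Spin k) + lo (Pi.single 14 1 : Spin k) : e6 k), x⁆ = 0) :
    x ∈ LinearMap.range (cartanMap k) := by
  obtain ⟨η, ξ, rfl⟩ := mem_odd.1 hx
  obtain ⟨h1, h2⟩ := coord_of_commute (by decide) h0
  obtain ⟨h3, h4⟩ := coord_of_commute (by decide) h14
  have horth : ∀ J : Fin 16, J ≠ 0 → J ≠ 14 → orthIndex 0 J ∨ orthIndex 14 J := by decide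
  have h5 : ∀ J, J ≠ 0 → J ≠ 14 → ξ J = 0 ∧ η J = 0 := fun J hJ hJ' =>
    (horth J hJ hJ').elim (h2 J hJ) (h4 J hJ')
  have h6 : η = η 0 • Pi.single 0 1 + η 14 • Pi.single 14 1 := by
    ext J
    by_cases hJ : J = 0
    · simp [hJ]
    by_cases hJ' : J = 14
    · simp [hJ']
    simp [hJ, hJ', (h5 J hJ hJ').2]
  have h7 : ξ = η := by
    ext J
    by_cases hJ : J = 0
    · rw [hJ, h1]
    by_cases hJ' : J = 14
    · rw [hJ', h3]
    rw [(h5 J hJ hJ').1, (h5 J hJ hJ').2]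
  refine ⟨(η 0, η 14), ?_⟩
  rw [cartanMap_eq, h7, ← h6]

theorem isCartanSubspace_range_cartanMap :
    IsCartanSubspace (g1 k) (LinearMap.range (cartanMap k)) := by
  refine ⟨isAbelianSemisimple_range_cartanMap, fun c hc hle x hx => ?_⟩
  refine mem_range_cartanMap (hc.1 hx) (hc.2.1 _ (hle ⟨(1, 0), ?_⟩) x hx)
    (hc.2.1 _ (hle ⟨(0, 1), ?_⟩) x hx)
  · rw [cartanMap_apply, one_smul, zero_smul, add_zero]
  · rw [cartanMap_apply, one_smul, zero_smul, zero_add]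

theorem finrank_range_cartanMap : Module.finrank k (LinearMap.range (cartanMap k)) = 2 := by
  rw [LinearMap.finrank_range_of_inj cartanMap_injective, Module.finrank_prod,
    Module.finrank_self]

theorem projOne_range_cartanMap :
    projOne (gradingElt k) (LinearMap.range (cartanMap k)) =
      Submodule.span k {hi (Pi.single 0 1 : Spin k), hi (Pi.single 14 1 : Spin k)} := by
  ext x
  rw [mem_projOne isAbelianSemisimple_range_cartanMap.1, Submodule.mem_span_pair]
  constructor
  · rintro ⟨η, ξ, ⟨⟨a, b⟩, h⟩, rfl⟩
    rw [cartanMap_eq] at h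
    have h1 := congrArg hiPart h
    rw [LinearMap.map_add hiPart, LinearMap.map_add hiPart, hiPart_hi, hiPart_hi, hiPart_lo,
      hiPart_lo, add_zero, add_zero] at h1
    exact ⟨a, b, by rw [← h1, map_add, map_smul, map_smul]⟩
  · rintro ⟨a, b, rfl⟩
    exact ⟨_, _, ⟨(a, b), cartanMap_eq a b⟩, by rw [map_add, map_smul, map_smul]⟩

theorem cartanElt_mulVec_single (x : Fin 5 → k) (a : Fin 5 ⊕ Fin 5) :
    (cartanElt x).1.mulVec (Pi.single a 1) = Sum.elim x (-x) a • (Pi.single a 1 : Vec k) := by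
  rw [cartanElt_eq]
  ext b
  rw [Matrix.mulVec_diagonal, Pi.smul_apply, smul_eq_mul]
  by_cases h : b = a
  · subst h
    rw [Pi.single_eq_same]
  · rw [Pi.single_eq_of_ne h, mul_zero, mul_zero]

theorem lie_cartanElt_lo_single (x : Fin 5 → k) (c : k) (J : Fin 16) :
    ⁅mid (cartanElt x, c), lo (Pi.single J 1 : Spin k)⁆ =
      ((∑ i, spinWeight J i / 2 * x i) - c) • lo (Pi.single J 1 : Spin k) := by
  have h : spinAct (cartanElt x).1 (Pi.single J 1) =
      (∑ i, spinWeight J i / 2 * x i) • (Pi.single J 1 : Spin k) := by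
    ext K
    rw [spinAct_cartanElt, Pi.smul_apply, smul_eq_mul]
    by_cases h : K = J
    · rw [h]
    · rw [Pi.single_eq_of_ne h, mul_zero, mul_zero]
  rw [lie_mid_lo, h, ← sub_smul, map_smul]

theorem lie_cartanElt_hi_single (x : Fin 5 → k) (c : k) (J : Fin 16) :
    ⁅mid (cartanElt x, c), hi (Pi.single J 1 : Spin k)⁆ =
      (c - ∑ i, spinWeight J i / 2 * x i) • hi (Pi.single J 1 : Spin k) := by
  have h : spinAct (cartanElt x).1.transpose (Pi.single J 1) =
      (∑ i, spinWeight J i / 2 * x i) • (Pi.single J 1 : Spin k) := by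
    ext K
    rw [cartanElt_eq, Matrix.diagonal_transpose, ← cartanElt_eq, spinAct_cartanElt, Pi.smul_apply,
      smul_eq_mul]
    by_cases h : K = J
    · rw [h]
    · rw [Pi.single_eq_of_ne h, mul_zero, mul_zero]
  rw [lie_mid_hi, h, ← sub_smul, map_smul]

theorem lie_cartanElt_wedge_single (x : Fin 5 → k) (c : k) (a b : Fin 5 ⊕ Fin 5) :
    ⁅(mid (cartanElt x, c) : e6 k), mid (wedge (Pi.single a 1 : Vec k) (Pi.single b 1), 0)⁆ =
      (Sum.elim x (-x) a + Sum.elim x (-x) b) •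
        mid (wedge (Pi.single a 1 : Vec k) (Pi.single b 1), 0) := by
  have h : ∀ c d : k, ∀ u v : Vec k, wedge (c • u) v + wedge u (d • v) = (c + d) • wedge u v := by
    intro c d u v
    refine Subtype.ext (Matrix.ext fun i j => ?_)
    change (wedge (c • u) v).1 i j + (wedge u (d • v)).1 i j = (c + d) * (wedge u v).1 i j
    simp only [wedge_apply, Pi.smul_apply, smul_eq_mul]
    ring
  rw [lie_mid_mid, lie_wedge, cartanElt_mulVec_single, cartanElt_mulVec_single, h, ← map_smul]
  congr 1
  exact Prod.ext rfl (smul_zero _).symm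

/-- Twice the value of `ε₁` on the weight of a basis vector of the vector representation. -/
def doubleWeight : Fin 5 ⊕ Fin 5 → ℤ :=
  Sum.elim ![2, 0, 0, 0, 0] ![-2, 0, 0, 0, 0]

theorem doubleWeight_cast (a : Fin 5 ⊕ Fin 5) :
    (Sum.elim ![2, 0, 0, 0, 0] (-![2, 0, 0, 0, 0]) a : k) = (doubleWeight a : k) := by
  rcases a with i | i <;> fin_cases i <;> simp [doubleWeight]

theorem sum_spinWeight (J : Fin 16) :
    ∑ i, (spinWeight J i / 2 * (![2, 0, 0, 0, 0] : Fin 5 → k) i) = spinWeight J 0 := by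
  simp [Fin.sum_univ_five]

/-- Spinor weights are half-integral, and the value `2` of `ε₁` makes the eigenvalues `±1` on
`𝔤(±1)`; on wedges of basis vectors they are sums of two values of `doubleWeight`. -/
theorem iSup_eigenspace_cartanElt :
    (⨆ i : ℤ, (LieAlgebra.ad k (e6 k)
      (mid (cartanElt (![2, 0, 0, 0, 0] : Fin 5 → k), 0))).eigenspace (i : k)) = ⊤ := by
  have hmem : ∀ (i : ℤ) (X : e6 k),
      ⁅mid (cartanElt (![2, 0, 0, 0, 0] : Fin 5 → k), 0), X⁆ = (i : k) • X →
      X ∈ ⨆ i : ℤ, (LieAlgebra.ad k (e6 k)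
        (mid (cartanElt (![2, 0, 0, 0, 0] : Fin 5 → k), 0))).eigenspace (i : k) :=
    fun i X h => Submodule.mem_iSup_of_mem i (Module.End.mem_eigenspace_iff.2 h)
  generalize (⨆ i : ℤ, (LieAlgebra.ad k (e6 k)
    (mid (cartanElt (![2, 0, 0, 0, 0] : Fin 5 → k), 0))).eigenspace (i : k)) = U at hmem ⊢
  have hlo : ∀ ξ : Spin k, lo ξ ∈ U := by
    intro ξ
    rw [pi_eq_sum_univ' ξ, map_sum]
    refine Submodule.sum_mem _ fun J _ => ?_
    rw [map_smul]
    exact U.smul_mem _ (hmem (spinWeight J 0) _ (by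
      rw [lie_cartanElt_lo_single, sum_spinWeight, sub_zero]))
  have hhi : ∀ η : Spin k, hi η ∈ U := by
    intro η
    rw [pi_eq_sum_univ' η, map_sum]
    refine Submodule.sum_mem _ fun J _ => ?_
    rw [map_smul]
    exact U.smul_mem _ (hmem (-spinWeight J 0) _ (by
      rw [lie_cartanElt_hi_single, sum_spinWeight, zero_sub, Int.cast_neg]))
  have hw : ∀ a b, mid (wedge (Pi.single a 1 : Vec k) (Pi.single b 1), 0) ∈ U := fun a b =>
    hmem (doubleWeight a + doubleWeight b) _ (by
      rw [lie_cartanElt_wedge_single, doubleWeight_cast, doubleWeight_cast, Int.cast_add])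
  have hmid : ∀ A : so10 k, mid (A, 0) ∈ U := by
    intro A
    have h : A ∈ U.comap (mid.comp (LinearMap.inl k (so10 k) k)) := by
      rw [eq_sum_wedge A]
      exact Submodule.smul_mem _ _ (Submodule.sum_mem _ fun a _ => Submodule.sum_mem _ fun b _ =>
        Submodule.smul_mem _ _ (hw b a.swap))
    exact h
  refine eq_top_iff.2 fun X _ => ?_
  obtain ⟨ξ, ⟨A, c⟩, η, rfl⟩ := exists_decomp X
  refine U.add_mem (U.add_mem (hlo ξ) ?_) (hhi η)
  have h1 : (mid (A, c) : e6 k) = mid (A, 0) + mid (0, c) := by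
    rw [← map_add, Prod.mk_add_mk, add_zero, zero_add]
  rw [h1]
  refine U.add_mem (hmid A) (hmem 0 _ ?_)
  rw [lie_mid_mid, lie_zero, Int.cast_zero, zero_smul]
  exact mid_zero

theorem lie_cartanElt_hi_single_eq_self {J : Fin 16} (hJ : spinWeight J 0 = -1) :
    ⁅mid (cartanElt (![2, 0, 0, 0, 0] : Fin 5 → k), 0), hi (Pi.single J 1 : Spin k)⁆ =
      hi (Pi.single J 1 : Spin k) := by
  have h : (0 - ((-1 : ℤ) : k)) = 1 := by norm_num
  rw [lie_cartanElt_hi_single, sum_spinWeight, hJ, h, one_smul]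

theorem lie_eq_self_of_mem_projOne {v : e6 k}
    (hv : v ∈ projOne (gradingElt k) (LinearMap.range (cartanMap k))) :
    ⁅mid (cartanElt (![2, 0, 0, 0, 0] : Fin 5 → k), 0), v⁆ = v := by
  rw [projOne_range_cartanMap, Submodule.mem_span_pair] at hv
  obtain ⟨a, b, rfl⟩ := hv
  rw [lie_add, lie_smul, lie_smul, lie_cartanElt_hi_single_eq_self (by decide),
    lie_cartanElt_hi_single_eq_self (by decide)]

theorem exists_isMultOneParam_contracting :
    ∃ lam : kˣ →* (e6 k ≃ₗ[k] e6 k), (∀ t, lam t ∈ SO10 (midEquiv k)) ∧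
      IsMultOneParam (so10Embedding (midEquiv k) (cartanElt ![2, 0, 0, 0, 0])) lam ∧
      ∀ v ∈ projOne (gradingElt k) (LinearMap.range (cartanMap k)), ContractsToZero lam v := by
  rw [so10Embedding_midEquiv]
  obtain ⟨lam, hlam⟩ := exists_isMultOneParam (iSup_eigenspace_cartanElt (k := k))
  exact ⟨lam, hlam.mem_connectedSubgroup ⟨_, so10Embedding_midEquiv _⟩, hlam,
    fun v hv => hlam.contractsToZero (lie_eq_self_of_mem_projOne hv)⟩

end CartanSubspace

/-! ### Chevalley generators -/

section Serre

/-- Twice the coordinates of the projections to `𝔰𝔬₁₀` of the simple coroots of `E₆`. -/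
def corootVec : Fin 6 → Fin 5 → ℤ :=
  ![![-1, -1, -1, -1, 1], ![0, 0, 0, 2, 2], ![0, 0, 0, 2, -2], ![0, 0, 2, -2, 0],
    ![0, 2, -2, 0, 0], ![2, -2, 0, 0, 0]]

/-- Four times the projections to the center of `𝔤(0)` of the simple coroots of `E₆`. -/
def corootDeg : Fin 6 → ℤ := ![3, 0, 0, 0, 0, 0]

/-- Twice the values at the simple coroots of the weights of the vector representation. -/
def vecWeight (i : Fin 6) : Fin 5 ⊕ Fin 5 → ℤ :=
  Sum.elim (corootVec i) (-corootVec i)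

/-- Four times the values at the simple coroots of the weights of `𝔤(1)`. -/
def hiWeight (i : Fin 6) (J : Fin 16) : ℤ :=
  corootDeg i - ∑ j, spinWeight J j * corootVec i j

/-- The simple roots `ε₄ + ε₅`, `ε₄ - ε₅`, `ε₃ - ε₄`, `ε₂ - ε₃`, `ε₁ - ε₂` of `𝔰𝔬₁₀` are the sums
of the weights `rootFst n` and `rootSnd n`. -/
def rootFst : Fin 5 → Fin 5 ⊕ Fin 5 := ![.inl 3, .inl 3, .inl 2, .inl 1, .inl 0]

/-- The second summands of the simple roots of `𝔰𝔬₁₀`. -/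
def rootSnd : Fin 5 → Fin 5 ⊕ Fin 5 := ![.inl 4, .inr 4, .inr 3, .inr 2, .inr 1]

theorem hiWeight_fifteen (i : Fin 6) : hiWeight i 15 = 4 * CartanMatrix.E₆ i 0 := by
  decide +revert

theorem vecWeight_root (i : Fin 6) (n : Fin 5) :
    vecWeight i (rootFst n) + vecWeight i (rootSnd n) = 2 * CartanMatrix.E₆ i n.succ := by
  decide +revert

theorem vecWeight_swap (i : Fin 6) (a : Fin 5 ⊕ Fin 5) : vecWeight i a.swap = -vecWeight i a := by
  rcases a with j | j <;> simp [vecWeight]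

/-- The Weyl group invariant norm of an integral weight, normalized so that roots have norm 6. -/
def weightNorm (l : Fin 6 → ℤ) : ℤ :=
  4 * l 0 ^ 2 + 6 * l 1 ^ 2 + 10 * l 2 ^ 2 + 18 * l 3 ^ 2 + 10 * l 4 ^ 2 + 4 * l 5 ^ 2 +
    2 * (l 0 * (3 * l 1 + 5 * l 2 + 6 * l 3 + 4 * l 4 + 2 * l 5) +
      l 1 * (6 * l 2 + 9 * l 3 + 6 * l 4 + 3 * l 5) + l 2 * (12 * l 3 + 8 * l 4 + 4 * l 5) +
      l 3 * (12 * l 4 + 6 * l 5) + 5 * l 4 * l 5)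

theorem weightNorm_mul (c : ℤ) (l : Fin 6 → ℤ) :
    weightNorm (fun i => c * l i) = c ^ 2 * weightNorm l := by
  simp only [weightNorm]
  ring

/-- The norm in terms of the orthogonal coordinates on `𝔰𝔬₁₀` and the degree. -/
theorem weightNorm_eq (t : ℤ) (w : Fin 5 → ℤ) :
    weightNorm (fun i => t * corootDeg i - ∑ j, w j * corootVec i j) =
      12 * ∑ j, w j ^ 2 + 36 * t ^ 2 := by
  simp [weightNorm, Fin.sum_univ_five, corootVec, corootDeg]
  ring

theorem weightNorm_hiWeight (J : Fin 16) : weightNorm (fun i => hiWeight i J) = 96 := by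
  have h : ∀ j, spinWeight J j ^ 2 = 1 := by
    intro j
    rw [spinWeight]
    split_ifs <;> rfl
  have h1 := weightNorm_eq 1 (spinWeight J)
  simp only [one_mul, h] at h1
  exact h1

/-- The orthogonal coordinates of the weights of the vector representation. -/
def unitCoord (a : Fin 5 ⊕ Fin 5) (j : Fin 5) : ℤ :=
  (if a = .inl j then 1 else 0) - if a = .inr j then 1 else 0

theorem vecWeight_eq_sum (i : Fin 6) (a : Fin 5 ⊕ Fin 5) :
    vecWeight i a = ∑ j, unitCoord a j * corootVec i j := by
  rcases a with l | l <;> simp [vecWeight, unitCoord]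

theorem sum_unitCoord_mul (a b : Fin 5 ⊕ Fin 5) : ∑ j, unitCoord a j * unitCoord b j =
    (if a = b then 1 else 0) - if a = b.swap then 1 else 0 := by
  rcases a with l | l <;> rcases b with m | m <;> simp [unitCoord, eq_comm]

theorem sum_unitCoord_sub_sq {a b : Fin 5 ⊕ Fin 5} (hab : a ≠ b.swap) :
    ∑ j, (unitCoord b j - unitCoord a j) ^ 2 = 0 ∨
      ∑ j, (unitCoord b j - unitCoord a j) ^ 2 = 2 := by
  have h : ∑ j, (unitCoord b j - unitCoord a j) ^ 2 = ∑ j, unitCoord b j * unitCoord b j -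
      2 * ∑ j, unitCoord a j * unitCoord b j + ∑ j, unitCoord a j * unitCoord a j := by
    rw [Finset.mul_sum, ← Finset.sum_sub_distrib, ← Finset.sum_add_distrib]
    exact Finset.sum_congr rfl fun j _ => by ring
  have h1 : ∀ c : Fin 5 ⊕ Fin 5, c ≠ c.swap := by decide
  rw [h, sum_unitCoord_mul, sum_unitCoord_mul, sum_unitCoord_mul, if_neg (h1 a), if_neg (h1 b),
    if_neg hab, if_pos rfl, if_pos rfl]
  split_ifs <;> decide

theorem weightNorm_vecWeight_sub {a b : Fin 5 ⊕ Fin 5} (hab : a ≠ b.swap) :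
    weightNorm (fun i => vecWeight i a - vecWeight i b) = 0 ∨
      weightNorm (fun i => vecWeight i a - vecWeight i b) = 24 := by
  have h1 := weightNorm_eq 0 (fun j => unitCoord b j - unitCoord a j)
  have h2 : ∀ i, 0 * corootDeg i - ∑ j, (unitCoord b j - unitCoord a j) * corootVec i j =
      vecWeight i a - vecWeight i b := by
    intro i
    simp only [vecWeight_eq_sum, sub_mul, Finset.sum_sub_distrib]
    ring
  simp only [h2] at h1
  have h3 := sum_unitCoord_sub_sq hab
  omega

/-- The norm shows that the integral weight `lam` is neither zero nor a root of `E₆`. -/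
def IsNotRoot (lam : Fin 6 → ℤ) : Prop :=
  weightNorm lam ≠ 0 ∧ weightNorm lam ≠ 6

/-- The matrix of `weightNorm` is three times the inverse of the Cartan matrix, so on root-lattice
coordinates it becomes three times the Cartan form. -/
theorem weightNorm_sum (x : Fin 6 → ℤ) :
    weightNorm (fun l => ∑ m, CartanMatrix.E₆ l m * x m) =
      3 * ∑ l, ∑ m, CartanMatrix.E₆ l m * x m * x l := by
  simp [weightNorm, Fin.sum_univ_six, CartanMatrix.E₆]
  ring

theorem weightNorm_root_add_root (i j : Fin 6) (a b : ℤ) :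
    weightNorm (fun l => CartanMatrix.E₆ l i * a + CartanMatrix.E₆ l j * b) =
      6 * (a ^ 2 + b ^ 2 + CartanMatrix.E₆ i j * (a * b)) := by
  have h := weightNorm_sum (Pi.single i a + Pi.single j b)
  simp only [Pi.add_apply, mul_add, Finset.sum_add_distrib, Pi.single_apply, mul_ite, mul_zero,
    Finset.sum_ite_eq', Finset.sum_ite_irrel, Finset.sum_const_zero, Finset.mem_univ, if_true,
    CartanMatrix.E₆_diag, add_mul, ite_mul, zero_mul] at h
  rw [h, CartanMatrix.E₆_isSymm.apply i j]
  ring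

theorem isNotRoot_sub {i j : Fin 6} (hij : i ≠ j) :
    IsNotRoot fun l => CartanMatrix.E₆ l i - CartanMatrix.E₆ l j := by
  have h := weightNorm_root_add_root i j 1 (-1)
  simp only [mul_one, mul_neg, ← sub_eq_add_neg] at h
  rw [IsNotRoot, h]
  rcases CartanMatrix.isSimplyLaced_E₆ hij with h1 | h1 <;> rw [h1] <;> decide

/-- This is the weight of the element in a Serre relation: a sum of two orthogonal simple roots, of
norm 12, or `2α_i + α_j` with `α_i`, `α_j` adjacent, of norm 18. -/
theorem isNotRoot_add {i j : Fin 6} (hij : i ≠ j) :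
    IsNotRoot fun l => (-CartanMatrix.E₆ i j).toNat * CartanMatrix.E₆ l i +
      (CartanMatrix.E₆ l i + CartanMatrix.E₆ l j) := by
  have h := weightNorm_root_add_root i j ((-CartanMatrix.E₆ i j).toNat + 1) 1
  have h0 : ∀ l, CartanMatrix.E₆ l i * ((-CartanMatrix.E₆ i j).toNat + 1 : ℤ) +
      CartanMatrix.E₆ l j * 1 = (-CartanMatrix.E₆ i j).toNat * CartanMatrix.E₆ l i +
      (CartanMatrix.E₆ l i + CartanMatrix.E₆ l j) := fun l => by ring
  simp only [h0] at h
  rw [IsNotRoot, h]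
  rcases CartanMatrix.isSimplyLaced_E₆ hij with h1 | h1 <;> rw [h1] <;> decide

namespace IsNotRoot

variable {lam : Fin 6 → ℤ}

theorem neg (h : IsNotRoot lam) : IsNotRoot (-lam) := by
  have h1 : weightNorm (-lam) = weightNorm lam := by
    simp only [weightNorm, Pi.neg_apply]
    ring
  exact ⟨h1 ▸ h.1, h1 ▸ h.2⟩

theorem exists_ne_zero (h : IsNotRoot lam) : ∃ i, lam i ≠ 0 := by
  by_contra! h0
  exact h.1 (by rw [funext h0]; rfl)

theorem exists_vecWeight_sub_ne (h : IsNotRoot lam) {a b : Fin 5 ⊕ Fin 5} (hab : a ≠ b.swap) :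
    ∃ i, vecWeight i a - vecWeight i b ≠ 2 * lam i := by
  by_contra! h0
  -- `vecWeight` is doubled, so its norms 0 and 24 would give `lam` norm 0 or 6.
  have h1 := weightNorm_vecWeight_sub hab
  rw [funext h0, weightNorm_mul] at h1
  have h2 := h.1
  have h3 := h.2
  omega

theorem exists_hiWeight_ne (h : IsNotRoot lam) (J : Fin 16) :
    ∃ i, hiWeight i J ≠ 4 * lam i := by
  by_contra! h0
  have h1 := weightNorm_hiWeight J
  rw [funext h0, weightNorm_mul] at h1
  have h3 := h.2
  omega

end IsNotRoot

variable {k : Type*} [Field k] [CharZero k]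

variable (k) in
/-- The simple coroots of `E₆`. -/
noncomputable def serreH (i : Fin 6) : e6 k :=
  mid (cartanElt fun j => (corootVec i j : k) / 2, (corootDeg i : k) / 4)

variable (k) in
/-- The simple root vectors of `E₆`. -/
noncomputable def serreE : Fin 6 → e6 k :=
  Fin.cons (hi (Pi.single 15 1))
    fun n => mid (wedge (Pi.single (rootFst n) 1) (Pi.single (rootSnd n) 1), 0)

variable (k) in
/-- The negative simple root vectors of `E₆`. -/
noncomputable def serreF : Fin 6 → e6 k :=
  Fin.cons (lo (Pi.single 15 1))
    fun n => mid (wedge (Pi.single (rootSnd n).swap 1) (Pi.single (rootFst n).swap 1), 0)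

theorem elim_corootVec (i : Fin 6) (a : Fin 5 ⊕ Fin 5) :
    Sum.elim (fun j => (corootVec i j : k) / 2) (-fun j => (corootVec i j : k) / 2) a =
      (vecWeight i a : k) / 2 := by
  rcases a with j | j <;> simp [vecWeight, neg_div]

theorem hiWeight_cast (i : Fin 6) (J : Fin 16) :
    (corootDeg i : k) / 4 - ∑ j, spinWeight J j / 2 * ((corootVec i j : k) / 2) =
      (hiWeight i J : k) / 4 := by
  rw [hiWeight, Int.cast_sub, Int.cast_sum, sub_div, Finset.sum_div]
  congr 1
  refine Finset.sum_congr rfl fun j _ => ?_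
  rw [Int.cast_mul]
  ring

variable [IsAlgClosed k]

theorem lie_serreH_hi_single (i : Fin 6) (J : Fin 16) :
    ⁅serreH k i, hi (Pi.single J 1 : Spin k)⁆ =
      ((hiWeight i J : k) / 4) • hi (Pi.single J 1 : Spin k) := by
  rw [serreH, lie_cartanElt_hi_single, hiWeight_cast]

theorem lie_serreH_lo_single (i : Fin 6) (J : Fin 16) :
    ⁅serreH k i, lo (Pi.single J 1 : Spin k)⁆ =
      (-((hiWeight i J : k) / 4)) • lo (Pi.single J 1 : Spin k) := by
  rw [serreH, lie_cartanElt_lo_single, ← hiWeight_cast, neg_sub]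

theorem lie_serreH_wedge (i : Fin 6) (a b : Fin 5 ⊕ Fin 5) :
    ⁅serreH k i, mid (wedge (Pi.single a 1 : Vec k) (Pi.single b 1), 0)⁆ =
      (((vecWeight i a + vecWeight i b : ℤ) : k) / 2) •
        mid (wedge (Pi.single a 1 : Vec k) (Pi.single b 1), 0) := by
  rw [serreH, lie_cartanElt_wedge_single, elim_corootVec, elim_corootVec, Int.cast_add, add_div]

theorem lie_serreH_serreE (i j : Fin 6) :
    ⁅serreH k i, serreE k j⁆ = (CartanMatrix.E₆ i j : k) • serreE k j := by
  induction j using Fin.cases with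
  | zero =>
    rw [serreE, Fin.cons_zero, lie_serreH_hi_single, hiWeight_fifteen, Int.cast_mul,
      Int.cast_ofNat, mul_div_cancel_left₀ _ (OfNat.ofNat_ne_zero 4)]
  | succ n =>
    rw [serreE, Fin.cons_succ, lie_serreH_wedge, vecWeight_root, Int.cast_mul, Int.cast_ofNat,
      mul_div_cancel_left₀ _ two_ne_zero]

theorem lie_serreH_serreF (i j : Fin 6) :
    ⁅serreH k i, serreF k j⁆ = (-CartanMatrix.E₆ i j : k) • serreF k j := by
  induction j using Fin.cases with
  | zero =>
    rw [serreF, Fin.cons_zero, lie_serreH_lo_single, hiWeight_fifteen, Int.cast_mul,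
      Int.cast_ofNat, mul_div_cancel_left₀ _ (OfNat.ofNat_ne_zero 4)]
  | succ n =>
    rw [serreF, Fin.cons_succ, lie_serreH_wedge, vecWeight_swap, vecWeight_swap, ← neg_add,
      add_comm, vecWeight_root, Int.cast_neg, Int.cast_mul, Int.cast_ofNat, neg_div,
      mul_div_cancel_left₀ _ two_ne_zero]

theorem lie_serreH_serreH (i j : Fin 6) : ⁅serreH k i, serreH k j⁆ = 0 := by
  have h : ⁅cartanElt fun l => (corootVec i l : k) / 2,
      cartanElt fun l => (corootVec j l : k) / 2⁆ = 0 := by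
    refine Subtype.ext ?_
    change (cartanElt fun l => (corootVec i l : k) / 2).1 *
      (cartanElt fun l => (corootVec j l : k) / 2).1 -
      (cartanElt fun l => (corootVec j l : k) / 2).1 *
      (cartanElt fun l => (corootVec i l : k) / 2).1 = 0
    rw [cartanElt_eq, cartanElt_eq, Matrix.diagonal_mul_diagonal, Matrix.diagonal_mul_diagonal,
      sub_eq_zero]
    simp only [mul_comm]
  rw [serreH, serreH, lie_mid_mid, h]
  exact mid_zero

theorem lie_serreH_hi (i : Fin 6) (η : Spin k) :
    ⁅serreH k i, hi η⁆ = hi fun J => (hiWeight i J : k) / 4 * η J := by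
  rw [serreH, lie_mid_hi]
  refine congrArg hi (funext fun J => ?_)
  rw [Pi.sub_apply, Pi.smul_apply, cartanElt_eq, Matrix.diagonal_transpose, ← cartanElt_eq,
    spinAct_cartanElt, smul_eq_mul, ← sub_mul, hiWeight_cast]

theorem lie_serreH_lo (i : Fin 6) (ξ : Spin k) :
    ⁅serreH k i, lo ξ⁆ = lo fun J => -((hiWeight i J : k) / 4) * ξ J := by
  rw [serreH, lie_mid_lo]
  refine congrArg lo (funext fun J => ?_)
  rw [Pi.sub_apply, Pi.smul_apply, spinAct_cartanElt, smul_eq_mul, ← sub_mul, ← hiWeight_cast,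
    neg_sub]

theorem lie_serreH_mid (i : Fin 6) (p : so10 k × k) :
    ∃ A : so10 k, ⁅serreH k i, mid p⁆ = mid (A, 0) ∧
      ∀ a b, A.1 a b = ((vecWeight i a - vecWeight i b : ℤ) : k) / 2 * p.1.1 a b := by
  refine ⟨_, lie_mid_mid _ p, fun a b => ?_⟩
  change ((cartanElt fun l => (corootVec i l : k) / 2).1 * p.1.1 -
    p.1.1 * (cartanElt fun l => (corootVec i l : k) / 2).1) a b = _
  rw [cartanElt_eq, Matrix.sub_apply, Matrix.diagonal_mul, Matrix.mul_diagonal, elim_corootVec,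
    elim_corootVec, Int.cast_sub]
  ring

/-- All coroots act diagonally on spinor coordinates and matrix entries. Each coordinate of `X` is
therefore killed once some coroot separates its weight from `lam`, and the norm supplies such a
coroot. -/
theorem eq_zero_of_isNotRoot {lam : Fin 6 → ℤ} (hlam : IsNotRoot lam) {X : e6 k}
    (hX : ∀ i, ⁅serreH k i, X⁆ = (lam i : k) • X) : X = 0 := by
  obtain ⟨ξ, ⟨A, c⟩, η, rfl⟩ := exists_decomp X
  have key : ∀ i, ((fun J => -((hiWeight i J : k) / 4) * ξ J) - (lam i : k) • ξ = 0) ∧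
      ((lam i : k) * c = 0 ∧ ∀ a b,
        ((vecWeight i a - vecWeight i b : ℤ) : k) / 2 * A.1 a b = lam i * A.1 a b) ∧
      (fun J => (hiWeight i J : k) / 4 * η J) - (lam i : k) • η = 0 := by
    intro i
    have h := hX i
    obtain ⟨B, hB, hB'⟩ := lie_serreH_mid i (A, c)
    rw [lie_add, lie_add, lie_serreH_lo, lie_serreH_hi, hB, smul_add, smul_add, ← map_smul,
      ← map_smul, ← map_smul, ← sub_eq_zero, add_sub_add_comm, add_sub_add_comm, ← map_sub,
      ← map_sub, ← map_sub] at h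
    obtain ⟨h1, h2, h3⟩ := decomp_eq_zero h
    refine ⟨h1, ⟨?_, fun a b => ?_⟩, h3⟩
    · have h4 := congrArg Prod.snd h2
      change (0 : k) - lam i * c = 0 at h4
      rw [zero_sub, neg_eq_zero] at h4
      exact h4
    · have h4 := congrArg (fun p : so10 k × k => p.1.1 a b) h2
      change B.1 a b - lam i * A.1 a b = 0 at h4
      rw [← hB' a b]
      exact sub_eq_zero.1 h4
  obtain ⟨i₀, hi₀⟩ := hlam.exists_ne_zero
  have hc : c = 0 := (mul_eq_zero.1 (key i₀).2.1.1).resolve_left (Int.cast_ne_zero.2 hi₀)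
  have hA : A = 0 := by
    refine Subtype.ext (Matrix.ext fun a b => ?_)
    change A.1 a b = 0
    by_cases hab : a = b.swap
    · subst hab
      have h3 := (so10_skew A).apply_swap b b.swap
      rw [Sum.swap_swap] at h3
      exact self_eq_neg.1 h3
    · obtain ⟨l, hl⟩ := hlam.exists_vecWeight_sub_ne hab
      have h3 := (key l).2.1.2 a b
      by_contra h4
      have h5 := mul_right_cancel₀ h4 h3
      rw [div_eq_iff two_ne_zero, mul_comm] at h5
      exact hl (by exact_mod_cast h5)
  have hη : η = 0 := by
    ext J
    obtain ⟨l, hl⟩ := hlam.exists_hiWeight_ne J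
    have h3 := congrFun (key l).2.2 J
    by_contra h4
    have h5 := mul_right_cancel₀ h4 (sub_eq_zero.1 h3)
    rw [div_eq_iff (OfNat.ofNat_ne_zero 4), mul_comm] at h5
    exact hl (by exact_mod_cast h5)
  have hξ : ξ = 0 := by
    ext J
    obtain ⟨l, hl⟩ := hlam.neg.exists_hiWeight_ne J
    have h3 := congrFun (key l).1 J
    by_contra h4
    have h5 := mul_right_cancel₀ h4 (sub_eq_zero.1 h3)
    rw [← neg_div, div_eq_iff (OfNat.ofNat_ne_zero 4), mul_comm, neg_eq_iff_eq_neg,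
      ← mul_neg] at h5
    exact hl (by rw [Pi.neg_apply]; exact_mod_cast h5)
  rw [hc, hA, hη, hξ]
  change lo 0 + mid 0 + hi 0 = 0
  rw [lo_zero, mid_zero, hi_zero, add_zero, add_zero]

theorem lie_serreE_serreF_zero :
    ⁅(hi (Pi.single 15 1 : Spin k) : e6 k), lo (Pi.single 15 1 : Spin k)⁆ = serreH k 0 := by
  have hdot : (Pi.single 15 1 : Spin k) ⬝ᵥ Pi.single 15 1 = 1 := by simp
  refine eq_of_act ?_ (fun w => ?_) fun s => ?_
  · rw [act_lie_hi_lo, serreH, act_mid]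
    simp [hdot, corootDeg]
  · rw [act_lie_hi_lo, serreH, act_mid]
    refine Prod.ext (by simp) (Prod.ext (by simp) ?_)
    dsimp only
    rw [cartanElt_eq]
    ext (i | i) <;> rw [Pi.neg_apply, Pi.sub_apply, Matrix.mulVec_diagonal, Pi.smul_apply] <;>
      fin_cases i <;>
      simp [spinPair_apply, spinPairFun, spinMul_apply, spinMulFun, swap_apply, corootDeg,
        corootVec] <;> ring
  · rw [act_lie_hi_lo, serreH, act_mid]
    simp

theorem form_single_single (a b : Fin 5 ⊕ Fin 5) :
    form (Pi.single a 1 : Vec k) (Pi.single b 1) = if a = b.swap then 1 else 0 := by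
  rw [form_single_right, Pi.single_apply]
  exact if_congr eq_comm rfl rfl

theorem wedge_zero_right (u : Vec k) : wedge u 0 = 0 :=
  Subtype.ext (Matrix.ext fun i j => (wedge_apply u 0 i j).trans (by simp))

theorem wedge_neg_swap (u v : Vec k) : wedge u (-v) = wedge v u :=
  Subtype.ext (Matrix.ext fun i j => by
    rw [wedge_apply, wedge_apply, Pi.neg_apply, Pi.neg_apply]
    ring)

theorem lie_wedge_single_swap {a b : Fin 5 ⊕ Fin 5} (hab : a ≠ b) :
    ⁅wedge (Pi.single a 1 : Vec k) (Pi.single b 1 : Vec k),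
      wedge (Pi.single b.swap 1 : Vec k) (Pi.single a.swap 1 : Vec k)⁆ =
      wedge (Pi.single a 1) (Pi.single a.swap 1) + wedge (Pi.single b 1) (Pi.single b.swap 1) := by
  rw [lie_wedge, wedge_mulVec, wedge_mulVec]
  simp only [form_single_single, Sum.swap_swap, if_true, if_neg hab, if_neg hab.symm, one_smul,
    zero_smul, sub_zero, zero_sub, wedge_neg_swap]

theorem lie_wedge_single {a b d : Fin 5 ⊕ Fin 5} (hab : a ≠ b) (hbd : b ≠ d.swap)
    (had : a ≠ d.swap) : ⁅wedge (Pi.single a 1 : Vec k) (Pi.single b 1 : Vec k),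
      wedge (Pi.single b.swap 1 : Vec k) (Pi.single d 1 : Vec k)⁆ =
      wedge (Pi.single a 1) (Pi.single d 1) := by
  rw [lie_wedge, wedge_mulVec, wedge_mulVec]
  simp only [form_single_single, Sum.swap_swap, if_true, if_neg hab, if_neg hbd, if_neg had,
    one_smul, zero_smul, sub_zero, wedge_zero_right, add_zero]

theorem rootFst_ne_rootSnd (n : Fin 5) : rootFst n ≠ rootSnd n := by
  decide +revert

theorem wedge_swap_mulVec_single (a c : Fin 5 ⊕ Fin 5) :
    (wedge (Pi.single a 1 : Vec k) (Pi.single a.swap 1)).1.mulVec (Pi.single c 1) =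
      (((if c = a then 1 else 0) - if c = a.swap then 1 else 0 : ℤ) : k) • Pi.single c 1 := by
  rw [wedge_mulVec, form_single_single, form_single_single]
  by_cases h1 : c = a
  · subst h1
    have h2 : c ≠ c.swap := by decide +revert
    simp [h2]
  · by_cases h2 : c = a.swap
    · subst h2
      simp [h1, Ne.symm h1]
    · have h3 : a ≠ c.swap := fun h => h2 (by rw [h, Sum.swap_swap])
      have h4 : a.swap ≠ c.swap := fun h => h1 (by rw [← Sum.swap_swap a, h, Sum.swap_swap])
      rw [if_neg h1, if_neg h2, if_neg h3, if_neg h4]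
      simp

theorem vecWeight_succ (n : Fin 5) (c : Fin 5 ⊕ Fin 5) : vecWeight n.succ c =
    2 * (((if c = rootFst n then 1 else 0) - if c = (rootFst n).swap then 1 else 0) +
      ((if c = rootSnd n then 1 else 0) - if c = (rootSnd n).swap then 1 else 0)) := by
  decide +revert

theorem lie_serreE_serreF_self (i : Fin 6) : ⁅serreE k i, serreF k i⁆ = serreH k i := by
  induction i using Fin.cases with
  | zero => exact lie_serreE_serreF_zero
  | succ n =>
    rw [serreE, serreF, Fin.cons_succ, Fin.cons_succ, lie_mid_mid, serreH,
      lie_wedge_single_swap (rootFst_ne_rootSnd n)]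
    have h1 : (corootDeg n.succ : k) / 4 = 0 := by
      have h : corootDeg n.succ = 0 := by decide +revert
      rw [h, Int.cast_zero, zero_div]
    rw [h1]
    refine congrArg (fun A : so10 k => (mid (A, 0) : e6 k)) (Subtype.ext
      (Matrix.ext_of_mulVec_single fun c => ?_))
    change ((wedge (k := k) _ _).1 + (wedge (k := k) _ _).1).mulVec _ = _
    rw [Matrix.add_mulVec, wedge_swap_mulVec_single, wedge_swap_mulVec_single,
      cartanElt_mulVec_single, elim_corootVec, ← add_smul, vecWeight_succ, Int.cast_mul,
      Int.cast_ofNat, mul_div_cancel_left₀ _ (two_ne_zero (α := k)), Int.cast_add]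

/-- The bracket has weight `α_i - α_j`, of norm 12 or 18. -/
theorem lie_serreE_serreF_of_ne {i j : Fin 6} (hij : i ≠ j) : ⁅serreE k i, serreF k j⁆ = 0 := by
  refine eq_zero_of_isNotRoot (isNotRoot_sub hij) fun l => ?_
  rw [leibniz_lie, lie_serreH_serreE, lie_serreH_serreF, smul_lie, lie_smul, ← add_smul,
    Int.cast_sub, sub_eq_add_neg]

theorem lie_ad_pow {L : Type*} [LieRing L] [LieAlgebra k L] {H E X : L} {a b : k}
    (hE : ⁅H, E⁆ = a • E) (hX : ⁅H, X⁆ = b • X) (n : ℕ) :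
    ⁅H, (LieAlgebra.ad k L E ^ n) X⁆ = (n * a + b) • (LieAlgebra.ad k L E ^ n) X := by
  induction n with
  | zero => rw [pow_zero, Module.End.one_apply, hX, Nat.cast_zero, zero_mul, zero_add]
  | succ n ih =>
    rw [pow_succ', Module.End.mul_apply, LieAlgebra.ad_apply, leibniz_lie, hE, ih, smul_lie,
      lie_smul, ← add_smul]
    push_cast
    congr 1
    ring

theorem ad_serreE_pow_eq_zero {i j : Fin 6} (hij : i ≠ j) :
    (LieAlgebra.ad k (e6 k) (serreE k i) ^ (-CartanMatrix.E₆ i j).toNat)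
      ⁅serreE k i, serreE k j⁆ = 0 := by
  refine eq_zero_of_isNotRoot (isNotRoot_add hij) fun l => ?_
  have h : ⁅serreH k l, ⁅serreE k i, serreE k j⁆⁆ =
      (CartanMatrix.E₆ l i + CartanMatrix.E₆ l j : k) • ⁅serreE k i, serreE k j⁆ := by
    rw [leibniz_lie, lie_serreH_serreE, lie_serreH_serreE, smul_lie, lie_smul, ← add_smul]
  rw [lie_ad_pow (lie_serreH_serreE l i) h]
  push_cast
  rfl

theorem ad_serreF_pow_eq_zero {i j : Fin 6} (hij : i ≠ j) :
    (LieAlgebra.ad k (e6 k) (serreF k i) ^ (-CartanMatrix.E₆ i j).toNat)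
      ⁅serreF k i, serreF k j⁆ = 0 := by
  refine eq_zero_of_isNotRoot (isNotRoot_add hij).neg fun l => ?_
  have h : ⁅serreH k l, ⁅serreF k i, serreF k j⁆⁆ =
      (-CartanMatrix.E₆ l i + -CartanMatrix.E₆ l j : k) • ⁅serreF k i, serreF k j⁆ := by
    rw [leibniz_lie, lie_serreH_serreF, lie_serreH_serreF, smul_lie, lie_smul, ← add_smul]
  rw [lie_ad_pow (lie_serreH_serreF l i) h, Pi.neg_apply]
  push_cast
  congr 1
  ring

end Serre

/-! ### The Serre presentation -/

section Lift

variable {k : Type*} [CommRing k] {B : Type*} [DecidableEq B] (CM : Matrix B B ℤ)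
  {L : Type*} [LieRing L] [LieAlgebra k L]

/-- Descend a homomorphism of Lie algebras to the quotient by an ideal contained in the kernel. -/
def quotientLift {L' : Type*} [LieRing L'] [LieAlgebra k L'] (I : LieIdeal k L) (f : L →ₗ⁅k⁆ L')
    (h : I ≤ f.ker) : (L ⧸ I) →ₗ⁅k⁆ L' :=
  { I.toSubmodule.liftQ (f : L →ₗ[k] L') fun x hx => f.mem_ker.1 (h hx) with
    map_lie' := by
      intro x y
      induction x using Quotient.inductionOn'
      induction y using Quotient.inductionOn'
      exact f.map_lie _ _ }

/-- Elements that satisfy the Serre relations define a homomorphism from the Lie algebra of a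
Cartan matrix. -/
theorem exists_hom_of_serre {H E F : B → L}
    (hHH : ∀ i j, ⁅H i, H j⁆ = 0)
    (hEF : ∀ i, ⁅E i, F i⁆ = H i) (hEF' : ∀ i j, i ≠ j → ⁅E i, F j⁆ = 0)
    (hHE : ∀ i j, ⁅H i, E j⁆ = (CM i j : k) • E j)
    (hHF : ∀ i j, ⁅H i, F j⁆ = (-CM i j : k) • F j)
    (hE : ∀ i j, i ≠ j → (LieAlgebra.ad k L (E i) ^ (-CM i j).toNat) ⁅E i, E j⁆ = 0)
    (hF : ∀ i j, i ≠ j → (LieAlgebra.ad k L (F i) ^ (-CM i j).toNat) ⁅F i, F j⁆ = 0) :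
    ∃ θ : CM.ToLieAlgebra k →ₗ⁅k⁆ L, ∀ i, E i ∈ θ.range ∧ F i ∈ θ.range := by
  set f : FreeLieAlgebra k (CartanMatrix.Generators B) →ₗ⁅k⁆ L :=
    FreeLieAlgebra.lift k fun x => CartanMatrix.Generators.rec H E F x with hf
  have fH : ∀ i, f (FreeLieAlgebra.of k (.H i)) = H i := fun i => FreeLieAlgebra.lift_of_apply _ _
  have fE : ∀ i, f (FreeLieAlgebra.of k (.E i)) = E i := fun i => FreeLieAlgebra.lift_of_apply _ _
  have fF : ∀ i, f (FreeLieAlgebra.of k (.F i)) = F i := fun i => FreeLieAlgebra.lift_of_apply _ _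
  have fpow : ∀ (x y : FreeLieAlgebra k (CartanMatrix.Generators B)) (n : ℕ),
      f ((LieAlgebra.ad k _ x ^ n) y) = (LieAlgebra.ad k L (f x) ^ n) (f y) := by
    intro x y n
    induction n with
    | zero => rfl
    | succ n ih =>
      rw [pow_succ', pow_succ', Module.End.mul_apply, Module.End.mul_apply, LieAlgebra.ad_apply,
        LieAlgebra.ad_apply, f.map_lie, ih]
  have hle : CartanMatrix.Relations.toIdeal k CM ≤ f.ker := by
    refine LieSubmodule.lieSpan_le.2 ?_
    rintro x (((((⟨⟨i, j⟩, rfl⟩ | ⟨⟨i, j⟩, rfl⟩) | ⟨⟨i, j⟩, rfl⟩) | ⟨⟨i, j⟩, rfl⟩) |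
      ⟨⟨i, j⟩, rfl⟩) | ⟨⟨i, j⟩, rfl⟩) <;> refine f.mem_ker.2 ?_
    · change f ⁅FreeLieAlgebra.of k _, FreeLieAlgebra.of k _⁆ = 0
      rw [f.map_lie, fH, fH, hHH]
    · change f (if i = j then ⁅FreeLieAlgebra.of k _, FreeLieAlgebra.of k _⁆ -
        FreeLieAlgebra.of k _ else ⁅FreeLieAlgebra.of k _, FreeLieAlgebra.of k _⁆) = 0
      split_ifs with hij
      · rw [map_sub, f.map_lie, fH, fE, fF, hEF, sub_self]
      · rw [f.map_lie, fE, fF, hEF' i j hij]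
    · change f (⁅FreeLieAlgebra.of k _, FreeLieAlgebra.of k _⁆ -
        CM i j • FreeLieAlgebra.of k _) = 0
      rw [map_sub, f.map_lie, map_zsmul, fH, fE, hHE, Int.cast_smul_eq_zsmul, sub_self]
    · change f (⁅FreeLieAlgebra.of k _, FreeLieAlgebra.of k _⁆ +
        CM i j • FreeLieAlgebra.of k _) = 0
      rw [map_add, f.map_lie, map_zsmul, fH, fF, hHF, neg_smul, Int.cast_smul_eq_zsmul,
        neg_add_cancel]
    · change f ((LieAlgebra.ad k _ (FreeLieAlgebra.of k _) ^ (-CM i j).toNat)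
        ⁅FreeLieAlgebra.of k _, FreeLieAlgebra.of k _⁆) = 0
      rw [fpow, f.map_lie, fE, fE]
      -- The defining relations range over all pairs; those with `i = j` hold because the inner
      -- bracket is zero.
      rcases eq_or_ne i j with rfl | hij
      · rw [lie_self, map_zero]
      · exact hE i j hij
    · change f ((LieAlgebra.ad k _ (FreeLieAlgebra.of k _) ^ (-CM i j).toNat)
        ⁅FreeLieAlgebra.of k _, FreeLieAlgebra.of k _⁆) = 0
      rw [fpow, f.map_lie, fF, fF]
      rcases eq_or_ne i j with rfl | hij
      · rw [lie_self, map_zero]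
      · exact hF i j hij
  refine ⟨quotientLift _ f hle, fun i => ⟨?_, ?_⟩⟩
  · exact ⟨LieSubmodule.Quotient.mk (FreeLieAlgebra.of k (.E i)), fE i⟩
  · exact ⟨LieSubmodule.Quotient.mk (FreeLieAlgebra.of k (.F i)), fF i⟩

end Lift

/-! ### Generation by simple root vectors. -/

section Generation

/-- A relation on the weights of the vector representation of `𝔰𝔬₁₀` that contains the simple
roots and their negatives and is closed under addition of roots contains all roots. The root
attached to `(a, b)` is the difference of the weights `a` and `b`. -/
theorem root_induction {T : Fin 5 ⊕ Fin 5 → Fin 5 ⊕ Fin 5 → Prop}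
    (hself : ∀ a, T a a.swap) (hswap : ∀ a b, T a b → T b.swap a.swap)
    (htrans : ∀ a b d, a ≠ b.swap → b ≠ d.swap → a ≠ d → T a b → T b d → T a d)
    (hroot : ∀ n, T (rootFst n) (rootSnd n).swap) (hroot' : ∀ n, T (rootSnd n).swap (rootFst n))
    {a b : Fin 5 ⊕ Fin 5} (hab : a ≠ b) : T a b := by
  have h43 : T (.inl 4) (.inl 3) := hroot' 1
  have h32 : T (.inl 3) (.inl 2) := hroot' 2
  have h21 : T (.inl 2) (.inl 1) := hroot' 3
  have h10 : T (.inl 1) (.inl 0) := hroot' 4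
  have h34 : T (.inl 3) (.inl 4) := hroot 1
  have h23 : T (.inl 2) (.inl 3) := hroot 2
  have h12 : T (.inl 1) (.inl 2) := hroot 3
  have h01 : T (.inl 0) (.inl 1) := hroot 4
  have k43 : T (.inl 4) (.inr 3) := hswap _ _ (hroot 0)
  have k34 : T (.inr 3) (.inl 4) := hswap _ _ (hroot' 0)
  have h42 := htrans _ _ _ (by decide) (by decide) (by decide) h43 h32
  have h41 := htrans _ _ _ (by decide) (by decide) (by decide) h42 h21
  have h40 := htrans _ _ _ (by decide) (by decide) (by decide) h41 h10
  have k42 := htrans _ _ _ (by decide) (by decide) (by decide) k43 (hswap _ _ h23)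
  have k41 := htrans _ _ _ (by decide) (by decide) (by decide) k42 (hswap _ _ h12)
  have k40 := htrans _ _ _ (by decide) (by decide) (by decide) k41 (hswap _ _ h01)
  have h24 := htrans _ _ _ (by decide) (by decide) (by decide) h23 h34
  have h14 := htrans _ _ _ (by decide) (by decide) (by decide) h12 h24
  have h04 := htrans _ _ _ (by decide) (by decide) (by decide) h01 h14
  have k24 := htrans _ _ _ (by decide) (by decide) (by decide) (hswap _ _ h32) k34
  have k14 := htrans _ _ _ (by decide) (by decide) (by decide) (hswap _ _ h21) k24
  have k04 := htrans _ _ _ (by decide) (by decide) (by decide) (hswap _ _ h10) k14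
  -- The weight `inl 4` serves as a hub: it is joined to every other weight in both directions, and
  -- a general root is the composite of two steps through it.
  have hl : ∀ a : Fin 5 ⊕ Fin 5, a ≠ .inl 4 → T (.inl 4) a := by
    rintro (i | i) hi <;> fin_cases i
    exacts [h40, h41, h42, h43, absurd rfl hi, k40, k41, k42, k43, hself _]
  have hr : ∀ a : Fin 5 ⊕ Fin 5, a ≠ .inl 4 → T a (.inl 4) := by
    rintro (i | i) hi <;> fin_cases i
    exacts [h04, h14, h24, h34, absurd rfl hi, k04, k14, k24, k34, hself _]
  have hne : ∀ {x y : Fin 5 ⊕ Fin 5}, x ≠ y.swap → x.swap ≠ y := fun h h' => h (by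
    rw [← h', Sum.swap_swap])
  by_cases ha : a = .inl 4
  · subst ha
    exact hl b hab.symm
  by_cases hb : b = .inl 4
  · subst hb
    exact hr a ha
  by_cases ha' : a = (Sum.inl 4 : Fin 5 ⊕ Fin 5).swap
  · subst ha'
    have := hswap _ _ (hr b.swap (hne (y := .inl 4) fun h => hab h.symm))
    rwa [Sum.swap_swap] at this
  by_cases hb' : b = (Sum.inl 4 : Fin 5 ⊕ Fin 5).swap
  · subst hb'
    have := hswap _ _ (hl a.swap (hne (y := .inl 4) hab))
    rwa [Sum.swap_swap] at this
  exact htrans a (.inl 4) b ha' (fun h => hb' (by rw [h, Sum.swap_swap])) hab (hr a ha) (hl b hb)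

variable {k : Type*} [Field k] [IsAlgClosed k] [CharZero k]

theorem wedge_swap (u v : Vec k) : wedge v u = -wedge u v :=
  Subtype.ext (Matrix.ext fun i j => by
    change (wedge v u).1 i j = -(wedge u v).1 i j
    rw [wedge_apply, wedge_apply]
    ring)

/-- A subspace of `𝔰𝔬₁₀` closed under brackets that contains the simple root vectors and their
negatives is everything. -/
theorem eq_top_of_simple_roots {U : LieSubalgebra k (so10 k)}
    (hE : ∀ n, wedge (Pi.single (rootFst n) 1) (Pi.single (rootSnd n) 1) ∈ U)
    (hF : ∀ n, wedge (Pi.single (rootSnd n).swap 1) (Pi.single (rootFst n).swap 1) ∈ U)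
    (A : so10 k) : A ∈ U := by
  have hself : ∀ u : Vec k, wedge u u ∈ U := by
    intro u
    have h : wedge u u = 0 := Subtype.ext (Matrix.ext fun i j =>
      (wedge_apply u u i j).trans (sub_self _))
    rw [h]
    exact U.zero_mem
  have hroot : ∀ a b : Fin 5 ⊕ Fin 5, a ≠ b.swap →
      wedge (Pi.single a 1 : Vec k) (Pi.single b 1) ∈ U := by
    intro a b hab
    rw [← Sum.swap_swap b]
    refine root_induction (T := fun a b =>
      wedge (Pi.single a 1 : Vec k) (Pi.single b.swap 1) ∈ U) ?_ ?_ ?_ ?_ ?_ hab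
    · intro a
      rw [Sum.swap_swap]
      exact hself _
    · intro a b h
      rw [Sum.swap_swap, wedge_swap]
      exact U.neg_mem h
    · intro a b d h1 h2 h3 h h'
      have h4 := lie_wedge_single (k := k) (d := d.swap) h1 (by
        rw [Sum.swap_swap]
        exact fun h => h2 (by rw [← h, Sum.swap_swap])) (by rwa [Sum.swap_swap])
      rw [← h4]
      refine U.lie_mem h ?_
      rwa [Sum.swap_swap]
    · intro n
      rw [Sum.swap_swap]
      exact hE n
    · intro n
      exact hF n
  -- Brackets of opposite root vectors give the sum and the difference of the diagonal elements for
  -- `a` and `b`; half of their total is the one for `a`.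
  have hdiag : ∀ a : Fin 5 ⊕ Fin 5, wedge (Pi.single a 1 : Vec k) (Pi.single a.swap 1) ∈ U := by
    intro a
    obtain ⟨b, h1, h2⟩ : ∃ b, a ≠ b ∧ a ≠ b.swap := by decide +revert
    have h3 : a.swap ≠ b := fun h => h2 (by rw [← h, Sum.swap_swap])
    have h4 := U.lie_mem (hroot a b h2) (hroot b.swap a.swap (by
      rw [Sum.swap_swap]
      exact fun h => h2 h.symm))
    have h5 := U.lie_mem (hroot a b.swap (by rwa [Sum.swap_swap])) (hroot b.swap.swap a.swap (by
      rw [Sum.swap_swap, Sum.swap_swap]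
      exact h1.symm))
    rw [lie_wedge_single_swap h1] at h4
    rw [lie_wedge_single_swap h2, Sum.swap_swap, wedge_swap (Pi.single b 1)] at h5
    have h6 := U.smul_mem (2⁻¹ : k) (U.add_mem h4 h5)
    rw [add_add_add_comm, add_neg_cancel, add_zero, ← two_smul k, smul_smul,
      inv_mul_cancel₀ two_ne_zero, one_smul] at h6
    exact h6
  rw [eq_sum_wedge A]
  refine U.smul_mem _ (sum_mem fun a _ => sum_mem fun b _ => U.smul_mem _ ?_)
  by_cases hab : b = a
  · subst hab
    exact hdiag b
  · exact hroot _ _ (by rwa [Sum.swap_swap])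

/-- A subalgebra of `E₆` that contains the Chevalley generators is everything. -/
theorem eq_top_of_serre {R : LieSubalgebra k (e6 k)} (hE : ∀ i, serreE k i ∈ R)
    (hF : ∀ i, serreF k i ∈ R) (X : e6 k) : X ∈ R := by
  have hso : ∀ A : so10 k, mid (A, 0) ∈ R := by
    let U : LieSubalgebra k (so10 k) :=
      { R.toSubmodule.comap (mid.comp (LinearMap.inl k (so10 k) k)) with
        lie_mem' := by
          intro A B hA hB
          change mid (⁅A, B⁆, 0) ∈ R
          have h := R.lie_mem (x := mid (A, 0)) (y := mid (B, 0)) hA hB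
          rwa [lie_mid_mid] at h }
    exact eq_top_of_simple_roots (U := U) (fun n => hE n.succ) fun n => hF n.succ
  have hone : (Pi.single 15 1 : Spin k) ≠ 0 := single_one_ne_zero _
  have hlo : ∀ ξ : Spin k, lo ξ ∈ R := by
    rcases spinAct_irreducible (R.toSubmodule.comap (lo : Spin k →ₗ[k] e6 k)) (by
      intro A s hs
      have h := R.lie_mem (hso A) hs
      rwa [lie_mid_lo, zero_smul, sub_zero] at h) with h | h
    · have h1 : Pi.single 15 1 ∈ R.toSubmodule.comap (lo : Spin k →ₗ[k] e6 k) := hF 0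
      rw [h] at h1
      exact absurd h1 hone
    · intro ξ
      have h1 : ξ ∈ R.toSubmodule.comap (lo : Spin k →ₗ[k] e6 k) := h ▸ Submodule.mem_top
      exact h1
  have hhi : ∀ η : Spin k, hi η ∈ R := by
    rcases spinAct_irreducible (R.toSubmodule.comap (hi : Spin k →ₗ[k] e6 k)) (by
      intro A s hs
      have h := R.lie_mem (hso (dual A)) hs
      rwa [lie_mid_hi_dual, dual_dual] at h) with h | h
    · have h1 : Pi.single 15 1 ∈ R.toSubmodule.comap (hi : Spin k →ₗ[k] e6 k) := hE 0
      rw [h] at h1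
      exact absurd h1 hone
    · intro η
      have h1 : η ∈ R.toSubmodule.comap (hi : Spin k →ₗ[k] e6 k) := h ▸ Submodule.mem_top
      exact h1
  -- The coroot `serreH 0` has central component `3/4 ≠ 0`, so together with `𝔰𝔬₁₀` it yields the
  -- center of `𝔤(0)`.
  have hmid : ∀ (A : so10 k) (c : k), mid (A, c) ∈ R := by
    intro A c
    have h := R.lie_mem (hE 0) (hF 0)
    rw [lie_serreE_serreF_self, serreH] at h
    have hdeg : (corootDeg 0 : k) / 4 ≠ 0 := by
      simp [corootDeg]
    have h1 := R.add_mem (R.smul_mem (c / ((corootDeg 0 : k) / 4)) h)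
      (hso (A - (c / ((corootDeg 0 : k) / 4)) • cartanElt fun j => (corootVec 0 j : k) / 2))
    rw [← map_smul, ← map_add, Prod.smul_mk, Prod.mk_add_mk, add_sub_cancel, add_zero, smul_eq_mul,
      div_mul_cancel₀ _ hdeg] at h1
    exact h1
  obtain ⟨ξ, ⟨A, c⟩, η, rfl⟩ := exists_decomp X
  exact R.add_mem (R.add_mem (hlo ξ) (hmid A c)) (hhi η)

variable (k) in
theorem exists_surjective_hom : ∃ θ : LieAlgebra.e₆ k →ₗ⁅k⁆ e6 k, Function.Surjective θ := by
  obtain ⟨θ, hθ⟩ := exists_hom_of_serre CartanMatrix.E₆ (lie_serreH_serreH (k := k))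
    lie_serreE_serreF_self (fun _ _ => lie_serreE_serreF_of_ne) lie_serreH_serreE
    lie_serreH_serreF (fun _ _ => ad_serreE_pow_eq_zero) fun _ _ => ad_serreF_pow_eq_zero
  exact ⟨θ, fun X => (θ.mem_range X).1 <|
    eq_top_of_serre (fun i => (hθ i).1) (fun i => (hθ i).2) X⟩

end Generation

/-! ### The main statements -/

section Main

variable {k : Type*} [Field k] [IsAlgClosed k] [CharZero k]

theorem hi_single_ne_zero (J : Fin 16) : hi (Pi.single J 1 : Spin k) ≠ 0 := fun h =>
  single_one_ne_zero J (by rw [← hiPart_hi (Pi.single J 1 : Spin k), h, LinearMap.map_zero])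

theorem quarticFun_eq_zero {c : Submodule k (e6 k)} (hc : IsCartanSubspace (g1 k) c)
    (x y : g k 1) (h : ((x : e6 k), (y : e6 k)) ∈
      closure[zariski k (e6 k × e6 k)] (sweep (gradingElt k) c)) :
    quarticFun (hiCoord k) (x, y) = 0 := by
  have h1 := quartic_eq_zero_of_mem_closure_sweep hc h
  rw [← hiCoord_apply x, ← hiCoord_apply y] at h1
  exact h1

variable (k) in
theorem exists_cartanSubspace : ∃ c, IsCartanSubspace (g1 k) c ∧ Module.finrank k c = 2 ∧
    (∃ v₁ v₂ : e6 k, v₁ ≠ 0 ∧ v₂ ≠ 0 ∧ IsWeightVector (so10Ad (midEquiv k)) (pi5 k) v₁ ∧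
      IsWeightVector (so10Ad (midEquiv k)) (pi5' k) v₂ ∧
      projOne (gradingElt k) c = Submodule.span k {v₁, v₂}) ∧
    ∃ lam : kˣ →* (e6 k ≃ₗ[k] e6 k), (∀ t, lam t ∈ SO10 (midEquiv k)) ∧
      IsMultOneParam (so10Embedding (midEquiv k) (cartanElt ![2, 0, 0, 0, 0])) lam ∧
      ∀ v ∈ projOne (gradingElt k) c, ContractsToZero lam v :=
  ⟨LinearMap.range (cartanMap k), isCartanSubspace_range_cartanMap, finrank_range_cartanMap,
    ⟨_, _, hi_single_ne_zero 0, hi_single_ne_zero 14, isWeightVector_pi5, isWeightVector_pi5',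
      projOne_range_cartanMap⟩, exists_isMultOneParam_contracting⟩

end Main

end E6Pair

theorem mainTheorem4 (k : Type*) [Field k] [IsAlgClosed k] [CharZero k] :
    -- `E6Pair.e6 k` is of type `E₆`
    (∃ θ : LieAlgebra.e₆ k →ₗ⁅k⁆ E6Pair.e6 k, Function.Surjective θ) ∧
    -- it has the short grading `𝔤(-1) ⊕ 𝔤(0) ⊕ 𝔤(1)`
    E6Pair.g k (-1) ⊔ E6Pair.g k 0 ⊔ E6Pair.g k 1 = ⊤ ∧
    -- `C(𝔤₁)` is reducible
    ¬ @IsIrreducible _ (E6Pair.zariski k (E6Pair.e6 k × E6Pair.e6 k))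
        (E6Pair.commutingVariety (E6Pair.g1 k)) ∧
    -- condition (♠) fails
    (∀ c, E6Pair.IsCartanSubspace (E6Pair.g1 k) c → ¬ E6Pair.Spade (E6Pair.gradingElt k) c) ∧
    -- `𝔤(0) = 𝔰𝔬₁₀ ⊕ k`, with the two half-spinor representations on `𝔤(1)` and `𝔤(-1)`
    ∃ ψ : (E6Pair.so10 k × k) ≃ₗ⁅k⁆ E6Pair.g0 k,
      E6Pair.IsHighestWeightIrrep (E6Pair.so10Ad ψ) (E6Pair.pi5 k) (E6Pair.g k 1) ∧
      E6Pair.IsHighestWeightIrrep (E6Pair.so10Ad ψ) (E6Pair.pi4 k) (E6Pair.g k (-1)) ∧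
      -- a Cartan subspace of dimension 2 with `c(1)` spanned by two weight vectors, and a
      -- one-parameter subgroup of the group of `𝔰𝔬₁₀` that contracts `c(1) × c(1)` to `0`
      (∃ c, E6Pair.IsCartanSubspace (E6Pair.g1 k) c ∧ Module.finrank k c = 2 ∧
        (∃ v₁ v₂ : E6Pair.e6 k, v₁ ≠ 0 ∧ v₂ ≠ 0 ∧
          E6Pair.IsWeightVector (E6Pair.so10Ad ψ) (E6Pair.pi5 k) v₁ ∧
          E6Pair.IsWeightVector (E6Pair.so10Ad ψ) (E6Pair.pi5' k) v₂ ∧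
          E6Pair.projOne (E6Pair.gradingElt k) c = Submodule.span k {v₁, v₂}) ∧
        ∃ lam : kˣ →* (E6Pair.e6 k ≃ₗ[k] E6Pair.e6 k),
          (∀ t, lam t ∈ E6Pair.SO10 ψ) ∧
          E6Pair.IsMultOneParam
            (E6Pair.so10Embedding ψ (E6Pair.cartanElt ![2, 0, 0, 0, 0])) lam ∧
          ∀ v ∈ E6Pair.projOne (E6Pair.gradingElt k) c, E6Pair.ContractsToZero lam v) ∧
      -- the invariant of degree 4
      ∃ W : Submodule k (QuadraticForm k (E6Pair.g k 1)),
        E6Pair.IsHighestWeightIrrep (E6Pair.so10Quad ψ) (E6Pair.pi1 k) W ∧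
        ∃ f : E6Pair.g k 1 × E6Pair.g k 1 → k,
          f ≠ 0 ∧
          E6Pair.IsHomogeneousPolyFun k 4 f ∧
          E6Pair.IsInvariant (E6Pair.SO10 ψ) f ∧
          f ∈ E6Pair.tensorSquare W ∧
          (∀ f' ∈ E6Pair.tensorSquare W, E6Pair.IsInvariant (E6Pair.SO10 ψ) f' →
            ∃ a : k, f' = a • f) ∧
          -- `f` vanishes on the closure of `G₀ (c(1) × c(1))`
          ∀ c, E6Pair.IsCartanSubspace (E6Pair.g1 k) c → ∀ x y : E6Pair.g k 1,
            ((x : E6Pair.e6 k), (y : E6Pair.e6 k)) ∈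
                closure[E6Pair.zariski k (E6Pair.e6 k × E6Pair.e6 k)]
                  (E6Pair.sweep (E6Pair.gradingElt k) c) →
              f (x, y) = 0 :=
  ⟨E6Pair.exists_surjective_hom k, E6Pair.g_sup_eq_top k,
    E6Pair.not_isIrreducible_commutingVariety k, fun _ hc => E6Pair.not_spade hc,
    E6Pair.midEquiv k, E6Pair.isHighestWeightIrrep_g_one k,
    E6Pair.isHighestWeightIrrep_g_neg_one k, E6Pair.exists_cartanSubspace k,
    LinearMap.range (E6Pair.vecQuad (E6Pair.hiCoord k)), E6Pair.isHighestWeightIrrep_so10Quad k,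
    E6Pair.quarticFun (E6Pair.hiCoord k), E6Pair.quarticFun_ne_zero E6Pair.hiCoord_surjective,
    E6Pair.isHomogeneousPolyFun_quarticFun _, E6Pair.isInvariant_quarticFun,
    E6Pair.quarticFun_mem_tensorSquare, fun _ h1 h2 => E6Pair.eq_smul_quarticFun h1 h2,
    fun _ hc => E6Pair.quarticFun_eq_zero hc⟩
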